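/- Let $d\ge 1$ and use the Fourier transform $\widehat f(\xi)=\int_{\mathbb R^d} e^{-i\langle x,\xi\rangle}f(x)\,dx$ with inverse $\mathcal F^{-1}$. Fix $\chi_+\in C_c^\infty(\mathbb R)$, real valued and supported in $(1/2,2)$, with $\sum_{j\in\mathbb Z}\chi_+(2^jt)=1$ for all $t>0$, and let $\eta(\xi)=\chi_+(|\xi|)$ on $\mathbb R^d$. Let $\alpha>d$ and let $\|g\|_{\mathscr L^1_\alpha}=\|(I-\Delta)^{\alpha/2}g\|_{L^1}$ (with value $\infty$ if $(I-\Delta)^{\alpha/2}g\notin L^1$). Then there is a finite constant $C$, depending only on $d$, $\alpha$ and the fixed function $\chi_+$, such that the following holds. Let $m:\mathbb R^d\to\mathbb C$ satisfy $$B(m):=\sup_{t>0}\|\eta\, m(t\,\cdot)\|_{\mathscr L^1_\alpha}<\infty .$$ For Schwartz functions $f$ put $Sf=\mathcal F^{-1}[m\widehat f\,]$ and, for $n\in\mathbb Z$, $S_nf=\mathcal F^{-1}\big[\sum_{j\le n}\eta(2^{-j}\cdot)\,m\,\widehat f\,\big]$. Let $1\le p<\infty$ and $f\in L^p(\mathbb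 R^d)$. Then $Sf$ and all $S_nf$ are well defined by continuous extension from Schwartz functions: there are measurable functions $Sf$, $S_nf$ such that $S\varphi_k\to Sf$ and $S_n\varphi_k\to S_nf$ in measure whenever $\varphi_k$ are Schwartz functions with $\varphi_k\to f$ in $L^p$ (as Schwartz functions are dense in $L^p$, this determines them up to null sets). Moreover, for every $r>0$, for almost every $x\in\mathbb R^d$ and all $0<\delta\le 1/2$, $$\sup_{n\in\mathbb Z}|S_nf(x)|\le \frac{1}{(1-\delta)^{1/r}}\big(M(|Sf|^r)(x)\big)^{1/r}+C\,\delta^{-1}B(m)\,Mf(x),$$ where $Mg(x)=\sup_{\rho>0}|B(x,\rho)|^{-1}\int_{B(x,\rho)}|g(y)|\,dy$ is the centered Hardy–Littlewood maximal function (the right-hand side may be infinite). -/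

import Mathlib

open MeasureTheory Filter Topology Set
open scoped ENNReal NNReal FourierTransform SchwartzMap ContDiff

noncomputable section

namespace Cotlar

/-- The Euclidean space `ℝ^d`. -/
abbrev E (d : ℕ) := EuclideanSpace ℝ (Fin d)

/-- A one-dimensional dyadic partition of unity: `χ ∈ C_c^∞(ℝ)` is supported in `(1/2, 2)` and
`∑_{j ∈ ℤ} χ(2^j t) = 1` for all `t > 0`. (For every `t > 0` at most two terms are nonzero.) -/
structure IsDyadicPartition (χ : ℝ → ℝ) : Prop where
  contDiff : ContDiff ℝ ∞ χ
  tsupport_subset : tsupport χ ⊆ Ioo (1 / 2) 2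
  sum_eq_one : ∀ t : ℝ, 0 < t → ∑' j : ℤ, χ ((2 : ℝ) ^ j * t) = 1

/-- `h ∈ L^1` represents `(I - Δ)^{α/2} g`, where `g ∈ L^1`. Mathlib's Fourier transform is
`𝓕 g ξ = ∫ e^{-2πi⟨x,ξ⟩} g(x) dx`, so that the symbol of `I - Δ` is `1 + |2πξ|^2`. Since both
functions are integrable, the identity of Fourier transforms is the identity
`(I - Δ)^{α/2} g = h` of tempered distributions, and it determines `h` almost everywhere.
(For `α ≥ 0` every `g` with `(I - Δ)^{α/2} g ∈ L^1` is itself integrable.) -/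
def IsBesselDerivative {d : ℕ} (α : ℝ) (g h : E d → ℂ) : Prop :=
  Integrable g volume ∧ Integrable h volume ∧
    ∀ ξ : E d, 𝓕 h ξ = (((1 + ‖(2 * Real.pi) • ξ‖ ^ 2) ^ (α / 2) : ℝ) : ℂ) * 𝓕 g ξ

/-- The norm `‖(I - Δ)^{α/2} g‖_1` of the potential space `𝓛^1_α`; it is `∞` when `g` does not
belong to that space. -/
def potentialNorm {d : ℕ} (α : ℝ) (g : E d → ℂ) : ℝ≥0∞ :=
  ⨅ (h : E d → ℂ) (_ : IsBesselDerivative α g h), eLpNorm h 1 volume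

/-- `B(m) = sup_{t > 0} ‖η m(t ·)‖_{𝓛^1_α}`, with `η = χ(|·|)`. -/
def multiplierConst {d : ℕ} (χ : ℝ → ℝ) (α : ℝ) (m : E d → ℂ) : ℝ≥0∞ :=
  ⨆ (t : ℝ) (_ : 0 < t), potentialNorm α fun ξ : E d => (χ ‖ξ‖ : ℂ) * m (t • ξ)

/-- The truncated multiplier `∑_{j ≤ n} η(2^{-j} ξ) m(ξ)`, with `η = χ(|·|)`. -/
def truncMultiplier {d : ℕ} (χ : ℝ → ℝ) (m : E d → ℂ) (n : ℤ) (ξ : E d) : ℂ :=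
  ∑' j : Iic n, (χ ‖(2 : ℝ) ^ (-(j : ℤ)) • ξ‖ : ℂ) * m ξ

/-- The multiplier operator `φ ↦ 𝓕⁻¹[m φ̂]` on Schwartz functions, for the Fourier transform
`φ̂(ξ) = ∫ e^{-i⟨x,ξ⟩} φ(x) dx`. In terms of Mathlib's transform `φ̂(2πξ) = 𝓕 φ ξ`, and the
substitution `ξ → 2πξ` in
`(2π)^{-d} ∫ e^{i⟨x,ξ⟩} m(ξ) φ̂(ξ) dξ` gives the formula below. -/
def schwartzMultiplierOp {d : ℕ} (m : E d → ℂ) (φ : 𝓢(E d, ℂ)) : E d → ℂ :=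
  𝓕⁻ fun ξ : E d => m ((2 * Real.pi) • ξ) * 𝓕 (φ : E d → ℂ) ξ

/-- `g` is the image of `f ∈ L^p` (`1 ≤ p < ∞`) under the multiplier operator with symbol `m`,
extended from Schwartz functions to `L^p` by continuity. The extension is taken with respect to
convergence in measure, which covers the operators that are bounded on `L^p` as well as those that
are only of weak type `(1,1)`. As Schwartz functions are dense in `L^p`, this determines `g`
almost everywhere. -/
def IsMultiplierImage {d : ℕ} (m : E d → ℂ) (p : ℝ≥0∞) (f g : E d → ℂ) : Prop :=
  AEStronglyMeasurable g volume ∧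
    ∀ φ : ℕ → 𝓢(E d, ℂ),
      Tendsto (fun k => eLpNorm (fun x => φ k x - f x) p volume) atTop (𝓝 0) →
        TendstoInMeasure volume (fun k => schwartzMultiplierOp m (φ k)) atTop g

/-- The (centered) Hardy--Littlewood maximal function
`M u(x) = sup_{ρ > 0} |B(x,ρ)|⁻¹ ∫_{B(x,ρ)} u`, for nonnegative `u`. -/
def maximalFunction {d : ℕ} (u : E d → ℝ≥0∞) (x : E d) : ℝ≥0∞ :=
  ⨆ (ρ : ℝ) (_ : 0 < ρ), ⨍⁻ y in Metric.ball x ρ, u y ∂volume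

end Cotlar

end

/-! Each dyadic piece of `m` is a dilate of a function `η m(2^j ·)` whose norm in the potential
space is at most `B(m)`. The Fourier transform of `(I - Δ)^{α/2} g` is bounded by its `L¹` norm, so
the kernel `K_j` of the piece satisfies `|K_j(x)| ≤ C B 2^{jd} (1 + 2^j|x|)^{-β}`. Compact frequency
support makes it Lipschitz at scale `2^{-j}` with the same decay. The exponent `β` is fixed with `d
< β ≤ α` and `β < d + 1`.

Well-definedness: finite sums of the `K_j` are Calderón–Zygmund kernels with one constant
(`exists_isCalderonZygmundKernel`). Hence they are of weak type (p,p) uniformly: the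
Calderón–Zygmund decomposition gives p = 1, cutting the function at the level gives `p ≤ 2`, and
duality gives `p > 2`. The symbols of `S` and `S_n` are almost everywhere limits of these sums, so
the estimates pass to `S` and `S_n`, which then extend to `L^p` in measure.

Pointwise inequality: fix `x`, `n` and the ball of radius `2^{-n}` about `x`, and let `U` be the
average of `|f|` against the weight `2^{nd} (1 + 2^n|x - z|)^{-β}`, so that `U ≤ C Mf(x)`. For `y`
in the ball, `|S_n f(x) - S_n f(y)| ≤ C B U`, because the scales `j ≤ n` gain a factor `2^{j-n}`
from smoothness (`exists_enorm_conv_low_sub_le`). The high part `Sf - S_n f` is controlled by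
splitting `f` at the double ball: the far part contributes at most `C B U` pointwise, and the near
part obeys the weak type (1,1) estimate (`exists_local_weak_type`). At a level of order `B U / δ`
the exceptional set fills at most the fraction `δ` of the ball. On the rest, `|S_n f(x)| ≤ |Sf(y)| +
C δ⁻¹ B U`, and Chebyshev's inequality for the `r`-th power yields the average of `|Sf|^r` with the
factor `(1 - δ)^{-1/r}` (`le_average_rpow_add`). -/

namespace Cotlar

variable {d : ℕ}

/-! ### Convolution -/

/-- The convolution of `f` with the kernel `K`. -/
noncomputable def conv (K f : E d → ℂ) (x : E d) : ℂ := ∫ z, f z * K (x - z)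

theorem integrable_prod_conv {K f : E d → ℂ} (hK : Integrable K) (hf : Integrable f) :
    Integrable (fun p : E d × E d => f p.2 * K (p.1 - p.2)) (volume.prod volume) :=
  hf.convolution_integrand (ContinuousLinearMap.mul ℂ ℂ) hK

theorem integrable_conv {K f : E d → ℂ} (hK : Integrable K) (hf : Integrable f) :
    Integrable (conv K f) :=
  hf.integrable_convolution (ContinuousLinearMap.mul ℂ ℂ) hK

theorem ae_integrable_conv {K f : E d → ℂ} (hK : Integrable K) (hf : Integrable f) :
    ∀ᵐ x, Integrable fun z => f z * K (x - z) :=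
  (integrable_prod_conv hK hf).prod_right_ae

theorem conv_add_ae {K f g : E d → ℂ} (hK : Integrable K) (hf : Integrable f)
    (hg : Integrable g) : ∀ᵐ x, conv K (fun z => f z + g z) x = conv K f x + conv K g x := by
  filter_upwards [ae_integrable_conv hK hf, ae_integrable_conv hK hg] with x h1 h2
  simp only [conv, add_mul]
  exact integral_add h1 h2

/-- The total mass of `z ↦ f z K (x - z)`, integrated over `x`. -/
theorem lintegral_lintegral_enorm_conv {K f : E d → ℂ} (hK : AEStronglyMeasurable K)
    (hf : AEStronglyMeasurable f) :
    ∫⁻ x, ∫⁻ z, ‖f z * K (x - z)‖ₑ = (∫⁻ z, ‖f z‖ₑ) * ∫⁻ x, ‖K x‖ₑ := by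
  have hm : AEStronglyMeasurable (fun p : E d × E d => f p.2 * K (p.1 - p.2))
      (volume.prod volume) :=
    hf.convolution_integrand (ContinuousLinearMap.mul ℂ ℂ) hK
  rw [lintegral_lintegral_swap hm.enorm]
  simp only [enorm_mul]
  have h : ∀ z : E d, ∫⁻ x, ‖f z‖ₑ * ‖K (x - z)‖ₑ = ‖f z‖ₑ * ∫⁻ x, ‖K x‖ₑ := by
    intro z
    rw [lintegral_const_mul' _ _ enorm_ne_top,
      lintegral_sub_right_eq_self (fun x => ‖K x‖ₑ) z]
  simp only [h]
  exact lintegral_mul_const'' _ hf.enorm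

/-! ### A covering of the set where the maximal function is large -/

/-- Negative radii are admitted because the coverings below code missing balls by them; both sides
are then zero. -/
theorem volume_closedBall_mul (x : E d) (r : ℝ) {t : ℝ} (ht : 0 < t) :
    volume (Metric.closedBall x (t * r)) =
      ENNReal.ofReal (t ^ d) * volume (Metric.closedBall x r) := by
  rcases lt_or_ge r 0 with hr | hr
  · rw [Metric.closedBall_eq_empty.2 hr, Metric.closedBall_eq_empty.2 (mul_neg_of_pos_of_neg ht hr)]
    simp
  · rw [Measure.addHaar_closedBall_mul _ _ ht.le hr, finrank_euclideanSpace_fin,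
      Measure.addHaar_closedBall_center volume x]

/-- This bounds the radii of balls on which the average of an integrable function exceeds a given
level. The whole space has infinite volume because `1 ≤ d`. -/
theorem exists_nat_le_volume_closedBall (hd : 1 ≤ d) {c : ℝ≥0∞} (hc : c ≠ ⊤) :
    ∃ n : ℕ, c ≤ volume (Metric.closedBall (0 : E d) n) := by
  have : Nonempty (Fin d) := ⟨⟨0, hd⟩⟩
  have h1 : Tendsto (fun n : ℕ => volume (Metric.closedBall (0 : E d) n)) atTop
      (𝓝 (volume (⋃ n : ℕ, Metric.closedBall (0 : E d) n))) :=
    tendsto_measure_iUnion_atTop fun i j hij =>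
      Metric.closedBall_subset_closedBall (by exact_mod_cast hij)
  rw [Metric.iUnion_closedBall_nat, measure_univ_of_isAddLeftInvariant] at h1
  exact ((h1.eventually (lt_mem_nhds hc.lt_top)).exists).imp fun _ h => h.le

/-- Calderón–Zygmund covering: disjoint balls on which `|f|` has average larger than `γ`, whose
five-fold dilates have average at most `γ` and cover almost all of `{|f| > γ}`. Negative radii
stand for missing balls. -/
theorem exists_calderonZygmund_covering (hd : 1 ≤ d) {f : E d → ℂ} (hf : Integrable f)
    {γ : ℝ≥0} (hγ : 0 < γ) :
    ∃ (c : ℕ → E d) (r : ℕ → ℝ),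
      (Pairwise fun i j => Disjoint (Metric.closedBall (c i) (r i))
        (Metric.closedBall (c j) (r j))) ∧
      (∀ n, γ * volume (Metric.closedBall (c n) (r n)) ≤
        ∫⁻ y in Metric.closedBall (c n) (r n), ‖f y‖ₑ) ∧
      (∀ n, ∫⁻ y in Metric.closedBall (c n) (5 * r n), ‖f y‖ₑ ≤
        γ * volume (Metric.closedBall (c n) (5 * r n))) ∧
      (∀ n, r n ≠ 0) ∧
      ∀ᵐ y, (∀ n, y ∉ Metric.closedBall (c n) (5 * r n)) → ‖f y‖ₑ ≤ γ := by
  set P : E d → ℝ → Prop := fun x ρ => 0 < ρ ∧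
    γ * volume (Metric.closedBall x ρ) < ∫⁻ y in Metric.closedBall x ρ, ‖f y‖ₑ with hP
  have hγ0 : (γ : ℝ≥0∞) ≠ 0 := by exact_mod_cast hγ.ne'
  have hI : (∫⁻ y, ‖f y‖ₑ) ≠ ⊤ := hf.2.ne
  -- A ball with average above `γ` has volume below `‖f‖₁ / γ`, so its radius is at most `N`.
  obtain ⟨N, hN⟩ := exists_nat_le_volume_closedBall hd (c := (∫⁻ y, ‖f y‖ₑ) / γ)
    (ENNReal.div_ne_top hI hγ0)
  have hbound : ∀ x ρ, P x ρ → ρ ≤ N := by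
    intro x ρ h
    by_contra! hlt
    have h1 : (∫⁻ y, ‖f y‖ₑ) ≤ γ * volume (Metric.closedBall x ρ) := by
      rw [mul_comm]
      refine (ENNReal.div_le_iff hγ0 ENNReal.coe_ne_top).1 (hN.trans ?_)
      rw [Measure.addHaar_closedBall_center volume x]
      exact measure_mono (Metric.closedBall_subset_closedBall hlt.le)
    exact absurd (h.2.trans_le (setLIntegral_le_lintegral _ _)) (not_lt.2 h1)
  -- Otherwise the radius could be multiplied by five forever, against the bound `N`. The stopping
  -- factor is the enlargement factor in Vitali's lemma, so the dilates that cover are also those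
  -- with small average.
  have hmax : ∀ x, (∃ ρ, P x ρ) → ∃ ρ, P x ρ ∧ ¬ P x (5 * ρ) := by
    rintro x ⟨ρ, hρ⟩
    by_contra! hcon
    have hall : ∀ n : ℕ, P x (5 ^ n * ρ) := by
      intro n
      induction n with
      | zero => simpa using hρ
      | succ n ih => rw [pow_succ', mul_assoc]; exact hcon _ ih
    have : Tendsto (fun n : ℕ => (5 : ℝ) ^ n * ρ) atTop atTop :=
      (tendsto_pow_atTop_atTop_of_one_lt (by norm_num)).atTop_mul_const hρ.1
    obtain ⟨n, hn⟩ := (this.eventually (eventually_gt_atTop (N : ℝ))).exists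
    exact absurd (hbound _ _ (hall n)) (not_le.2 hn)
  choose! R hR using hmax
  obtain ⟨u, hut, hdisj, hcov⟩ := Vitali.exists_disjoint_subfamily_covering_enlargement_closedBall
    {x : E d | ∃ ρ, P x ρ} id R N (fun x hx => hbound _ _ (hR x hx).1) 5 (by norm_num)
  have hu : u.Countable := by
    refine hdisj.countable_of_nonempty_interior fun x hx => ?_
    refine ⟨x, Metric.ball_subset_interior_closedBall (Metric.mem_ball_self (hR x (hut hx)).1.1)⟩
  have := hu.toEncodable
  -- `decode₂` lists each selected ball at exactly one index, which keeps distinct indices disjoint.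
  -- The unused indices receive radius -1, hence an empty closed ball.
  refine ⟨fun n => (Encodable.decode₂ u n).elim 0 (fun a => (a : E d)),
    fun n => (Encodable.decode₂ u n).elim (-1) (fun a => R a), ?_, ?_, ?_, ?_, ?_⟩
  · intro i j hij
    rcases hi : Encodable.decode₂ u i with _ | a
    · simp [hi]
    rcases hj : Encodable.decode₂ u j with _ | b
    · simp [hj]
    simp only [hi, hj, Option.elim]
    refine hdisj a.2 b.2 fun hab => hij ?_
    rw [Encodable.decode₂_eq_some] at hi hj
    rw [← hi, ← hj, Subtype.ext hab]
  · intro n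
    rcases hn : Encodable.decode₂ u n with _ | a
    · simp [hn]
    · simp only [hn, Option.elim]
      exact (hR a (hut a.2)).1.2.le
  · intro n
    rcases hn : Encodable.decode₂ u n with _ | a
    · norm_num [hn]
    · simp only [hn, Option.elim]
      have h := hR a (hut a.2)
      have h5 : 0 < 5 * R a := by linarith [h.1.1]
      exact not_lt.1 fun hlt => h.2 ⟨h5, hlt⟩
  · intro n
    rcases hn : Encodable.decode₂ u n with _ | a
    · norm_num [hn]
    · simp only [hn, Option.elim]
      exact (hR a (hut a.2)).1.1.ne'
  -- Lebesgue differentiation: a point outside all dilates is the centre of no ball with average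
  -- above `γ`, so the limit of its averages is at most `γ`.
  · filter_upwards [IsUnifLocDoublingMeasure.ae_tendsto_average volume
      hf.norm.locallyIntegrable 1] with y hy hny
    have hnot : ¬ ∃ ρ, P y ρ := by
      intro hyt
      obtain ⟨b, hb, hsub⟩ := hcov y hyt
      refine hny (Encodable.encode (⟨b, hb⟩ : u)) ?_
      rw [Encodable.encodek₂]
      exact hsub (Metric.mem_closedBall_self (hR y hyt).1.1.le)
    have hδ : Tendsto (fun n : ℕ => 1 / ((n : ℝ) + 1)) atTop (𝓝[>] 0) :=
      tendsto_nhdsWithin_iff.2 ⟨tendsto_one_div_add_atTop_nhds_zero_nat,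
        Eventually.of_forall fun n => Set.mem_Ioi.2 (by positivity)⟩
    have hlim := hy (fun _ => y) (fun n : ℕ => 1 / ((n : ℝ) + 1)) hδ
      (Eventually.of_forall fun n => Metric.mem_closedBall_self (by positivity))
    have hle : ‖f y‖ ≤ γ := by
      refine le_of_tendsto' hlim fun n => ?_
      have hpos : (0 : ℝ) < 1 / ((n : ℝ) + 1) := by positivity
      have h1 : (∫⁻ z in Metric.closedBall y (1 / ((n : ℝ) + 1)), ‖f z‖ₑ) ≤
          γ * volume (Metric.closedBall y (1 / ((n : ℝ) + 1))) :=
        not_lt.1 fun hlt => hnot ⟨_, hpos, hlt⟩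
      have hv : volume (Metric.closedBall y (1 / ((n : ℝ) + 1))) ≠ ⊤ := measure_closedBall_lt_top.ne
      rw [setAverage_eq, smul_eq_mul,
        integral_norm_eq_lintegral_enorm hf.1.restrict, measureReal_def]
      have h2 := ENNReal.toReal_mono (ENNReal.mul_ne_top ENNReal.coe_ne_top hv) h1
      rw [ENNReal.toReal_mul, ENNReal.coe_toReal] at h2
      have h3 : 0 < (volume (Metric.closedBall y (1 / ((n : ℝ) + 1)))).toReal :=
        ENNReal.toReal_pos (Metric.measure_closedBall_pos volume y hpos).ne' hv
      rw [inv_mul_le_iff₀ h3]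
      linarith
    rw [← ofReal_norm]
    exact ENNReal.ofReal_le_of_le_toReal (by simpa using hle)

/-! ### The weak type (1,1) estimate -/

/-- Integrable convolution kernels that satisfy the `L²` bound and Hörmander's condition, with
constant `A`. -/
structure IsCalderonZygmundKernel (K : E d → ℂ) (A : ℝ≥0) : Prop where
  pos : 0 < A
  integrable : Integrable K
  lintegral_sq_le : ∀ f : E d → ℂ, Integrable f → MemLp f 2 →
    ∫⁻ x, ‖conv K f x‖ₑ ^ 2 ≤ (A : ℝ≥0∞) ^ 2 * ∫⁻ x, ‖f x‖ₑ ^ 2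
  hormander : ∀ y : E d, ∫⁻ x in {x | 2 * ‖y‖ ≤ ‖x‖}, ‖K (x - y) - K x‖ₑ ≤ A

theorem memLp_two_of_lintegral_lt_top {f : E d → ℂ} (hf : AEStronglyMeasurable f)
    (h : ∫⁻ x, ‖f x‖ₑ ^ 2 < ⊤) : MemLp f 2 := by
  refine ⟨hf, ?_⟩
  rw [eLpNorm_lt_top_iff_lintegral_rpow_enorm_lt_top (by norm_num) (by norm_num)]
  simpa using h

/-- The action of a Calderón–Zygmund kernel on an atom, away from the support of the atom. -/
theorem IsCalderonZygmundKernel.lintegral_conv_atom_le {K : E d → ℂ} {A : ℝ≥0}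
    (hK : IsCalderonZygmundKernel K A) {b : E d → ℂ} (hb : Integrable b) (hb0 : ∫ z, b z = 0)
    {c : E d} {s : ℝ} (hs : ∀ z, z ∉ Metric.closedBall c s → b z = 0) :
    ∫⁻ x in (Metric.closedBall c (2 * s))ᶜ, ‖conv K b x‖ₑ ≤ A * ∫⁻ z, ‖b z‖ₑ := by
  set S : Set (E d) := (Metric.closedBall c (2 * s))ᶜ with hS
  have hSm : MeasurableSet S := Metric.isClosed_closedBall.measurableSet.compl
  have h1 : ∀ᵐ x, ‖conv K b x‖ₑ ≤ ∫⁻ z, ‖b z * (K (x - z) - K (x - c))‖ₑ := by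
    filter_upwards [ae_integrable_conv hK.integrable hb] with x hx
    -- Cancellation: since `b` has integral zero, the constant `K (x - c)` may be subtracted from
    -- the kernel.
    have : conv K b x = ∫ z, b z * (K (x - z) - K (x - c)) := by
      simp only [mul_sub]
      rw [integral_sub hx (hb.mul_const _), integral_mul_const, hb0, zero_mul, sub_zero, conv]
    rw [this]
    exact enorm_integral_le_lintegral_enorm _
  have hm : AEStronglyMeasurable (fun p : E d × E d => b p.2 * (K (p.1 - p.2) - K (p.1 - c)))
      (volume.prod volume) := by
    simp only [mul_sub]
    refine (integrable_prod_conv hK.integrable hb).1.sub ?_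
    have := ((hK.integrable.comp_sub_right c).mul_prod hb).1
    simpa only [mul_comm] using this
  calc ∫⁻ x in S, ‖conv K b x‖ₑ
      ≤ ∫⁻ x in S, ∫⁻ z, ‖b z * (K (x - z) - K (x - c))‖ₑ :=
        lintegral_mono_ae (ae_restrict_of_ae h1)
    _ = ∫⁻ z, ∫⁻ x in S, ‖b z * (K (x - z) - K (x - c))‖ₑ :=
        lintegral_lintegral_swap (hm.enorm.mono_ac
          (Measure.AbsolutelyContinuous.prod Measure.restrict_le_self.absolutelyContinuous
            Measure.AbsolutelyContinuous.rfl))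
    _ ≤ ∫⁻ z, ‖b z‖ₑ * A := by
        refine lintegral_mono fun z => ?_
        by_cases hz : z ∈ Metric.closedBall c s
        · simp only [enorm_mul]
          rw [lintegral_const_mul' _ _ enorm_ne_top]
          gcongr
          refine le_trans ?_ (hK.hormander (z - c))
          have hms : MeasurableSet {x : E d | 2 * ‖z - c‖ ≤ ‖x‖} :=
            (isClosed_le continuous_const continuous_norm).measurableSet
          -- After translation by `c`, points outside the doubled ball satisfy `2‖z - c‖ ≤ ‖x‖`,
          -- because `‖z - c‖ ≤ s`. This is the region of Hörmander's condition for the shift `z -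
          -- c`.
          rw [← lintegral_indicator hSm, ← lintegral_indicator hms,
            ← lintegral_sub_right_eq_self (indicator {x : E d | 2 * ‖z - c‖ ≤ ‖x‖} _) c]
          refine lintegral_mono fun x => ?_
          by_cases hx : x ∈ S
          · have hx' : x - c ∈ {x : E d | 2 * ‖z - c‖ ≤ ‖x‖} := by
              simp only [hS, mem_compl_iff, Metric.mem_closedBall, not_le, dist_eq_norm] at hx
              rw [Metric.mem_closedBall, dist_eq_norm] at hz
              simp only [mem_ofPred_eq]
              linarith
            rw [indicator_of_mem hx, indicator_of_mem hx']
            simp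
          · rw [indicator_of_notMem hx]
            exact zero_le
        · simp [hs z hz]
    _ = A * ∫⁻ z, ‖b z‖ₑ := by
        rw [lintegral_mul_const' _ _ ENNReal.coe_ne_top, mul_comm]

theorem hasSum_indicator_of_pairwise_disjoint {X : Type*} {s : ℕ → Set X}
    (hs : Pairwise fun i j => Disjoint (s i) (s j)) (F : ℕ → X → ℂ) {z : X} {n : ℕ}
    (hn : z ∈ s n) : HasSum (fun i => (s i).indicator (F i) z) (F n z) := by
  have h := hasSum_single (f := fun i => (s i).indicator (F i) z) n fun i hi =>
    indicator_of_notMem (fun hz => disjoint_left.1 (hs hi) hz hn) _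
  simpa [hn] using h

/-- The pointwise domination of the convolution with a sum. -/
theorem enorm_conv_tsum_le {K : E d → ℂ} (hK : Integrable K) {b : ℕ → E d → ℂ}
    (hb : ∀ n, Integrable (b n)) (hsum : ∑' n, ∫⁻ z, ‖b n z‖ₑ ≠ ⊤) :
    ∀ᵐ x, ‖conv K (fun z => ∑' n, b n z) x‖ₑ ≤ ∑' n, ‖conv K (b n) x‖ₑ := by
  -- Fubini in absolute values: for almost every `x` the sum over `n` may be exchanged with the
  -- integral over `z`.
  have hfin : ∫⁻ x, ∑' n, ∫⁻ z, ‖b n z * K (x - z)‖ₑ ≠ ⊤ := by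
    rw [lintegral_tsum]
    · simp only [lintegral_lintegral_enorm_conv hK.1 (hb _).1]
      rw [ENNReal.tsum_mul_right]
      exact ENNReal.mul_ne_top hsum hK.2.ne
    · exact fun n => (integrable_prod_conv hK (hb n)).1.enorm.lintegral_prod_right'
  have hmeas : AEMeasurable (fun x => ∑' n, ∫⁻ z, ‖b n z * K (x - z)‖ₑ) :=
    AEMeasurable.tsum fun n =>
      (integrable_prod_conv hK (hb n)).1.enorm.lintegral_prod_right'
  filter_upwards [ae_lt_top' hmeas hfin, ae_all_iff.2 fun n => ae_integrable_conv hK (hb n)]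
    with x hx hint
  have : conv K (fun z => ∑' n, b n z) x = ∑' n, conv K (b n) x := by
    simp only [conv]
    rw [← integral_tsum (fun n => (hint n).1) hx.ne]
    simp only [tsum_mul_right]
  rw [this]
  exact enorm_tsum_le_tsum_enorm

/-- **Calderón–Zygmund decomposition.** An integrable function splits into a bounded good part and
a sum of atoms supported in closed balls of small total volume. -/
theorem exists_calderonZygmund_decomposition (hd : 1 ≤ d) {f : E d → ℂ} (hf : Integrable f)
    {γ : ℝ≥0} (hγ : 0 < γ) :
    ∃ (g : E d → ℂ) (b : ℕ → E d → ℂ) (c : ℕ → E d) (s : ℕ → ℝ),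
      (∀ z, f z = g z + ∑' n, b n z) ∧ Integrable g ∧ (∀ n, Integrable (b n)) ∧
      (∀ᵐ z, ‖g z‖ₑ ≤ 5 ^ d * γ) ∧ (∫⁻ z, ‖g z‖ₑ ≤ ∫⁻ z, ‖f z‖ₑ) ∧
      (∀ n, ∫ z, b n z = 0) ∧ (∀ n z, z ∉ Metric.closedBall (c n) (s n) → b n z = 0) ∧
      (∑' n, ∫⁻ z, ‖b n z‖ₑ ≤ 2 * ∫⁻ z, ‖f z‖ₑ) ∧
      (∑' n, γ * volume (Metric.closedBall (c n) (2 * s n)) ≤ 10 ^ d * ∫⁻ z, ‖f z‖ₑ) := by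
  obtain ⟨c, r, hdisj, hlow, hup, hr0, hout⟩ := exists_calderonZygmund_covering hd hf hγ
  set B : ℕ → Set (E d) := fun n => Metric.closedBall (c n) (r n) with hB
  set D : ℕ → Set (E d) := fun n => Metric.closedBall (c n) (5 * r n) with hD
  -- The dilates `D n` may overlap; the sets `a n` partition their union.
  set a : ℕ → Set (E d) := disjointed D with ha
  have hBm : ∀ n, MeasurableSet (B n) := fun n => Metric.isClosed_closedBall.measurableSet
  have hDm : ∀ n, MeasurableSet (D n) := fun n => Metric.isClosed_closedBall.measurableSet
  have ham : ∀ n, MeasurableSet (a n) := fun n => MeasurableSet.disjointed hDm n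
  have hadisj : Pairwise fun i j => Disjoint (a i) (a j) := disjoint_disjointed D
  have haD : ∀ n, a n ⊆ D n := disjointed_subset D
  have haU : ⋃ n, a n = ⋃ n, D n := iUnion_disjointed
  have hBfin : ∀ n, volume (B n) ≠ ⊤ := fun n => measure_closedBall_lt_top.ne
  have hBD : ∀ n, B n ⊆ D n := by
    intro n
    rcases lt_or_ge (r n) 0 with h | h
    · simp [hB, Metric.closedBall_eq_empty.2 h]
    · exact Metric.closedBall_subset_closedBall (by linarith)
  have hempty : ∀ n, volume (B n) = 0 → a n = ∅ := by
    intro n hn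
    rcases lt_or_gt_of_ne (hr0 n) with h | h
    · exact subset_empty_iff.1 ((haD n).trans_eq
        (Metric.closedBall_eq_empty.2 (by linarith)))
    · exact absurd hn (Metric.measure_closedBall_pos volume _ h).ne'
  have hDB : ∀ n, volume (D n) = 5 ^ d * volume (B n) := by
    intro n
    simp only [hD, hB]
    rw [volume_closedBall_mul _ _ (by norm_num), ENNReal.ofReal_pow (by norm_num)]
    norm_num
  -- The mass of `f` on `a n` is put back as a constant on `B n` rather than on `a n`. The balls `B
  -- n` are disjoint and comparable to `D n`, whereas `a n` may be arbitrarily small; this keeps the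
  -- good part bounded.
  set κ : ℕ → ℂ := fun n => (∫ z in a n, f z) / ((volume (B n)).toReal : ℂ) with hκ
  have hκB : ∀ n, κ n * ((volume (B n)).toReal : ℂ) = ∫ z in a n, f z := by
    intro n
    by_cases h0 : volume (B n) = 0
    · simp [h0, hempty n h0]
    · refine div_mul_cancel₀ _ ?_
      exact_mod_cast (ENNReal.toReal_pos h0 (hBfin n)).ne'
  have hκle : ∀ n, ‖κ n‖ₑ * volume (B n) ≤ ∫⁻ z in a n, ‖f z‖ₑ := by
    intro n
    refine le_trans (le_of_eq ?_) (enorm_integral_le_lintegral_enorm _)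
    rw [← hκB n, enorm_mul]
    congr 1
    rw [← ofReal_norm, Complex.norm_real, Real.norm_of_nonneg ENNReal.toReal_nonneg,
      ENNReal.ofReal_toReal (hBfin n)]
  have hκbd : ∀ n, ‖κ n‖ₑ ≤ 5 ^ d * γ := by
    intro n
    by_cases h0 : volume (B n) = 0
    · simp [hκ, h0]
    · have h1 : ‖κ n‖ₑ * volume (B n) ≤ (5 ^ d * γ) * volume (B n) :=
        calc ‖κ n‖ₑ * volume (B n) ≤ ∫⁻ z in a n, ‖f z‖ₑ := hκle n
          _ ≤ ∫⁻ z in D n, ‖f z‖ₑ := lintegral_mono_set (haD n)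
          _ ≤ γ * volume (D n) := hup n
          _ = _ := by rw [hDB n]; ring
      exact (ENNReal.mul_le_mul_iff_left h0 (hBfin n)).1 h1
  set q : E d → ℂ := fun z => ∑' n, (B n).indicator (fun _ => κ n) z with hq
  have hqsum : ∀ z, HasSum (fun n => (B n).indicator (fun _ => κ n) z) (q z) := by
    intro z
    refine Summable.hasSum ?_
    by_cases h : ∃ n, z ∈ B n
    · obtain ⟨n, hn⟩ := h
      exact (hasSum_indicator_of_pairwise_disjoint hdisj (fun n _ => κ n) hn).summable
    · push Not at h
      simp only [indicator_of_notMem (h _)]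
      exact summable_zero
  have hqbd : ∀ z, ‖q z‖ₑ ≤ 5 ^ d * γ := by
    intro z
    by_cases h : ∃ n, z ∈ B n
    · obtain ⟨n, hn⟩ := h
      rw [(hqsum z).unique (hasSum_indicator_of_pairwise_disjoint hdisj (fun n _ => κ n) hn)]
      exact hκbd n
    · push Not at h
      simp [hq, indicator_of_notMem (h _)]
  have hq0 : ∀ z, z ∉ ⋃ n, D n → q z = 0 := by
    intro z hz
    have h : ∀ n, z ∉ B n := fun n hn => hz (mem_iUnion.2 ⟨n, hBD n hn⟩)
    simp [hq, indicator_of_notMem (h _)]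
  have hqm : AEStronglyMeasurable q := by
    refine aestronglyMeasurable_of_tendsto_ae atTop
      (f := fun (N : ℕ) z => ∑ n ∈ Finset.range N, (B n).indicator (fun _ => κ n) z) (fun N => ?_)
      (Eventually.of_forall fun z => (hqsum z).tendsto_sum_nat)
    exact (Finset.measurable_fun_sum _ fun n _ =>
      measurable_const.indicator (hBm n)).aestronglyMeasurable
  have hΩm : MeasurableSet (⋃ n, D n) := MeasurableSet.iUnion hDm
  have hΩsum : ∑' n, ∫⁻ z in a n, ‖f z‖ₑ = ∫⁻ z in ⋃ n, D n, ‖f z‖ₑ := by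
    rw [← haU, lintegral_iUnion ham hadisj]
  have hqint : ∫⁻ z, ‖q z‖ₑ ≤ ∫⁻ z in ⋃ n, D n, ‖f z‖ₑ := by
    calc ∫⁻ z, ‖q z‖ₑ ≤ ∫⁻ z, ∑' n, ‖(B n).indicator (fun _ => κ n) z‖ₑ :=
          lintegral_mono fun z => enorm_tsum_le_tsum_enorm
      _ = ∑' n, ‖κ n‖ₑ * volume (B n) := by
          rw [lintegral_tsum fun n => (measurable_const.indicator (hBm n)).enorm.aemeasurable]
          simp only [enorm_indicator_eq_indicator_enorm]
          congr 1 with n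
          rw [lintegral_indicator (hBm n), lintegral_const, Measure.restrict_apply_univ]
      _ ≤ ∑' n, ∫⁻ z in a n, ‖f z‖ₑ := ENNReal.tsum_le_tsum hκle
      _ = _ := hΩsum
  have hIfin : ∫⁻ z, ‖f z‖ₑ < ⊤ := hf.2
  have hqI : Integrable q := ⟨hqm, (hqint.trans (setLIntegral_le_lintegral _ _)).trans_lt hIfin⟩
  have hbn : ∀ n, Integrable fun z => (a n).indicator f z - (B n).indicator (fun _ => κ n) z :=
    fun n => (hf.indicator (ham n)).sub ((integrable_indicator_iff (hBm n)).2
      (integrableOn_const (hBfin n)))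
  refine ⟨fun z => (⋃ n, D n)ᶜ.indicator f z + q z,
    fun n z => (a n).indicator f z - (B n).indicator (fun _ => κ n) z, c, fun n => 5 * r n,
    ?_, (hf.indicator hΩm.compl).add hqI, hbn, ?_, ?_, ?_, ?_, ?_, ?_⟩
  · intro z
    have h1 : HasSum (fun n => (a n).indicator f z) ((⋃ n, D n).indicator f z) := by
      rw [← haU]
      by_cases h : z ∈ ⋃ n, a n
      · rw [indicator_of_mem h]
        obtain ⟨n, hn⟩ := mem_iUnion.1 h
        exact hasSum_indicator_of_pairwise_disjoint hadisj (fun _ => f) hn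
      · rw [indicator_of_notMem h]
        have h' : ∀ n, z ∉ a n := fun n hn => h (mem_iUnion.2 ⟨n, hn⟩)
        simp only [indicator_of_notMem (h' _)]
        exact hasSum_zero
    rw [(h1.sub (hqsum z)).tsum_eq]
    have := congrFun (indicator_compl_add_self (⋃ n, D n) f) z
    simp only [Pi.add_apply] at this
    rw [← this]
    ring
  · filter_upwards [hout] with z hz
    by_cases h : z ∈ ⋃ n, D n
    · rw [indicator_of_notMem (notMem_compl_iff.2 h), zero_add]
      exact hqbd z
    · have h' : ∀ n, z ∉ D n := fun n hn => h (mem_iUnion.2 ⟨n, hn⟩)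
      rw [hq0 z h, add_zero, indicator_of_mem (mem_compl h)]
      refine (hz h').trans ?_
      calc (γ : ℝ≥0∞) = 1 * γ := (one_mul _).symm
        _ ≤ 5 ^ d * γ := by gcongr; exact one_le_pow₀ (by norm_num)
  · calc ∫⁻ z, ‖(⋃ n, D n)ᶜ.indicator f z + q z‖ₑ
        ≤ ∫⁻ z, (‖(⋃ n, D n)ᶜ.indicator f z‖ₑ + ‖q z‖ₑ) :=
          lintegral_mono fun z => enorm_add_le _ _
      _ = (∫⁻ z in (⋃ n, D n)ᶜ, ‖f z‖ₑ) + ∫⁻ z, ‖q z‖ₑ := by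
          rw [lintegral_add_right' _ hqm.enorm]
          simp only [enorm_indicator_eq_indicator_enorm]
          rw [lintegral_indicator hΩm.compl]
      _ ≤ (∫⁻ z in (⋃ n, D n)ᶜ, ‖f z‖ₑ) + ∫⁻ z in ⋃ n, D n, ‖f z‖ₑ := by gcongr
      _ = ∫⁻ z, ‖f z‖ₑ := by rw [add_comm, lintegral_add_compl _ hΩm]
  · intro n
    rw [integral_sub (hf.indicator (ham n)) ((integrable_indicator_iff (hBm n)).2
      (integrableOn_const (hBfin n))), integral_indicator (ham n), integral_indicator (hBm n),
      setIntegral_const, ← hκB n, measureReal_def, Complex.real_smul]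
    ring
  · intro n z hz
    simp only
    rw [indicator_of_notMem (fun h => hz (haD n h)), indicator_of_notMem (fun h => hz (hBD n h)),
      sub_zero]
  · calc ∑' n, ∫⁻ z, ‖(a n).indicator f z - (B n).indicator (fun _ => κ n) z‖ₑ
        ≤ ∑' n, 2 * ∫⁻ z in a n, ‖f z‖ₑ := by
          refine ENNReal.tsum_le_tsum fun n => ?_
          calc ∫⁻ z, ‖(a n).indicator f z - (B n).indicator (fun _ => κ n) z‖ₑ
              ≤ ∫⁻ z, (‖(a n).indicator f z‖ₑ + ‖(B n).indicator (fun _ => κ n) z‖ₑ) :=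
                lintegral_mono fun z => enorm_sub_le
            _ = (∫⁻ z in a n, ‖f z‖ₑ) + ‖κ n‖ₑ * volume (B n) := by
                rw [lintegral_add_right _ (measurable_const.indicator (hBm n)).enorm]
                simp only [enorm_indicator_eq_indicator_enorm]
                rw [lintegral_indicator (ham n), lintegral_indicator (hBm n), lintegral_const,
                  Measure.restrict_apply_univ]
            _ ≤ (∫⁻ z in a n, ‖f z‖ₑ) + ∫⁻ z in a n, ‖f z‖ₑ := by gcongr; exact hκle n
            _ = _ := (two_mul _).symm
      _ ≤ 2 * ∫⁻ z, ‖f z‖ₑ := by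
          rw [ENNReal.tsum_mul_left, hΩsum]
          gcongr
          exact Measure.restrict_le_self
  -- The doubled five-fold dilate has `10 ^ d` times the volume of `B n`, and that volume is paid
  -- for by the large average of `f` on `B n`.
  · calc ∑' n, γ * volume (Metric.closedBall (c n) (2 * (5 * r n)))
        ≤ ∑' n, 10 ^ d * ∫⁻ z in B n, ‖f z‖ₑ := by
          refine ENNReal.tsum_le_tsum fun n => ?_
          rw [← mul_assoc, volume_closedBall_mul _ _ (by norm_num),
            ENNReal.ofReal_pow (by norm_num), mul_left_comm]
          norm_num
          gcongr
          exact hlow n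
      _ ≤ 10 ^ d * ∫⁻ z, ‖f z‖ₑ := by
          rw [ENNReal.tsum_mul_left, ← lintegral_iUnion hBm hdisj]
          gcongr
          exact Measure.restrict_le_self

/-- The constant in the weak type (1,1) estimate. -/
noncomputable def weakConst (d : ℕ) : ℝ≥0 := 10 ^ d + 4 * 5 ^ d + 4

/-- The **weak type (1,1) estimate** for Calderón–Zygmund kernels. -/
theorem IsCalderonZygmundKernel.weak_one_one (hd : 1 ≤ d) {K : E d → ℂ} {A : ℝ≥0}
    (hK : IsCalderonZygmundKernel K A) {f : E d → ℂ} (hf : Integrable f) (γ : ℝ≥0) :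
    γ * volume {x | (A : ℝ≥0∞) * γ < ‖conv K f x‖ₑ} ≤ weakConst d * ∫⁻ z, ‖f z‖ₑ := by
  rcases eq_or_ne γ 0 with rfl | hγ'
  · simp
  have hγ : 0 < γ := pos_iff_ne_zero.2 hγ'
  obtain ⟨g, b, c, s, hfgb, hg, hb, hgbd, hgint, hb0, hbs, hbsum, hvol⟩ :=
    exists_calderonZygmund_decomposition hd hf hγ
  have hA0 : (A : ℝ≥0∞) ≠ 0 := by exact_mod_cast hK.pos.ne'
  have hγ0 : (γ : ℝ≥0∞) ≠ 0 := by exact_mod_cast hγ.ne'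
  have hIfin : ∫⁻ z, ‖f z‖ₑ < ⊤ := hf.2
  have hbsumfin : ∑' n, ∫⁻ z, ‖b n z‖ₑ ≠ ⊤ :=
    (hbsum.trans_lt (ENNReal.mul_lt_top (by norm_num) hIfin)).ne
  set β : E d → ℂ := fun z => ∑' n, b n z with hβ
  have hβint : Integrable β := by
    have : β = fun z => f z - g z := by
      funext z
      rw [hfgb z]
      ring
    rw [this]
    exact hf.sub hg
  -- The three sets give the three terms of `weakConst`: `Ω` by its volume, `S₁` by Chebyshev in
  -- `L²` for the good part, and `S₂` off `Ω` by Chebyshev in `L¹` for the atoms.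
  set Ω : Set (E d) := ⋃ n, Metric.closedBall (c n) (2 * s n) with hΩ
  set S₁ : Set (E d) := {x | (A : ℝ≥0∞) * γ / 2 ≤ ‖conv K g x‖ₑ} with hS₁
  set S₂ : Set (E d) := {x | (A : ℝ≥0∞) * γ / 2 ≤ ‖conv K β x‖ₑ} with hS₂
  have hsub : ({x | (A : ℝ≥0∞) * γ < ‖conv K f x‖ₑ} : Set (E d)) ≤ᵐ[volume]
      (Ω ∪ S₁ ∪ (S₂ ∩ Ωᶜ) : Set (E d)) := by
    filter_upwards [conv_add_ae hK.integrable hg hβint] with x hx hxf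
    have hxf' : (A : ℝ≥0∞) * γ < ‖conv K f x‖ₑ := hxf
    by_contra hcon
    have hcon' : x ∉ Ω ∪ S₁ ∪ (S₂ ∩ Ωᶜ) := hcon
    simp only [mem_union, mem_inter_iff, mem_compl_iff, not_or, not_and, not_not] at hcon'
    obtain ⟨⟨h1, h2⟩, h3⟩ := hcon'
    have h4 : x ∉ S₂ := fun h => h1 (h3 h)
    simp only [hS₁, hS₂, mem_ofPred_eq, not_le] at h2 h4
    have hfx : conv K f x = conv K g x + conv K β x := by
      rw [← hx]
      congr 1
      funext z
      exact hfgb z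
    rw [hfx] at hxf'
    have := (hxf'.trans_le (enorm_add_le _ _)).trans (ENNReal.add_lt_add h2 h4)
    rw [ENNReal.add_halves] at this
    exact lt_irrefl _ this
  have hT1 : γ * volume Ω ≤ 10 ^ d * ∫⁻ z, ‖f z‖ₑ := by
    refine le_trans ?_ hvol
    rw [ENNReal.tsum_mul_left]
    gcongr
    exact measure_iUnion_le _
  have hT2 : γ * volume S₁ ≤ 4 * 5 ^ d * ∫⁻ z, ‖f z‖ₑ := by
    have hg2 : ∫⁻ z, ‖g z‖ₑ ^ 2 ≤ 5 ^ d * γ * ∫⁻ z, ‖f z‖ₑ := by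
      calc ∫⁻ z, ‖g z‖ₑ ^ 2 ≤ ∫⁻ z, 5 ^ d * γ * ‖g z‖ₑ := by
            refine lintegral_mono_ae ?_
            filter_upwards [hgbd] with z hz
            rw [pow_two]
            gcongr
        _ = 5 ^ d * γ * ∫⁻ z, ‖g z‖ₑ := lintegral_const_mul'' _ hg.1.enorm
        _ ≤ _ := by gcongr
    have hgL2 : MemLp g 2 := memLp_two_of_lintegral_lt_top hg.1 (hg2.trans_lt
      (ENNReal.mul_lt_top (ENNReal.mul_lt_top (by simp) ENNReal.coe_lt_top) hIfin))
    have h1 : ((A : ℝ≥0∞) * γ / 2) ^ 2 * volume S₁ ≤ A ^ 2 * (5 ^ d * γ * ∫⁻ z, ‖f z‖ₑ) := by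
      refine le_trans ?_ (le_trans (hK.lintegral_sq_le g hg hgL2)
        (mul_le_mul_right hg2 _))
      refine le_trans ?_ (mul_meas_ge_le_lintegral₀
        ((integrable_conv hK.integrable hg).1.enorm.pow_const 2) (((A : ℝ≥0∞) * γ / 2) ^ 2))
      gcongr
      intro x hx
      simp only [hS₁, mem_ofPred_eq] at hx ⊢
      gcongr
    have h2 : ((A : ℝ≥0∞) ^ 2 * γ) * (γ * volume S₁) ≤
        (A ^ 2 * γ) * (4 * 5 ^ d * ∫⁻ z, ‖f z‖ₑ) := by
      calc ((A : ℝ≥0∞) ^ 2 * γ) * (γ * volume S₁)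
          = 4 * (((A : ℝ≥0∞) * γ / 2) ^ 2 * volume S₁) := by
            have h4 : (4 : ℝ≥0∞) * (2⁻¹) ^ 2 = 1 := by
              rw [← ENNReal.inv_pow]
              norm_num
              exact ENNReal.mul_inv_cancel (by norm_num) (by norm_num)
            rw [div_eq_mul_inv, mul_pow _ (2⁻¹ : ℝ≥0∞)]
            calc _ = (4 * (2⁻¹) ^ 2) * ((A : ℝ≥0∞) ^ 2 * γ * (γ * volume S₁)) := by
                  rw [h4, one_mul]
              _ = _ := by ring
        _ ≤ 4 * (A ^ 2 * (5 ^ d * γ * ∫⁻ z, ‖f z‖ₑ)) := by gcongr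
        _ = _ := by ring
    exact (ENNReal.mul_le_mul_iff_right (mul_ne_zero (pow_ne_zero 2 hA0) hγ0)
      (ENNReal.mul_ne_top (by simp) ENNReal.coe_ne_top)).1 h2
  have hT3 : γ * volume (S₂ ∩ Ωᶜ) ≤ 4 * ∫⁻ z, ‖f z‖ₑ := by
    have hΩm : MeasurableSet Ωᶜ :=
      (MeasurableSet.iUnion fun n => Metric.isClosed_closedBall.measurableSet).compl
    have h1 : ∫⁻ x in Ωᶜ, ‖conv K β x‖ₑ ≤ A * (2 * ∫⁻ z, ‖f z‖ₑ) := by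
      calc ∫⁻ x in Ωᶜ, ‖conv K β x‖ₑ ≤ ∫⁻ x in Ωᶜ, ∑' n, ‖conv K (b n) x‖ₑ :=
            lintegral_mono_ae (ae_restrict_of_ae
              (enorm_conv_tsum_le hK.integrable hb hbsumfin))
        _ = ∑' n, ∫⁻ x in Ωᶜ, ‖conv K (b n) x‖ₑ :=
            lintegral_tsum fun n => (integrable_conv hK.integrable (hb n)).1.enorm.restrict
        _ ≤ ∑' n, A * ∫⁻ z, ‖b n z‖ₑ := by
            refine ENNReal.tsum_le_tsum fun n => ?_
            refine le_trans (lintegral_mono_set ?_)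
              (hK.lintegral_conv_atom_le (hb n) (hb0 n) (hbs n))
            exact compl_subset_compl.2 (subset_iUnion
              (fun n => Metric.closedBall (c n) (2 * s n)) n)
        _ ≤ _ := by
            rw [ENNReal.tsum_mul_left]
            gcongr
    have h2 : ((A : ℝ≥0∞) * γ / 2) * volume (S₂ ∩ Ωᶜ) ≤ A * (2 * ∫⁻ z, ‖f z‖ₑ) := by
      refine le_trans ?_ h1
      rw [← Measure.restrict_apply' hΩm]
      exact mul_meas_ge_le_lintegral₀ (integrable_conv hK.integrable hβint).1.enorm.restrict _
    have h3 : (A : ℝ≥0∞) * (γ * volume (S₂ ∩ Ωᶜ)) ≤ A * (4 * ∫⁻ z, ‖f z‖ₑ) := by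
      calc (A : ℝ≥0∞) * (γ * volume (S₂ ∩ Ωᶜ))
          = 2 * (((A : ℝ≥0∞) * γ / 2) * volume (S₂ ∩ Ωᶜ)) := by
            rw [← mul_assoc 2, ENNReal.mul_div_cancel (by norm_num) (by norm_num), mul_assoc]
        _ ≤ 2 * (A * (2 * ∫⁻ z, ‖f z‖ₑ)) := by gcongr
        _ = _ := by ring
    exact (ENNReal.mul_le_mul_iff_right hA0 ENNReal.coe_ne_top).1 h3
  calc γ * volume {x | (A : ℝ≥0∞) * γ < ‖conv K f x‖ₑ}
      ≤ γ * (volume Ω + volume S₁ + volume (S₂ ∩ Ωᶜ)) := by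
        gcongr
        refine (measure_mono_ae hsub).trans ((measure_union_le _ _).trans ?_)
        gcongr
        exact measure_union_le _ _
    _ = γ * volume Ω + γ * volume S₁ + γ * volume (S₂ ∩ Ωᶜ) := by ring
    _ ≤ 10 ^ d * (∫⁻ z, ‖f z‖ₑ) + 4 * 5 ^ d * (∫⁻ z, ‖f z‖ₑ) + 4 * ∫⁻ z, ‖f z‖ₑ := by gcongr
    _ = weakConst d * ∫⁻ z, ‖f z‖ₑ := by
        simp only [weakConst]
        push_cast
        ring

/-! ### Weak type (p,p) estimates -/

theorem conv_congr_ae {K f g : E d → ℂ} (h : f =ᵐ[volume] g) : conv K f = conv K g := by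
  funext x
  refine integral_congr_ae ?_
  filter_upwards [h] with z hz
  rw [hz]

theorem IsCalderonZygmundKernel.weak_two_two {K : E d → ℂ} {A : ℝ≥0}
    (hK : IsCalderonZygmundKernel K A) {f : E d → ℂ} (hf : Integrable f) (hf2 : MemLp f 2)
    (γ : ℝ≥0) :
    (γ : ℝ≥0∞) ^ 2 * volume {x | (A : ℝ≥0∞) * γ < ‖conv K f x‖ₑ} ≤ ∫⁻ z, ‖f z‖ₑ ^ 2 := by
  have hA0 : (A : ℝ≥0∞) ≠ 0 := by exact_mod_cast hK.pos.ne'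
  have h1 : (A : ℝ≥0∞) ^ 2 * ((γ : ℝ≥0∞) ^ 2 * volume {x | (A : ℝ≥0∞) * γ < ‖conv K f x‖ₑ}) ≤
      A ^ 2 * ∫⁻ z, ‖f z‖ₑ ^ 2 := by
    rw [← mul_assoc, ← mul_pow]
    refine le_trans ?_ (hK.lintegral_sq_le f hf hf2)
    refine le_trans ?_ (mul_meas_ge_le_lintegral₀
      ((integrable_conv hK.integrable hf).1.enorm.pow_const 2) (((A : ℝ≥0∞) * γ) ^ 2))
    gcongr with x
    intro hx
    exact pow_le_pow_left' hx.le 2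
  exact (ENNReal.mul_le_mul_iff_right (pow_ne_zero 2 hA0) (by simp)).1 h1

/-- The function is cut at the height `γ` of the level itself. The large part is treated by weak
(1,1), as `γ^{p-1}|f| ≤ |f|^p` where `|f| > γ`. The small part is treated by weak (2,2), as
`γ^{p-2}|f|² ≤ |f|^p` where `|f| ≤ γ` and `p ≤ 2`. The factor 2 in the level comes from the two
parts. -/
theorem IsCalderonZygmundKernel.weak_of_le_two (hd : 1 ≤ d) {p : ℝ} (hp1 : 1 ≤ p) (hp2 : p ≤ 2)
    {K : E d → ℂ} {A : ℝ≥0} (hK : IsCalderonZygmundKernel K A) {f : E d → ℂ}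
    (hf : Integrable f) (hf2 : MemLp f 2) (γ : ℝ≥0) :
    (γ : ℝ≥0∞) ^ p * volume {x | (A : ℝ≥0∞) * (2 * γ) < ‖conv K f x‖ₑ} ≤
      (weakConst d + 1) * ∫⁻ z, ‖f z‖ₑ ^ p := by
  rcases eq_or_ne γ 0 with rfl | hγ
  · rw [ENNReal.coe_zero, ENNReal.zero_rpow_of_pos (by linarith), zero_mul]
    exact zero_le
  have hγ0 : (γ : ℝ≥0∞) ≠ 0 := by exact_mod_cast hγ
  have hγt : (γ : ℝ≥0∞) ≠ ⊤ := ENNReal.coe_ne_top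
  wlog hfm : StronglyMeasurable f generalizing f
  · have hae := hf.1.ae_eq_mk
    have h := this (hf.congr hae) (hf2.ae_eq hae) hf.1.stronglyMeasurable_mk
    rw [← conv_congr_ae hae] at h
    refine h.trans_eq ?_
    congr 1
    refine lintegral_congr_ae ?_
    filter_upwards [hae] with z hz
    rw [hz]
  set S : Set (E d) := {z | (γ : ℝ≥0∞) < ‖f z‖ₑ} with hS
  have hSm : MeasurableSet S := measurableSet_lt measurable_const hfm.enorm
  have hI1 : Integrable (S.indicator f) := hf.indicator hSm
  have hI2 : Integrable (Sᶜ.indicator f) := hf.indicator hSm.compl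
  have h1 := hK.weak_one_one hd hI1 γ
  have h2 := hK.weak_two_two hI2 (hf2.indicator hSm.compl) γ
  have hF1 : (γ : ℝ≥0∞) ^ (p - 1) * ∫⁻ z, ‖S.indicator f z‖ₑ ≤ ∫⁻ z, ‖f z‖ₑ ^ p := by
    rw [← lintegral_const_mul' _ _ (ENNReal.rpow_ne_top_of_nonneg (by linarith) hγt)]
    refine lintegral_mono fun z => ?_
    by_cases hz : z ∈ S
    · rw [indicator_of_mem hz]
      have hz' : (γ : ℝ≥0∞) < ‖f z‖ₑ := hz
      calc (γ : ℝ≥0∞) ^ (p - 1) * ‖f z‖ₑ ≤ ‖f z‖ₑ ^ (p - 1) * ‖f z‖ₑ := by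
            gcongr
        _ = ‖f z‖ₑ ^ (p - 1) * ‖f z‖ₑ ^ (1 : ℝ) := by rw [ENNReal.rpow_one]
        _ = ‖f z‖ₑ ^ p := by
            rw [← ENNReal.rpow_add _ _ (bot_le.trans_lt hz').ne' enorm_ne_top]
            congr 1
            ring
    · simp [indicator_of_notMem hz]
  have hF2 : (γ : ℝ≥0∞) ^ (p - 2) * ∫⁻ z, ‖Sᶜ.indicator f z‖ₑ ^ 2 ≤ ∫⁻ z, ‖f z‖ₑ ^ p := by
    rw [← lintegral_const_mul' _ _ (ENNReal.rpow_ne_top_of_ne_zero hγ0 hγt)]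
    refine lintegral_mono fun z => ?_
    by_cases hz : z ∈ S
    · simp [indicator_of_notMem (notMem_compl_iff.2 hz)]
    · rw [indicator_of_mem (mem_compl hz)]
      have hz' : ‖f z‖ₑ ≤ γ := not_lt.1 hz
      calc (γ : ℝ≥0∞) ^ (p - 2) * ‖f z‖ₑ ^ 2
          = (γ : ℝ≥0∞) ^ (p - 2) * (‖f z‖ₑ ^ p * ‖f z‖ₑ ^ (2 - p)) := by
            rw [← ENNReal.rpow_add_of_nonneg _ _ (by linarith) (by linarith), ← ENNReal.rpow_two]
            congr 2
            ring
        _ ≤ (γ : ℝ≥0∞) ^ (p - 2) * (‖f z‖ₑ ^ p * γ ^ (2 - p)) := by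
            gcongr
        _ = ((γ : ℝ≥0∞) ^ (p - 2) * γ ^ (2 - p)) * ‖f z‖ₑ ^ p := by ring
        _ = ‖f z‖ₑ ^ p := by
            rw [← ENNReal.rpow_add _ _ hγ0 hγt]
            simp
  have hsub : ({x | (A : ℝ≥0∞) * (2 * γ) < ‖conv K f x‖ₑ} : Set (E d)) ≤ᵐ[volume]
      ({x | (A : ℝ≥0∞) * γ < ‖conv K (S.indicator f) x‖ₑ} ∪
        {x | (A : ℝ≥0∞) * γ < ‖conv K (Sᶜ.indicator f) x‖ₑ} : Set (E d)) := by
    filter_upwards [conv_add_ae hK.integrable hI1 hI2] with x hx hxf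
    have hxf' : (A : ℝ≥0∞) * (2 * γ) < ‖conv K f x‖ₑ := hxf
    by_contra hcon
    have hcon' : x ∉ ({x | (A : ℝ≥0∞) * γ < ‖conv K (S.indicator f) x‖ₑ} ∪
        {x | (A : ℝ≥0∞) * γ < ‖conv K (Sᶜ.indicator f) x‖ₑ} : Set (E d)) := hcon
    simp only [mem_union, mem_ofPred_eq, not_or, not_lt] at hcon'
    have hfx : conv K f x = conv K (S.indicator f) x + conv K (Sᶜ.indicator f) x := by
      rw [← hx]
      congr 1
      funext z
      exact (congrFun (indicator_self_add_compl S f) z).symm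
    rw [hfx] at hxf'
    have := hxf'.trans_le ((enorm_add_le _ _).trans (add_le_add hcon'.1 hcon'.2))
    rw [← two_mul, mul_left_comm] at this
    exact lt_irrefl _ this
  have e1 : (γ : ℝ≥0∞) ^ p = γ ^ (p - 1) * γ := by
    conv_rhs => rw [← ENNReal.rpow_one (γ : ℝ≥0∞), ← ENNReal.rpow_mul, one_mul,
      ← ENNReal.rpow_add _ _ hγ0 hγt]
    simp
  have e2 : (γ : ℝ≥0∞) ^ p = γ ^ (p - 2) * (γ : ℝ≥0∞) ^ 2 := by
    rw [← ENNReal.rpow_two, ← ENNReal.rpow_add _ _ hγ0 hγt]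
    simp
  calc (γ : ℝ≥0∞) ^ p * volume {x | (A : ℝ≥0∞) * (2 * γ) < ‖conv K f x‖ₑ}
      ≤ (γ : ℝ≥0∞) ^ p * (volume {x | (A : ℝ≥0∞) * γ < ‖conv K (S.indicator f) x‖ₑ} +
          volume {x | (A : ℝ≥0∞) * γ < ‖conv K (Sᶜ.indicator f) x‖ₑ}) := by
        gcongr
        exact (measure_mono_ae hsub).trans (measure_union_le _ _)
    _ = γ ^ (p - 1) * (γ * volume {x | (A : ℝ≥0∞) * γ < ‖conv K (S.indicator f) x‖ₑ}) +
        γ ^ (p - 2) * ((γ : ℝ≥0∞) ^ 2 *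
          volume {x | (A : ℝ≥0∞) * γ < ‖conv K (Sᶜ.indicator f) x‖ₑ}) := by
        rw [mul_add, ← mul_assoc, ← mul_assoc, ← e1, ← e2]
    _ ≤ γ ^ (p - 1) * (weakConst d * ∫⁻ z, ‖S.indicator f z‖ₑ) +
        γ ^ (p - 2) * ∫⁻ z, ‖Sᶜ.indicator f z‖ₑ ^ 2 := by gcongr
    _ ≤ weakConst d * (∫⁻ z, ‖f z‖ₑ ^ p) + ∫⁻ z, ‖f z‖ₑ ^ p := by
        rw [mul_left_comm]
        gcongr
    _ = _ := by ring

/-- The transposed operator has the reflected kernel; this feeds the duality argument for `p > 2`.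
-/
theorem IsCalderonZygmundKernel.comp_neg {K : E d → ℂ} {A : ℝ≥0}
    (hK : IsCalderonZygmundKernel K A) : IsCalderonZygmundKernel (fun x => K (-x)) A := by
  have hconv : ∀ (f : E d → ℂ) (x : E d),
      conv (fun x => K (-x)) f x = conv K (fun z => f (-z)) (-x) := by
    intro f x
    simp only [conv]
    rw [← integral_neg_eq_self]
    congr 1 with z
    congr 2
    abel
  refine ⟨hK.pos, hK.integrable.comp_neg, fun f hf hf2 => ?_, fun y => ?_⟩
  · simp only [hconv]
    rw [lintegral_neg_eq_self (fun x => ‖conv K (fun z => f (-z)) x‖ₑ ^ 2)]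
    refine (hK.lintegral_sq_le _ hf.comp_neg
      (hf2.comp_measurePreserving (Measure.measurePreserving_neg volume))).trans_eq ?_
    rw [lintegral_neg_eq_self (fun x => ‖f x‖ₑ ^ 2)]
  · have h := hK.hormander (-y)
    have hms : MeasurableSet {x : E d | 2 * ‖y‖ ≤ ‖x‖} :=
      (isClosed_le continuous_const continuous_norm).measurableSet
    rw [norm_neg, ← lintegral_indicator hms, ← lintegral_neg_eq_self] at h
    rw [← lintegral_indicator hms]
    refine le_trans (lintegral_mono fun x => le_of_eq ?_) h
    simp only [indicator, mem_ofPred_eq, norm_neg, sub_neg_eq_add, neg_sub]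
    congr 4
    abel

/-- The layer-cake integral after the distribution function has been bounded by both weak type
estimates. It converges at 0 because `1 < q` and at infinity because `q < 2`. -/
theorem lintegral_min_rpow_lt_top {q : ℝ} (hq1 : 1 < q) (hq2 : q < 2) :
    ∫⁻ t in Ioi (0 : ℝ), ENNReal.ofReal (min t⁻¹ (t ^ 2)⁻¹) * ENNReal.ofReal (t ^ (q - 1)) < ⊤ := by
  rw [← Ioc_union_Ioi_eq_Ioi (zero_le_one (α := ℝ))]
  refine (lintegral_union_le _ _ _).trans_lt (ENNReal.add_lt_top.2 ⟨?_, ?_⟩)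
  · have h : IntegrableOn (fun t : ℝ => t ^ (q - 2)) (Ioc 0 1) :=
      (intervalIntegrable_iff_integrableOn_Ioc_of_le zero_le_one).1
        (intervalIntegral.intervalIntegrable_rpow' (by linarith))
    refine lt_of_le_of_lt (setLIntegral_mono' measurableSet_Ioc fun t ht => ?_) h.2
    rw [← ofReal_norm, ← ENNReal.ofReal_mul (le_min (by have := ht.1; positivity)
      (by have := ht.1; positivity))]
    refine ENNReal.ofReal_le_ofReal ?_
    rw [Real.norm_of_nonneg (Real.rpow_nonneg ht.1.le _)]
    calc min t⁻¹ (t ^ 2)⁻¹ * t ^ (q - 1) ≤ t⁻¹ * t ^ (q - 1) := by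
          gcongr
          · exact Real.rpow_nonneg ht.1.le _
          · exact min_le_left _ _
      _ = t ^ (q - 2) := by
          rw [← Real.rpow_neg_one, ← Real.rpow_add ht.1]
          congr 1
          ring
  · have h : IntegrableOn (fun t : ℝ => t ^ (q - 3)) (Ioi 1) :=
      integrableOn_Ioi_rpow_of_lt (by linarith) one_pos
    refine lt_of_le_of_lt (setLIntegral_mono' measurableSet_Ioi fun t ht => ?_) h.2
    have ht0 : (0 : ℝ) < t := one_pos.trans ht
    rw [← ofReal_norm, ← ENNReal.ofReal_mul (le_min (by positivity) (by positivity))]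
    refine ENNReal.ofReal_le_ofReal ?_
    rw [Real.norm_of_nonneg (Real.rpow_nonneg ht0.le _)]
    calc min t⁻¹ (t ^ 2)⁻¹ * t ^ (q - 1) ≤ (t ^ 2)⁻¹ * t ^ (q - 1) := by
          gcongr
          exact min_le_right _ _
      _ = t ^ (q - 3) := by
          rw [← Real.rpow_two, ← Real.rpow_neg ht0.le, ← Real.rpow_add ht0]
          congr 1
          ring

/-- Restricted strong type for exponents strictly between `1` and `2`. -/
theorem exists_lintegral_conv_rpow_le (hd : 1 ≤ d) {q : ℝ} (hq1 : 1 < q) (hq2 : q < 2) :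
    ∃ C : ℝ≥0, ∀ (K : E d → ℂ) (A : ℝ≥0), IsCalderonZygmundKernel K A →
      ∀ (S : Set (E d)) (h : E d → ℂ), volume S ≠ ⊤ → Integrable h → MemLp h 2 →
        (∫⁻ z, ‖h z‖ₑ ≤ volume S) → (∫⁻ z, ‖h z‖ₑ ^ 2 ≤ volume S) →
        ∫⁻ x, ‖conv K h x‖ₑ ^ q ≤ C * (A : ℝ≥0∞) ^ q * volume S := by
  set I := ∫⁻ t in Ioi (0 : ℝ), ENNReal.ofReal (min t⁻¹ (t ^ 2)⁻¹) * ENNReal.ofReal (t ^ (q - 1))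
    with hI
  have hIfin : I ≠ ⊤ := (lintegral_min_rpow_lt_top hq1 hq2).ne
  refine ⟨(ENNReal.ofReal q * ((weakConst d + 1) * I)).toNNReal, ?_⟩
  intro K A hK S h hS hh hh2 hh1S hh2S
  rw [ENNReal.coe_toNNReal (ENNReal.mul_ne_top ENNReal.ofReal_ne_top
    (ENNReal.mul_ne_top (by simp) hIfin))]
  have hA0 : (A : ℝ≥0∞) ≠ 0 := by exact_mod_cast hK.pos.ne'
  have hA : (0 : ℝ) < A := hK.pos
  have hmeas : AEMeasurable (fun x => ‖conv K h x‖ / A) :=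
    (integrable_conv hK.integrable hh).1.norm.aemeasurable.div_const _
  have hlayer := lintegral_rpow_eq_lintegral_meas_lt_mul volume
    (f := fun x => ‖conv K h x‖ / A) (Eventually.of_forall fun x => by positivity) hmeas
    (p := q) (by linarith)
  -- The `L¹` norm of `h` and the square of its `L²` norm are both at most `volume S`, so weak (1,1)
  -- and weak (2,2) apply with the same right-hand side.
  have hlev : ∀ t : ℝ, 0 < t → volume {x | t < ‖conv K h x‖ / A} ≤
      (weakConst d + 1) * volume S * ENNReal.ofReal (min t⁻¹ (t ^ 2)⁻¹) := by
    intro t ht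
    have hset : {x | t < ‖conv K h x‖ / A} =
        {x | (A : ℝ≥0∞) * t.toNNReal < ‖conv K h x‖ₑ} := by
      ext x
      simp only [mem_ofPred_eq]
      rw [lt_div_iff₀ hA, ← ofReal_norm, ← ENNReal.ofReal_coe_nnreal, ← ENNReal.ofReal_coe_nnreal,
        ← ENNReal.ofReal_mul hA.le, Real.coe_toNNReal _ ht.le, mul_comm (A : ℝ)]
      exact (ENNReal.ofReal_lt_ofReal_iff_of_nonneg (by positivity)).symm
    have ht0 : ENNReal.ofReal t ≠ 0 := by simpa using ht
    have h1 := hK.weak_one_one hd hh t.toNNReal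
    have h2 := hK.weak_two_two hh hh2 t.toNNReal
    rw [← hset] at h1 h2
    change ENNReal.ofReal t * _ ≤ _ at h1
    change (ENNReal.ofReal t) ^ 2 * _ ≤ _ at h2
    have h1' : volume {x | t < ‖conv K h x‖ / A} ≤
        (weakConst d + 1) * volume S * ENNReal.ofReal t⁻¹ := by
      rw [ENNReal.ofReal_inv_of_pos ht, ← div_eq_mul_inv,
        ENNReal.le_div_iff_mul_le (Or.inl ht0) (Or.inl ENNReal.ofReal_ne_top), mul_comm]
      refine h1.trans ?_
      gcongr
      exact le_self_add
    have h2' : volume {x | t < ‖conv K h x‖ / A} ≤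
        (weakConst d + 1) * volume S * ENNReal.ofReal (t ^ 2)⁻¹ := by
      rw [ENNReal.ofReal_inv_of_pos (by positivity), ← div_eq_mul_inv,
        ENNReal.ofReal_pow ht.le,
        ENNReal.le_div_iff_mul_le (Or.inl (pow_ne_zero 2 ht0)) (Or.inl (by simp)), mul_comm]
      refine h2.trans (hh2S.trans ?_)
      calc volume S = 1 * volume S := (one_mul _).symm
        _ ≤ _ := by
          gcongr
          exact le_add_self
    rcases min_choice t⁻¹ (t ^ 2)⁻¹ with h | h <;> rw [h]
    · exact h1'
    · exact h2'
  have hmain : ∫⁻ x, ENNReal.ofReal ((‖conv K h x‖ / A) ^ q) ≤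
      ENNReal.ofReal q * ((weakConst d + 1) * volume S * I) := by
    rw [hlayer]
    gcongr
    rw [hI, ← lintegral_const_mul' _ _ (ENNReal.mul_ne_top (by simp) hS)]
    refine setLIntegral_mono' measurableSet_Ioi fun t ht => ?_
    rw [← mul_assoc]
    gcongr
    exact hlev t ht
  have hpt : ∀ x, ‖conv K h x‖ₑ ^ q = (A : ℝ≥0∞) ^ q *
      ENNReal.ofReal ((‖conv K h x‖ / A) ^ q) := by
    intro x
    rw [← ENNReal.ofReal_rpow_of_nonneg (by positivity) (by linarith),
      ← ENNReal.mul_rpow_of_nonneg _ _ (by linarith : (0 : ℝ) ≤ q)]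
    congr 1
    rw [← ENNReal.ofReal_coe_nnreal, ← ENNReal.ofReal_mul hA.le, mul_div_cancel₀ _ hA.ne',
      ofReal_norm]
  simp only [hpt]
  rw [lintegral_const_mul' _ _ (ENNReal.rpow_ne_top_of_nonneg (by linarith) ENNReal.coe_ne_top)]
  calc (A : ℝ≥0∞) ^ q * ∫⁻ x, ENNReal.ofReal ((‖conv K h x‖ / A) ^ q)
      ≤ (A : ℝ≥0∞) ^ q * (ENNReal.ofReal q * ((weakConst d + 1) * volume S * I)) := by gcongr
    _ = _ := by ring

/-- Convolution with the reflected kernel is the transposed operator. -/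
theorem integral_mul_conv {K f h : E d → ℂ} (hK : Integrable K) (hf : Integrable f)
    (hh : AEStronglyMeasurable h) (hh1 : ∀ x, ‖h x‖ ≤ 1) :
    ∫ x, h x * conv K f x = ∫ z, f z * conv (fun y => K (-y)) h z := by
  have hint : Integrable (fun p : E d × E d => h p.1 * (f p.2 * K (p.1 - p.2)))
      (volume.prod volume) :=
    (integrable_prod_conv hK hf).bdd_mul (c := 1) hh.comp_fst
      (Eventually.of_forall fun p => hh1 p.1)
  simp only [conv, ← integral_const_mul]
  rw [integral_integral_swap hint]
  congr 1 with z
  congr 1 with x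
  rw [neg_sub]
  ring

/-- The **weak type (p,p) estimate** for `1 ≤ p < ∞`. -/
theorem exists_weak_type (hd : 1 ≤ d) {p : ℝ} (hp : 1 ≤ p) :
    ∃ C : ℝ≥0, ∀ (K : E d → ℂ) (A : ℝ≥0), IsCalderonZygmundKernel K A →
      ∀ f : E d → ℂ, Integrable f → MemLp f 2 → ∀ γ : ℝ≥0,
        (γ : ℝ≥0∞) ^ p * volume {x | (A : ℝ≥0∞) * (2 * γ) < ‖conv K f x‖ₑ} ≤
          C * ∫⁻ z, ‖f z‖ₑ ^ p := by
  rcases le_or_gt p 2 with hp2 | hp2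
  · refine ⟨weakConst d + 1, fun K A hK f hf hf2 γ => ?_⟩
    push_cast
    exact hK.weak_of_le_two hd hp hp2 hf hf2 γ
  have hpos : 0 < p := by linarith
  -- Duality for `p > 2`: `K * f` is tested against its own conjugate phase `h` on the level set
  -- `S`. The transpose sends `h` into `L^q` by the restricted strong type bound, where `1 < q < 2`,
  -- and Hölder's inequality finishes.
  set q : ℝ := p / (p - 1) with hq
  have hpq : p.HolderConjugate q := Real.HolderConjugate.conjExponent (by linarith)
  have hq1 : 1 < q := hpq.symm.lt
  have hq2 : q < 2 := by
    rw [hq, div_lt_iff₀ (by linarith)]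
    linarith
  have hq0 : 0 < q := by linarith
  obtain ⟨C, hC⟩ := exists_lintegral_conv_rpow_le hd hq1 hq2
  refine ⟨C ^ (p / q), fun K A hK f hf hf2 γ => ?_⟩
  rcases eq_or_ne γ 0 with rfl | hγ
  · rw [ENNReal.coe_zero, ENNReal.zero_rpow_of_pos hpos, zero_mul]
    exact zero_le
  have hA0 : (A : ℝ≥0∞) ≠ 0 := by exact_mod_cast hK.pos.ne'
  have hγ0 : (γ : ℝ≥0∞) ≠ 0 := by exact_mod_cast hγ
  have hui := integrable_conv hK.integrable hf
  set u := hui.1.mk (conv K f) with hu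
  have hum : StronglyMeasurable u := hui.1.stronglyMeasurable_mk
  have hae : conv K f =ᵐ[volume] u := hui.1.ae_eq_mk
  set S : Set (E d) := {x | (A : ℝ≥0∞) * γ < ‖u x‖ₑ} with hS
  have hSm : MeasurableSet S := measurableSet_lt measurable_const hum.enorm
  have hSv : volume S = volume {x | (A : ℝ≥0∞) * γ < ‖conv K f x‖ₑ} := by
    refine measure_congr ?_
    filter_upwards [hae] with x hx
    exact congrArg (fun w : ℂ => (A : ℝ≥0∞) * γ < ‖w‖ₑ) hx.symm
  -- Finiteness, here from the weak (2,2) estimate, makes `h` integrable and allows the later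
  -- division by a power of `volume S`.
  have hSfin : volume S ≠ ⊤ := by
    have h2 := hK.weak_two_two hf hf2 γ
    rw [← hSv] at h2
    have hfin : ∫⁻ z, ‖f z‖ₑ ^ 2 < ⊤ := by
      have := (eLpNorm_lt_top_iff_lintegral_rpow_enorm_lt_top (by norm_num) (by norm_num)).1 hf2.2
      simpa using this
    exact fun htop => by
      rw [htop, ENNReal.mul_top (pow_ne_zero 2 hγ0)] at h2
      exact absurd h2 (not_le.2 hfin)
  set h : E d → ℂ := S.indicator fun x => (starRingEnd ℂ) (u x) / (‖u x‖ : ℂ) with hh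
  have hhm : StronglyMeasurable h := by
    refine StronglyMeasurable.indicator (Measurable.stronglyMeasurable ?_) hSm
    exact (Complex.continuous_conj.measurable.comp hum.measurable).div
      (Complex.continuous_ofReal.measurable.comp hum.measurable.norm)
  have hh1 : ∀ x, ‖h x‖ ≤ S.indicator (fun _ => (1 : ℝ)) x := by
    intro x
    by_cases hx : x ∈ S
    · simp only [hh, indicator_of_mem hx, norm_div, RCLike.norm_conj, Complex.norm_real, norm_norm]
      exact div_self_le_one _
    · simp [hh, indicator_of_notMem hx]
  have hh1' : ∀ x, ‖h x‖ ≤ 1 := fun x => (hh1 x).trans (indicator_le_self' (by simp) x)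
  have hhe : ∀ x, ‖h x‖ₑ ≤ S.indicator (fun _ => (1 : ℝ≥0∞)) x := by
    intro x
    by_cases hx : x ∈ S
    · rw [indicator_of_mem hx, ← ofReal_norm]
      exact ENNReal.ofReal_le_one.2 (hh1' x)
    · simp [hh, indicator_of_notMem hx]
  have hhS1 : ∫⁻ z, ‖h z‖ₑ ≤ volume S := by
    refine (lintegral_mono hhe).trans_eq ?_
    rw [lintegral_indicator hSm, setLIntegral_one]
  have hhS2 : ∫⁻ z, ‖h z‖ₑ ^ 2 ≤ volume S := by
    refine (lintegral_mono fun x => ?_).trans hhS1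
    rw [pow_two]
    refine mul_le_of_le_one_right' ?_
    rw [← ofReal_norm]
    exact ENNReal.ofReal_le_one.2 (hh1' x)
  have hhI : Integrable h := ⟨hhm.aestronglyMeasurable, hhS1.trans_lt hSfin.lt_top⟩
  have hhL2 : MemLp h 2 := memLp_two_of_lintegral_lt_top hhI.1 (hhS2.trans_lt hSfin.lt_top)
  have hT := hC _ A hK.comp_neg S h hSfin hhI hhL2 hhS1 hhS2
  have hprod : ∀ x, h x * u x = ((S.indicator (fun x => ‖u x‖) x : ℝ) : ℂ) := by
    intro x
    by_cases hx : x ∈ S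
    · simp only [hh, indicator_of_mem hx]
      rw [div_mul_eq_mul_div, mul_comm, Complex.mul_conj, Complex.normSq_eq_norm_sq]
      have : (‖u x‖ : ℂ) ≠ 0 := by
        have hx' : (A : ℝ≥0∞) * γ < ‖u x‖ₑ := hx
        have h0 : ‖u x‖ₑ ≠ 0 := (bot_le.trans_lt hx').ne'
        simpa using h0
      push_cast
      field_simp
    · simp [hh, indicator_of_notMem hx]
  have hlow : (A : ℝ≥0∞) * γ * volume S ≤ ‖∫ x, h x * conv K f x‖ₑ := by
    have e1 : ∫ x, h x * conv K f x = ((∫ x, S.indicator (fun x => ‖u x‖) x : ℝ) : ℂ) := by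
      rw [← integral_complex_ofReal]
      refine integral_congr_ae ?_
      filter_upwards [hae] with x hx
      rw [hx]
      exact hprod x
    rw [e1, ← ofReal_norm, Complex.norm_real, ofReal_norm, integral_indicator hSm,
      ← ofReal_norm, Real.norm_of_nonneg (integral_nonneg fun x => norm_nonneg _),
      ofReal_integral_norm_eq_lintegral_enorm (hui.congr hae).integrableOn, ← setLIntegral_const]
    exact setLIntegral_mono' hSm fun x hx => le_of_lt hx
  have hup : ‖∫ x, h x * conv K f x‖ₑ ≤
      (∫⁻ z, ‖f z‖ₑ ^ p) ^ (1 / p) * (C * (A : ℝ≥0∞) ^ q * volume S) ^ (1 / q) := by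
    rw [integral_mul_conv hK.integrable hf hhI.1 hh1']
    refine (enorm_integral_le_lintegral_enorm _).trans ?_
    simp only [enorm_mul]
    refine (ENNReal.lintegral_mul_le_Lp_mul_Lq volume hpq hf.1.enorm
      (integrable_conv hK.comp_neg.integrable hhI).1.enorm).trans ?_
    gcongr
  have hsub : volume {x | (A : ℝ≥0∞) * (2 * γ) < ‖conv K f x‖ₑ} ≤ volume S := by
    rw [hSv]
    refine measure_mono (ofPred_subset_ofPred.2 fun x hx => lt_of_le_of_lt ?_ hx)
    gcongr
    calc (γ : ℝ≥0∞) = 1 * γ := (one_mul _).symm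
      _ ≤ 2 * γ := by
        gcongr
        norm_num
  refine (mul_le_mul_right hsub _).trans ?_
  rcases eq_or_ne (volume S) 0 with h0 | h0
  · simp [h0]
  -- The two bounds for the pairing read `A γ |S| ≤ ‖f‖_p C^{1/q} A |S|^{1/q}`; cancelling `A
  -- |S|^{1/q}` leaves `|S|^{1/p}`.
  have hkey : (γ : ℝ≥0∞) * volume S ^ (1 / p) ≤
      (∫⁻ z, ‖f z‖ₑ ^ p) ^ (1 / p) * (C : ℝ≥0∞) ^ (1 / q) := by
    have hVq0 : volume S ^ (1 / q) ≠ 0 := by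
      simp [ENNReal.rpow_eq_zero_iff, h0, hSfin]
    have hVqt : volume S ^ (1 / q) ≠ ⊤ := ENNReal.rpow_ne_top_of_nonneg (by positivity) hSfin
    refine (ENNReal.mul_le_mul_iff_right (mul_ne_zero hA0 hVq0)
      (ENNReal.mul_ne_top ENNReal.coe_ne_top hVqt)).1 ?_
    calc (A : ℝ≥0∞) * volume S ^ (1 / q) * (γ * volume S ^ (1 / p))
        = A * γ * (volume S ^ (1 / p) * volume S ^ (1 / q)) := by ring
      _ = A * γ * volume S := by
          rw [← ENNReal.rpow_add _ _ h0 hSfin, one_div, one_div, hpq.inv_add_inv_eq_one,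
            ENNReal.rpow_one]
      _ ≤ _ := hlow.trans hup
      _ = _ := by
          rw [ENNReal.mul_rpow_of_nonneg _ _ (by positivity),
            ENNReal.mul_rpow_of_nonneg _ _ (by positivity), ← ENNReal.rpow_mul,
            mul_one_div_cancel hq0.ne', ENNReal.rpow_one]
          ring
  have := ENNReal.rpow_le_rpow hkey hpos.le
  rw [ENNReal.mul_rpow_of_nonneg _ _ hpos.le, ENNReal.mul_rpow_of_nonneg _ _ hpos.le,
    ← ENNReal.rpow_mul, ← ENNReal.rpow_mul, ← ENNReal.rpow_mul, one_div_mul_cancel hpos.ne',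
    ENNReal.rpow_one, ENNReal.rpow_one, one_div_mul_eq_div] at this
  refine this.trans_eq ?_
  rw [mul_comm, ENNReal.coe_rpow_of_nonneg _ (by positivity)]

/-! ### Facts on the Fourier transform of integrable functions -/

theorem continuous_fourier {f : E d → ℂ} (hf : Integrable f) : Continuous (𝓕 f) :=
  VectorFourier.fourierIntegral_continuous Real.continuous_fourierChar
    (innerSL ℝ).continuous₂ hf

theorem norm_fourier_le (f : E d → ℂ) (ξ : E d) : ‖𝓕 f ξ‖ ≤ ∫ x, ‖f x‖ :=
  VectorFourier.norm_fourierIntegral_le_integral_norm _ _ _ _ _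

theorem integral_fourier_mul {f g : E d → ℂ} (hf : Integrable f) (hg : Integrable g) :
    ∫ ξ, 𝓕 f ξ * g ξ = ∫ x, f x * 𝓕 g x := by
  have h := VectorFourier.integral_fourierIntegral_smul_eq_flip (L := innerₗ (E d))
    Real.continuous_fourierChar continuous_inner hf hg
  rw [flip_innerₗ] at h
  exact h

theorem integral_fourierInv_mul {f g : E d → ℂ} (hf : Integrable f) (hg : Integrable g) :
    ∫ ξ, 𝓕⁻ f ξ * g ξ = ∫ x, f x * 𝓕⁻ g x := by
  simp only [Real.fourierInv_eq_fourier_neg]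
  rw [← integral_neg_eq_self]
  simp only [neg_neg]
  rw [integral_fourier_mul hf hg.comp_neg]
  congr 1 with x
  rw [← Real.fourierInv_eq_fourier_neg, Real.fourierInv_eq_fourier_comp_neg]

/-- Multiplication by `M` on the Fourier side is convolution with `𝓕⁻ M`. -/
theorem fourierInv_mul_fourier {M f : E d → ℂ} (hM : Integrable M) (hf : Integrable f) (x : E d) :
    𝓕⁻ (fun ξ => M ξ * 𝓕 f ξ) x = conv (𝓕⁻ M) f x := by
  set g : E d → ℂ := fun ξ => Real.fourierChar (inner ℝ ξ x) • M ξ with hg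
  have hgi : Integrable g := by
    refine hM.mono ?_ (Eventually.of_forall fun ξ => by simp [hg, Circle.norm_smul])
    exact (Continuous.aestronglyMeasurable (by fun_prop)).smul hM.1
  have h := integral_fourier_mul hf hgi
  rw [Real.fourierInv_eq, conv]
  have e1 : ∀ ξ, Real.fourierChar (inner ℝ ξ x) • (M ξ * 𝓕 f ξ) = 𝓕 f ξ * g ξ := by
    intro ξ
    simp only [hg, Circle.smul_def, smul_eq_mul]
    ring
  simp only [e1]
  rw [h]
  congr 1 with z
  congr 1
  rw [Real.fourier_eq, Real.fourierInv_eq]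
  congr 1 with ξ
  rw [hg, smul_smul, ← AddChar.map_add_eq_mul, inner_sub_right]
  congr 2
  ring

/-- Real smooth functions of compact support are among the test functions, and they already separate
locally integrable functions. This identifies Fourier transforms that are defined in different ways.
-/
theorem ae_eq_of_integral_schwartz_mul {f g : E d → ℂ} (hf : LocallyIntegrable f)
    (hg : LocallyIntegrable g) (h : ∀ φ : 𝓢(E d, ℂ), ∫ x, φ x * f x = ∫ x, φ x * g x) :
    f =ᵐ[volume] g := by
  have h0 := ae_eq_zero_of_integral_contDiff_smul_eq_zero (hf.sub hg) fun φ hφ hφc => by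
    have hc : HasCompactSupport fun x => (φ x : ℂ) := hφc.comp_left Complex.ofReal_zero
    have hs : ContDiff ℝ ∞ fun x => (φ x : ℂ) := Complex.ofRealCLM.contDiff.comp hφ
    have e : ∀ u : E d → ℂ, ∀ x, φ x • u x = (φ x : ℂ) * u x := fun u x => Complex.real_smul
    have hi : ∀ u : E d → ℂ, LocallyIntegrable u → Integrable fun x => φ x • u x := fun u hu =>
      hu.integrable_smul_left_of_hasCompactSupport hφ.continuous hφc
    have h1 := h (hc.toSchwartzMap hs)
    simp only [HasCompactSupport.toSchwartzMap_toFun, ← e] at h1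
    simp only [Pi.sub_apply, smul_sub]
    rw [integral_sub (hi f hf) (hi g hg)]
    exact sub_eq_zero.2 h1
  filter_upwards [h0] with x hx
  exact sub_eq_zero.1 hx

/-- Almost everywhere Fourier inversion. -/
theorem ae_eq_fourierInv_fourier {f : E d → ℂ} (hf : Integrable f) (hf' : Integrable (𝓕 f)) :
    f =ᵐ[volume] 𝓕⁻ (𝓕 f) := by
  have hc : Continuous (𝓕⁻ (𝓕 f)) := by
    have : 𝓕⁻ (𝓕 f) = fun x => 𝓕 (𝓕 f) (-x) := by
      funext x
      exact Real.fourierInv_eq_fourier_neg _ _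
    rw [this]
    exact (continuous_fourier hf').comp continuous_neg
  refine ae_eq_of_integral_schwartz_mul hf.locallyIntegrable hc.locallyIntegrable fun φ => ?_
  have h1 := integral_fourierInv_mul hf' φ.integrable
  have h2 := integral_fourier_mul hf (𝓕⁻ φ).integrable
  rw [SchwartzMap.fourierInv_coe] at h2
  rw [h2, ← SchwartzMap.fourierInv_coe, ← SchwartzMap.fourier_coe, FourierTransform.fourier_fourierInv_eq] at h1
  simp only [mul_comm (φ _)]
  exact h1.symm

/-- Plancherel's theorem for integrable square integrable functions. -/
theorem lintegral_fourier_sq {f : E d → ℂ} (hf : Integrable f) (hf2 : MemLp f 2) :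
    ∫⁻ ξ, ‖𝓕 f ξ‖ₑ ^ 2 = ∫⁻ x, ‖f x‖ₑ ^ 2 := by
  set F : Lp ℂ 2 (volume : Measure (E d)) := hf2.toLp f with hF
  have hFf : F =ᵐ[volume] f := hf2.coeFn_toLp
  -- The `L²` Fourier transform and the Fourier integral agree as tempered distributions, so the
  -- isometry of `L²` applies to the integral.
  have hae : (𝓕 F : Lp ℂ 2 (volume : Measure (E d))) =ᵐ[volume] 𝓕 f := by
    refine ae_eq_of_integral_schwartz_mul ((Lp.memLp (𝓕 F)).locallyIntegrable (by norm_num))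
      (continuous_fourier hf).locallyIntegrable fun φ => ?_
    have h1 := congrArg (fun T : 𝓢'(E d, ℂ) => T φ) (Lp.fourier_toTemperedDistribution_eq F)
    simp only [TemperedDistribution.fourier_apply, Lp.toTemperedDistribution_apply,
      smul_eq_mul] at h1
    rw [← h1]
    have h2 := integral_fourier_mul φ.integrable hf
    rw [← h2, SchwartzMap.fourier_coe]
    refine integral_congr_ae ?_
    filter_upwards [hFf] with x hx
    rw [hx]
  have h3 := Lp.norm_fourier_eq F
  have key : ∀ (G : Lp ℂ 2 (volume : Measure (E d))) (g : E d → ℂ), G =ᵐ[volume] g →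
      ENNReal.ofReal ‖G‖ ^ 2 = ∫⁻ x, ‖g x‖ₑ ^ 2 := by
    intro G g hG
    rw [Lp.norm_def, ENNReal.ofReal_toReal (Lp.eLpNorm_ne_top G), eLpNorm_congr_ae hG,
      eLpNorm_eq_lintegral_rpow_enorm_toReal (by norm_num) (by norm_num)]
    simp only [ENNReal.toReal_ofNat, ENNReal.rpow_ofNat]
    rw [← ENNReal.rpow_natCast, ← ENNReal.rpow_mul]
    norm_num
  rw [← key _ _ hae, ← key _ _ hFf, h3]

/-- The `L²` bound for the convolution with the inverse Fourier transform of a bounded function. -/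
theorem lintegral_conv_fourierInv_sq_le {M : E d → ℂ} {A : ℝ≥0} (hM : Integrable M)
    (hMA : ∀ᵐ ξ, ‖M ξ‖ₑ ≤ A) {f : E d → ℂ} (hf : Integrable f) (hf2 : MemLp f 2) :
    ∫⁻ x, ‖conv (𝓕⁻ M) f x‖ₑ ^ 2 ≤ (A : ℝ≥0∞) ^ 2 * ∫⁻ x, ‖f x‖ₑ ^ 2 := by
  have hfin : ∫⁻ x, ‖f x‖ₑ ^ 2 < ⊤ := by
    have := (eLpNorm_lt_top_iff_lintegral_rpow_enorm_lt_top (by norm_num) (by norm_num)).1 hf2.2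
    simpa using this
  have hG : Integrable fun ξ => M ξ * 𝓕 f ξ :=
    hM.mul_bdd (continuous_fourier hf).aestronglyMeasurable
      (Eventually.of_forall fun ξ => norm_fourier_le f ξ)
  have hGle : ∫⁻ ξ, ‖M ξ * 𝓕 f ξ‖ₑ ^ 2 ≤ (A : ℝ≥0∞) ^ 2 * ∫⁻ x, ‖f x‖ₑ ^ 2 := by
    rw [← lintegral_fourier_sq hf hf2, ← lintegral_const_mul' _ _ (by simp)]
    refine lintegral_mono_ae ?_
    filter_upwards [hMA] with ξ hξ
    rw [enorm_mul, mul_pow]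
    gcongr
  have hG2 : MemLp (fun ξ => M ξ * 𝓕 f ξ) 2 := memLp_two_of_lintegral_lt_top hG.1
    (hGle.trans_lt (ENNReal.mul_lt_top (by simp) hfin))
  simp only [← fourierInv_mul_fourier hM hf, Real.fourierInv_eq_fourier_neg]
  rw [lintegral_neg_eq_self (fun x => ‖𝓕 (fun ξ => M ξ * 𝓕 f ξ) x‖ₑ ^ 2),
    lintegral_fourier_sq hG hG2]
  exact hGle

/-! ### Kernel bounds for the dyadic pieces of the multiplier -/

/-- The dilated weight `t^d (1 + t |x|)^{-β}`. -/
noncomputable def weight (β t : ℝ) (x : E d) : ℝ := t ^ d * (1 + t * ‖x‖) ^ (-β)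

/-- Pointwise bounds for a family of multipliers, localized to dyadic annuli, and for the
corresponding convolution kernels. -/
structure IsDyadicFamily (β : ℝ) (A : ℝ≥0) (M : ℤ → E d → ℂ) : Prop where
  pos : 0 < A
  integrable : ∀ j, Integrable (M j)
  bound : ∀ j, ∀ᵐ ξ, ‖M j ξ‖ ≤ A
  support : ∀ ξ, ∃ N : ℤ, ∀ j, M j ξ ≠ 0 → j = N ∨ j = N + 1
  size : ∀ j x, ‖𝓕⁻ (M j) x‖ ≤ A * weight β (2 ^ j) x
  smooth : ∀ j x u, (2 : ℝ) ^ j * ‖u‖ ≤ 1 →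
    ‖𝓕⁻ (M j) (x - u) - 𝓕⁻ (M j) x‖ ≤ A * (2 ^ j * ‖u‖) * weight β (2 ^ j) x

/-- For every admissible `h` the left side equals `|𝓕 h ξ|`, which is at most `‖h‖₁`. Without an
admissible `h` the infimum is `∞`. -/
theorem enorm_fourier_le_potentialNorm {α : ℝ} (g : E d → ℂ) (ξ : E d) :
    ENNReal.ofReal ((1 + ‖(2 * Real.pi) • ξ‖ ^ 2) ^ (α / 2)) * ‖𝓕 g ξ‖ₑ ≤ potentialNorm α g := by
  refine le_iInf₂ fun h hh => ?_
  have h1 : ‖𝓕 h ξ‖ₑ = ENNReal.ofReal ((1 + ‖(2 * Real.pi) • ξ‖ ^ 2) ^ (α / 2)) * ‖𝓕 g ξ‖ₑ := by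
    rw [hh.2.2 ξ, enorm_mul, ← ofReal_norm, Complex.norm_real, Real.norm_of_nonneg (by positivity)]
  rw [← h1, eLpNorm_one_eq_lintegral_enorm, ← ofReal_integral_norm_eq_lintegral_enorm hh.2.1,
    ← ofReal_norm]
  exact ENNReal.ofReal_le_ofReal (norm_fourier_le h ξ)

/-- The source of all kernel decay. The factor `2^{α/2}` comes from `(1 + ‖ξ‖)² ≤ 2 (1 + ‖ξ‖²)`. The
exponent is lowered from `α` to `β` because the later sums over scales need `β < d + 1`. -/
theorem norm_fourier_le_of_potentialNorm_le {α β : ℝ} (hβ0 : 0 < β) (hβ : β ≤ α) {g : E d → ℂ}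
    {B : ℝ≥0} (hB : potentialNorm α g ≤ B) (ξ : E d) :
    ‖𝓕 g ξ‖ ≤ B * 2 ^ (α / 2) * (1 + ‖ξ‖) ^ (-β) := by
  set y : ℝ := 1 + ‖(2 * Real.pi) • ξ‖ ^ 2 with hy
  have hy0 : 0 < y := by positivity
  have h1 : y ^ (α / 2) * ‖𝓕 g ξ‖ ≤ B := by
    have h := (enorm_fourier_le_potentialNorm g ξ).trans hB
    rw [← ofReal_norm, ← ENNReal.ofReal_mul (by positivity)] at h
    exact (ENNReal.ofReal_le_iff_le_toReal ENNReal.coe_ne_top).1 h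
  have h2 : ‖𝓕 g ξ‖ ≤ B * y ^ (-α / 2) := by
    rw [neg_div, Real.rpow_neg hy0.le, ← div_eq_mul_inv, le_div_iff₀ (by positivity), mul_comm]
    exact h1
  have hpi : ‖ξ‖ ≤ ‖(2 * Real.pi) • ξ‖ := by
    rw [norm_smul, Real.norm_of_nonneg (by positivity)]
    have := Real.pi_gt_three
    nlinarith [norm_nonneg ξ]
  have h3 : y ^ (-α / 2) ≤ 2 ^ (α / 2) * (1 + ‖ξ‖) ^ (-β) := by
    calc y ^ (-α / 2) ≤ (1 + ‖ξ‖ ^ 2) ^ (-α / 2) := by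
          refine Real.rpow_le_rpow_of_nonpos (by positivity) (by rw [hy]; gcongr) (by linarith)
      _ ≤ 2 ^ (α / 2) * (1 + ‖ξ‖) ^ (-α) := rpow_neg_one_add_norm_sq_le ξ (by linarith)
      _ ≤ _ := by
          gcongr
          linarith [norm_nonneg ξ]
  calc ‖𝓕 g ξ‖ ≤ B * y ^ (-α / 2) := h2
    _ ≤ B * (2 ^ (α / 2) * (1 + ‖ξ‖) ^ (-β)) := by gcongr
    _ = _ := by ring

theorem integrable_of_potentialNorm_lt_top {α : ℝ} {g : E d → ℂ} (h : potentialNorm α g < ⊤) :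
    Integrable g := by
  obtain ⟨u, hu⟩ := iInf_lt_iff.1 h
  obtain ⟨hu, -⟩ := iInf_lt_iff.1 hu
  exact hu.1

/-- This submultiplicativity lets a polynomial weight pass through a convolution. -/
theorem one_add_norm_le_mul (x z : E d) : 1 + ‖x‖ ≤ (1 + ‖x - z‖) * (1 + ‖z‖) := by
  have := norm_le_norm_sub_add x z
  nlinarith [norm_nonneg (x - z), norm_nonneg z, mul_nonneg (norm_nonneg (x - z)) (norm_nonneg z)]

/-- Mean value inequality on the ball of radius `‖u‖ ≤ 1` about `z`, where `1 + ‖v‖ ≥ (1 + ‖z‖) /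
2`, so the decay of the derivative at `v` is comparable to decay at `z`. -/
theorem exists_schwartz_sub_le (Φ : 𝓢(E d, ℂ)) (k : ℕ) :
    ∃ c : ℝ, 0 ≤ c ∧ ∀ z u : E d, ‖u‖ ≤ 1 → ‖Φ (z - u) - Φ z‖ ≤ c * ‖u‖ * (1 + ‖z‖) ^ (-(k : ℝ)) := by
  set D : ℝ := 2 ^ k * ((Finset.Iic (k, 1)).sup fun m => SchwartzMap.seminorm ℝ m.1 m.2) Φ with hD
  have hD0 : 0 ≤ D := by positivity
  have hder : ∀ v : E d, ‖fderiv ℝ Φ v‖ ≤ D * (1 + ‖v‖) ^ (-(k : ℝ)) := by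
    intro v
    have h := SchwartzMap.one_add_le_sup_seminorm_apply (𝕜 := ℝ) (m := (k, 1)) le_rfl le_rfl Φ v
    rw [norm_iteratedFDeriv_one] at h
    rw [Real.rpow_neg (by positivity), ← div_eq_mul_inv, le_div_iff₀ (by positivity),
      Real.rpow_natCast, mul_comm]
    exact h
  refine ⟨D * 2 ^ (k : ℝ), by positivity, fun z u hu => ?_⟩
  have hseg : ∀ v ∈ Metric.closedBall z ‖u‖,
      ‖fderiv ℝ Φ v‖ ≤ D * 2 ^ (k : ℝ) * (1 + ‖z‖) ^ (-(k : ℝ)) := by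
    intro v hv
    rw [Metric.mem_closedBall, dist_eq_norm, norm_sub_rev] at hv
    have h1 : (1 + ‖z‖) / 2 ≤ 1 + ‖v‖ := by
      have := norm_le_norm_sub_add z v
      linarith [norm_nonneg v]
    have h2 : (1 + ‖v‖) ^ (-(k : ℝ)) ≤ 2 ^ (k : ℝ) * (1 + ‖z‖) ^ (-(k : ℝ)) := by
      calc (1 + ‖v‖) ^ (-(k : ℝ)) ≤ ((1 + ‖z‖) / 2) ^ (-(k : ℝ)) :=
            Real.rpow_le_rpow_of_nonpos (by positivity) h1 (by simp)
        _ = _ := by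
            rw [Real.div_rpow (by positivity) (by norm_num),
              Real.rpow_neg (by norm_num : (0 : ℝ) ≤ 2), div_inv_eq_mul, mul_comm]
    calc ‖fderiv ℝ Φ v‖ ≤ D * (1 + ‖v‖) ^ (-(k : ℝ)) := hder v
      _ ≤ D * (2 ^ (k : ℝ) * (1 + ‖z‖) ^ (-(k : ℝ))) := by gcongr
      _ = _ := by ring
  have := (convex_closedBall z ‖u‖).norm_image_sub_le_of_norm_fderiv_le
    (f := Φ) (fun v _ => Φ.differentiable.differentiableAt) hseg
    (Metric.mem_closedBall_self (norm_nonneg u))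
    (y := z - u) (by simp [Metric.mem_closedBall])
  refine this.trans_eq ?_
  rw [sub_sub_cancel_left, norm_neg]
  ring

theorem norm_fourierInv_le_of_potentialNorm_le {α β : ℝ} (hβ0 : 0 < β) (hβ : β ≤ α)
    {g : E d → ℂ} {B : ℝ≥0} (hB : potentialNorm α g ≤ B) (x : E d) :
    ‖𝓕⁻ g x‖ ≤ B * 2 ^ (α / 2) * (1 + ‖x‖) ^ (-β) := by
  rw [Real.fourierInv_eq_fourier_neg]
  simpa using norm_fourier_le_of_potentialNorm_le hβ0 hβ hB (-x)

/-- Smoothness of the kernel of a compactly supported multiplier in the potential space. -/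
theorem exists_norm_fourierInv_sub_le (d : ℕ) {α β : ℝ} (hβ0 : 0 < β) (hβ : β ≤ α) :
    ∃ c : ℝ, 0 ≤ c ∧ ∀ (g : E d → ℂ) (B : ℝ≥0), potentialNorm α g ≤ B →
      (∀ ξ, 2 < ‖ξ‖ → g ξ = 0) → ∀ x u : E d, ‖u‖ ≤ 1 →
        ‖𝓕⁻ g (x - u) - 𝓕⁻ g x‖ ≤ c * B * ‖u‖ * (1 + ‖x‖) ^ (-β) := by
  -- `ψ` equals 1 on the ball of radius 2, so `g = g ψ` and `𝓕⁻ g` is its own convolution with the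
  -- Schwartz function `Φ`. Differences of `𝓕⁻ g` then fall on `Φ`.
  let ψ₀ : ContDiffBump (0 : E d) := ⟨2, 3, by norm_num, by norm_num⟩
  have hc : HasCompactSupport fun x => (ψ₀ x : ℂ) :=
    ψ₀.hasCompactSupport.comp_left Complex.ofReal_zero
  have hs : ContDiff ℝ ∞ fun x => (ψ₀ x : ℂ) := Complex.ofRealCLM.contDiff.comp ψ₀.contDiff
  set ψ : 𝓢(E d, ℂ) := hc.toSchwartzMap hs with hψ
  set Φ : 𝓢(E d, ℂ) := 𝓕⁻ ψ with hΦ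
  have hΦψ : 𝓕 (Φ : E d → ℂ) = ψ := by
    rw [← SchwartzMap.fourier_coe, hΦ, FourierTransform.fourier_fourierInv_eq]
  have hψ1 : ∀ ξ : E d, ‖ξ‖ ≤ 2 → ψ ξ = 1 := by
    intro ξ hξ
    simp only [hψ, HasCompactSupport.toSchwartzMap_toFun]
    rw [ψ₀.one_of_mem_closedBall (by simpa [ψ₀] using hξ), Complex.ofReal_one]
  -- The decay of `Φ` must absorb the growth `(1 + ‖z‖)^β` of the shifted weight and remain
  -- integrable.
  obtain ⟨k, hk⟩ := exists_nat_gt (β + d)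
  obtain ⟨c, hc0, hcΦ⟩ := exists_schwartz_sub_le Φ k
  have hJ : Integrable fun z : E d => (1 + ‖z‖) ^ (-((k : ℝ) - β)) :=
    integrable_one_add_norm (by rw [finrank_euclideanSpace_fin]; linarith)
  set J : ℝ := ∫ z : E d, (1 + ‖z‖) ^ (-((k : ℝ) - β)) with hJdef
  have hJ0 : 0 ≤ J := integral_nonneg fun z => by positivity
  refine ⟨2 ^ (α / 2) * c * J, by positivity, fun g B hB hg x u hu => ?_⟩
  have hgi : Integrable g := integrable_of_potentialNorm_lt_top (hB.trans_lt ENNReal.coe_lt_top)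
  have hrep : ∀ x, 𝓕⁻ g x = conv (𝓕⁻ g) Φ x := by
    intro x
    rw [← fourierInv_mul_fourier hgi Φ.integrable, hΦψ]
    refine congrFun (congrArg _ (funext fun ξ => ?_)) x
    by_cases h : ‖ξ‖ ≤ 2
    · rw [hψ1 ξ h, mul_one]
    · rw [hg ξ (not_le.1 h), zero_mul]
  have hcont : Continuous (𝓕⁻ g) := by
    rw [Real.fourierInv_eq_fourier_comp_neg]
    exact continuous_fourier hgi.comp_neg
  have hκ : ∀ x, ‖𝓕⁻ g x‖ ≤ B * 2 ^ (α / 2) * (1 + ‖x‖) ^ (-β) :=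
    norm_fourierInv_le_of_potentialNorm_le hβ0 hβ hB
  have hbd : ∀ x, ‖𝓕⁻ g x‖ ≤ B * 2 ^ (α / 2) := fun x => (hκ x).trans
    (mul_le_of_le_one_right (by positivity)
      (Real.rpow_le_one_of_one_le_of_nonpos (by linarith [norm_nonneg x]) (by linarith)))
  have hi1 : Integrable fun z => Φ (z - u) * 𝓕⁻ g (x - z) :=
    (Φ.integrable.comp_sub_right u).mul_bdd
      (hcont.comp (continuous_const.sub continuous_id)).aestronglyMeasurable
      (Eventually.of_forall fun z => hbd _)
  have hi2 : Integrable fun z => Φ z * 𝓕⁻ g (x - z) :=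
    Φ.integrable.mul_bdd
      (hcont.comp (continuous_const.sub continuous_id)).aestronglyMeasurable
      (Eventually.of_forall fun z => hbd _)
  have hshift : conv (𝓕⁻ g) Φ (x - u) = ∫ z, Φ (z - u) * 𝓕⁻ g (x - z) := by
    rw [conv, ← integral_sub_right_eq_self _ u]
    congr 1 with z
    rw [sub_sub_sub_cancel_right]
  rw [hrep (x - u), hrep x, hshift, conv, ← integral_sub hi1 hi2]
  have hbound : ∀ z, ‖Φ (z - u) * 𝓕⁻ g (x - z) - Φ z * 𝓕⁻ g (x - z)‖ ≤
      (2 ^ (α / 2) * c * B * ‖u‖ * (1 + ‖x‖) ^ (-β)) * (1 + ‖z‖) ^ (-((k : ℝ) - β)) := by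
    intro z
    rw [← sub_mul, norm_mul]
    have hP : (1 + ‖x - z‖) ^ (-β) ≤ (1 + ‖x‖) ^ (-β) * (1 + ‖z‖) ^ β := by
      have h1 := Real.rpow_le_rpow (by positivity) (one_add_norm_le_mul x z) hβ0.le
      rw [Real.mul_rpow (by positivity) (by positivity)] at h1
      rw [Real.rpow_neg (by positivity), Real.rpow_neg (by positivity), inv_mul_eq_div,
        inv_eq_one_div, div_le_div_iff₀ (by positivity) (by positivity)]
      linarith
    calc ‖Φ (z - u) - Φ z‖ * ‖𝓕⁻ g (x - z)‖
        ≤ (c * ‖u‖ * (1 + ‖z‖) ^ (-(k : ℝ))) *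
          (B * 2 ^ (α / 2) * ((1 + ‖x‖) ^ (-β) * (1 + ‖z‖) ^ β)) := by
          gcongr
          · exact hcΦ z u hu
          · refine (hκ _).trans ?_
            gcongr
      _ = (2 ^ (α / 2) * c * B * ‖u‖ * (1 + ‖x‖) ^ (-β)) *
          ((1 + ‖z‖) ^ (-(k : ℝ)) * (1 + ‖z‖) ^ β) := by ring
      _ = _ := by
          rw [← Real.rpow_add (by positivity)]
          congr 2
          ring
  refine (norm_integral_le_of_norm_le (hJ.const_mul _) (Eventually.of_forall hbound)).trans_eq ?_
  rw [integral_const_mul, ← hJdef]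
  ring

theorem fourierInv_comp_smul (g : E d → ℂ) {s : ℝ} (hs : 0 < s) (x : E d) :
    𝓕⁻ (fun ξ => g (s • ξ)) x = ((s⁻¹ ^ d : ℝ) : ℂ) * 𝓕⁻ g (s⁻¹ • x) := by
  have h := Measure.integral_comp_smul (volume : Measure (E d))
    (fun ξ => Real.fourierChar (inner ℝ ξ (s⁻¹ • x)) • g ξ) s
  rw [Real.fourierInv_eq, Real.fourierInv_eq]
  have e : ∀ ξ : E d, inner ℝ (s • ξ) (s⁻¹ • x) = inner ℝ ξ x := by
    intro ξ
    rw [real_inner_smul_left, real_inner_smul_right, mul_inv_cancel_left₀ hs.ne']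
  simp only [e] at h
  rw [h, finrank_euclideanSpace_fin, abs_of_pos (by positivity), Complex.real_smul, inv_pow]

/-- A function in the potential space is bounded. -/
theorem ae_norm_le_of_potentialNorm_le {α β : ℝ} (hβd : (d : ℝ) < β) (hβ0 : 0 < β) (hβ : β ≤ α)
    {g : E d → ℂ} {B : ℝ≥0} (hB : potentialNorm α g ≤ B) :
    ∀ᵐ ξ, ‖g ξ‖ ≤ B * (2 ^ (α / 2) * ∫ x : E d, (1 + ‖x‖) ^ (-β)) := by
  have hgi : Integrable g := integrable_of_potentialNorm_lt_top (hB.trans_lt ENNReal.coe_lt_top)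
  have hJ : Integrable fun z : E d => (1 + ‖z‖) ^ (-β) :=
    integrable_one_add_norm (by rwa [finrank_euclideanSpace_fin])
  have hle := norm_fourier_le_of_potentialNorm_le hβ0 hβ hB
  have hi : Integrable (𝓕 g) := (hJ.const_mul (B * 2 ^ (α / 2))).mono'
    (continuous_fourier hgi).aestronglyMeasurable (Eventually.of_forall hle)
  filter_upwards [ae_eq_fourierInv_fourier hgi hi] with ξ hξ
  rw [hξ, Real.fourierInv_eq_fourier_neg]
  refine (norm_fourier_le _ _).trans ?_
  rw [← mul_assoc, ← integral_const_mul]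
  exact integral_mono hi.norm (hJ.const_mul _) hle

/-- If `2^N ≤ s < 2^{N+1}`, then `1/2 < 2^{-j} s < 2` forces `N - 1 < j < N + 2`. For `s ≤ 0`
nothing survives and any `N` serves. -/
theorem exists_forall_eq_or_eq_of_ne_zero {χ : ℝ → ℝ} (hχ : IsDyadicPartition χ) (s : ℝ) :
    ∃ N : ℤ, ∀ j : ℤ, χ (2 ^ (-j) * s) ≠ 0 → j = N ∨ j = N + 1 := by
  have hsupp : ∀ t, χ t ≠ 0 → 1 / 2 < t ∧ t < 2 := fun t ht =>
    hχ.tsupport_subset (subset_tsupport _ ht)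
  rcases le_or_gt s 0 with hs | hs
  · refine ⟨0, fun j hj => absurd (hsupp _ hj).1 (not_lt.2 ?_)⟩
    have : (2 : ℝ) ^ (-j) * s ≤ 0 := mul_nonpos_of_nonneg_of_nonpos (by positivity) hs
    linarith
  obtain ⟨N, hN1, hN2⟩ := exists_mem_Ico_zpow hs (one_lt_two (α := ℝ))
  refine ⟨N, fun j hj => ?_⟩
  obtain ⟨h1, h2⟩ := hsupp _ hj
  have hj1 : N - 1 < j := by
    by_contra! hcon
    have : (2 : ℝ) ≤ 2 ^ (-j) * s :=
      calc (2 : ℝ) = 2 ^ (1 : ℤ) := (zpow_one _).symm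
        _ ≤ 2 ^ (-j + N) := zpow_le_zpow_right₀ one_le_two (by omega)
        _ = 2 ^ (-j) * 2 ^ N := zpow_add₀ two_ne_zero _ _
        _ ≤ 2 ^ (-j) * s := by gcongr
    linarith
  have hj2 : j < N + 2 := by
    by_contra! hcon
    have : (2 : ℝ) ^ (-j) * s ≤ 1 / 2 :=
      calc (2 : ℝ) ^ (-j) * s ≤ 2 ^ (-j) * 2 ^ (N + 1) := by gcongr
        _ = 2 ^ (-j + (N + 1)) := (zpow_add₀ two_ne_zero _ _).symm
        _ ≤ 2 ^ (-1 : ℤ) := zpow_le_zpow_right₀ one_le_two (by omega)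
        _ = 1 / 2 := by norm_num
    linarith
  omega

/-- The piece of the multiplier `m(2π ·)` that is localized to frequencies of size `2^j`. -/
noncomputable def dyadicPiece (χ : ℝ → ℝ) (m : E d → ℂ) (j : ℤ) (ξ : E d) : ℂ :=
  (χ ‖(2 : ℝ) ^ (-j) • (2 * Real.pi) • ξ‖ : ℂ) * m ((2 * Real.pi) • ξ)

/-- The pieces are dilates of the functions `G j`, all of potential norm at most `B`, so each
property is a bound for `G j` transported by scaling. The factor `2π` in the dilation costs at most
`(2π)^β` in the weight. -/
theorem exists_isDyadicFamily {χ : ℝ → ℝ} (hχ : IsDyadicPartition χ) {α β : ℝ}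
    (hβd : (d : ℝ) < β) (hβ : β ≤ α) :
    ∃ C : ℝ≥0, 0 < C ∧ ∀ (m : E d → ℂ) (B : ℝ≥0), 0 < B → multiplierConst χ α m ≤ B →
      IsDyadicFamily β (C * B) (dyadicPiece χ m) := by
  have hβ0 : 0 < β := (Nat.cast_nonneg d).trans_lt hβd
  obtain ⟨c, hc0, hc⟩ := exists_norm_fourierInv_sub_le d hβ0 hβ
  set J : ℝ := ∫ x : E d, (1 + ‖x‖) ^ (-β) with hJ
  have hJ0 : 0 ≤ J := integral_nonneg fun z => by positivity
  have hpi : 0 < 2 * Real.pi := by positivity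
  have hpi1 : 1 ≤ 2 * Real.pi := by linarith [Real.pi_gt_three]
  -- The summands serve, in order, the bound of the multiplier, the size of the kernel and its
  -- smoothness.
  set C₀ : ℝ := 2 ^ (α / 2) * J + 2 ^ (α / 2) * (2 * Real.pi) ^ β + c * (2 * Real.pi) ^ β with hC₀
  have hp1 : 0 < 2 ^ (α / 2) * (2 * Real.pi) ^ β := by positivity
  have hp2 : 0 ≤ c * (2 * Real.pi) ^ β := by positivity
  have hp3 : 0 ≤ 2 ^ (α / 2) * J := by positivity
  have hC₀pos : 0 < C₀ := by linarith
  refine ⟨⟨C₀, hC₀pos.le⟩, hC₀pos, fun m B hB0 hB => ?_⟩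
  set G : ℤ → E d → ℂ := fun j ζ => (χ ‖ζ‖ : ℂ) * m ((2 : ℝ) ^ j • ζ) with hG
  have hGB : ∀ j, potentialNorm α (G j) ≤ B := fun j =>
    (le_iSup₂ (f := fun (t : ℝ) (_ : 0 < t) =>
      potentialNorm α fun ξ : E d => (χ ‖ξ‖ : ℂ) * m (t • ξ)) ((2 : ℝ) ^ j) (by positivity)).trans hB
  have hGint : ∀ j, Integrable (G j) := fun j =>
    integrable_of_potentialNorm_lt_top ((hGB j).trans_lt ENNReal.coe_lt_top)
  set s : ℤ → ℝ := fun j => 2 ^ (-j) * (2 * Real.pi) with hs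
  have hs0 : ∀ j, 0 < s j := fun j => by positivity
  have hsinv : ∀ j, (s j)⁻¹ = 2 ^ j * (2 * Real.pi)⁻¹ := by
    intro j
    simp only [hs]
    rw [mul_inv, zpow_neg, inv_inv]
  have hM : ∀ j, dyadicPiece χ m j = fun ξ => G j (s j • ξ) := by
    intro j
    funext ξ
    simp only [hG, hs, dyadicPiece, smul_smul]
    congr 3
    rw [zpow_neg, mul_inv_cancel_left₀ (by positivity)]
  have hG0 : ∀ j ξ, 2 < ‖ξ‖ → G j ξ = 0 := by
    intro j ξ hξ
    have : χ ‖ξ‖ = 0 := by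
      by_contra h
      exact absurd (hχ.tsupport_subset (subset_tsupport _ h)).2 (not_lt.2 hξ.le)
    simp [hG, this]
  have hK : ∀ j x, 𝓕⁻ (dyadicPiece χ m j) x =
      (((s j)⁻¹ ^ d : ℝ) : ℂ) * 𝓕⁻ (G j) ((s j)⁻¹ • x) := fun j x => by
    rw [hM j]
    exact fourierInv_comp_smul (G j) (hs0 j) x
  have hw : ∀ (j : ℤ) (x : E d), (s j)⁻¹ ^ d * (1 + ‖(s j)⁻¹ • x‖) ^ (-β) ≤
      (2 * Real.pi) ^ β * weight β (2 ^ j) x := by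
    intro j x
    have h1 : (s j)⁻¹ ^ d ≤ (2 ^ j) ^ d := by
      gcongr
      rw [hsinv]
      exact mul_le_of_le_one_right (by positivity) (inv_le_one_of_one_le₀ hpi1)
    have h2 : (1 + (2 : ℝ) ^ j * ‖x‖) / (2 * Real.pi) ≤ 1 + ‖(s j)⁻¹ • x‖ := by
      rw [norm_smul, Real.norm_of_nonneg (inv_nonneg.2 (hs0 j).le), hsinv, add_div]
      gcongr
      · exact div_le_one_of_le₀ hpi1 hpi.le
      · apply le_of_eq
        field_simp
    have h3 : (1 + ‖(s j)⁻¹ • x‖) ^ (-β) ≤ (2 * Real.pi) ^ β * (1 + 2 ^ j * ‖x‖) ^ (-β) := by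
      refine (Real.rpow_le_rpow_of_nonpos (by positivity) h2 (by linarith)).trans_eq ?_
      rw [Real.div_rpow (by positivity) hpi.le, Real.rpow_neg hpi.le, div_inv_eq_mul, mul_comm]
    rw [weight]
    calc (s j)⁻¹ ^ d * (1 + ‖(s j)⁻¹ • x‖) ^ (-β)
        ≤ (2 ^ j) ^ d * ((2 * Real.pi) ^ β * (1 + 2 ^ j * ‖x‖) ^ (-β)) := by gcongr
      _ = _ := by ring
  have hw0 : ∀ (j : ℤ) (x : E d), 0 ≤ weight β (2 ^ j) x := fun j x => by
    rw [weight]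
    positivity
  refine ⟨mul_pos hC₀pos hB0, fun j => ?_, fun j => ?_, fun ξ => ?_, fun j x => ?_,
    fun j x u hu => ?_⟩
  · rw [hM j]
    exact (hGint j).comp_smul (hs0 j).ne'
  · have h := ae_norm_le_of_potentialNorm_le hβd hβ0 hβ (hGB j)
    have h' : ∀ᵐ ξ, ‖G j (s j • ξ)‖ ≤ B * (2 ^ (α / 2) * J) :=
      (Measure.quasiMeasurePreserving_smul volume (hs0 j).ne').ae h
    rw [hM j]
    filter_upwards [h'] with ξ hξ
    refine hξ.trans ?_
    change (B : ℝ) * (2 ^ (α / 2) * J) ≤ C₀ * B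
    rw [mul_comm]
    gcongr
    linarith
  · obtain ⟨N, hN⟩ := exists_forall_eq_or_eq_of_ne_zero hχ ‖(2 * Real.pi) • ξ‖
    refine ⟨N, fun j hj => hN j fun h0 => hj ?_⟩
    rw [dyadicPiece, norm_smul, Real.norm_of_nonneg (by positivity), h0]
    simp
  · rw [hK, norm_mul, Complex.norm_real, Real.norm_of_nonneg (by have := hs0 j; positivity)]
    change _ ≤ C₀ * B * _
    calc (s j)⁻¹ ^ d * ‖𝓕⁻ (G j) ((s j)⁻¹ • x)‖
        ≤ (s j)⁻¹ ^ d * (B * 2 ^ (α / 2) * (1 + ‖(s j)⁻¹ • x‖) ^ (-β)) := by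
          have := hs0 j
          gcongr
          exact norm_fourierInv_le_of_potentialNorm_le hβ0 hβ (hGB j) _
      _ = B * 2 ^ (α / 2) * ((s j)⁻¹ ^ d * (1 + ‖(s j)⁻¹ • x‖) ^ (-β)) := by ring
      _ ≤ B * 2 ^ (α / 2) * ((2 * Real.pi) ^ β * weight β (2 ^ j) x) := by
          exact mul_le_mul_of_nonneg_left (hw j x) (by positivity)
      _ = (2 ^ (α / 2) * (2 * Real.pi) ^ β) * B * weight β (2 ^ j) x := by ring
      _ ≤ C₀ * B * weight β (2 ^ j) x := by
          have := hw0 j x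
          gcongr
          linarith
  · have hu' : ‖(s j)⁻¹ • u‖ ≤ 2 ^ j * ‖u‖ := by
      rw [norm_smul, Real.norm_of_nonneg (inv_nonneg.2 (hs0 j).le), hsinv]
      gcongr
      exact mul_le_of_le_one_right (by positivity) (inv_le_one_of_one_le₀ hpi1)
    rw [hK, hK, ← mul_sub, norm_mul, Complex.norm_real,
      Real.norm_of_nonneg (by have := hs0 j; positivity), smul_sub]
    change _ ≤ C₀ * B * _ * _
    calc (s j)⁻¹ ^ d * ‖𝓕⁻ (G j) ((s j)⁻¹ • x - (s j)⁻¹ • u) - 𝓕⁻ (G j) ((s j)⁻¹ • x)‖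
        ≤ (s j)⁻¹ ^ d * (c * B * ‖(s j)⁻¹ • u‖ * (1 + ‖(s j)⁻¹ • x‖) ^ (-β)) := by
          have := hs0 j
          gcongr
          exact hc (G j) B (hGB j) (hG0 j) _ _ (hu'.trans hu)
      _ = c * B * ‖(s j)⁻¹ • u‖ * ((s j)⁻¹ ^ d * (1 + ‖(s j)⁻¹ • x‖) ^ (-β)) := by ring
      _ ≤ c * B * (2 ^ j * ‖u‖) * ((2 * Real.pi) ^ β * weight β (2 ^ j) x) := by
          have := hs0 j
          exact mul_le_mul (by gcongr) (hw j x) (by positivity) (by positivity)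
      _ = (c * (2 * Real.pi) ^ β) * B * (2 ^ j * ‖u‖) * weight β (2 ^ j) x := by ring
      _ ≤ C₀ * B * (2 ^ j * ‖u‖) * weight β (2 ^ j) x := by
          have := hw0 j x
          gcongr
          linarith

/-! ### Properties of the weights -/

theorem weight_nonneg {β t : ℝ} (ht : 0 ≤ t) (x : E d) : 0 ≤ weight β t x := by
  rw [weight]
  positivity

theorem continuous_weight {β t : ℝ} (ht : 0 ≤ t) : Continuous (weight (d := d) β t) := by
  unfold weight
  refine continuous_const.mul (Continuous.rpow_const (by fun_prop) fun x => Or.inl ?_)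
  positivity

theorem integrable_weight {β t : ℝ} (hβ : (d : ℝ) < β) (ht : 0 < t) :
    Integrable (weight (d := d) β t) := by
  have h : Integrable fun x : E d => (1 + ‖x‖) ^ (-β) :=
    integrable_one_add_norm (by rwa [finrank_euclideanSpace_fin])
  have h2 := (h.comp_smul ht.ne').const_mul (t ^ d)
  simp only [norm_smul, Real.norm_of_nonneg ht.le] at h2
  exact h2

theorem integral_weight {β t : ℝ} (ht : 0 < t) :
    ∫ x : E d, weight β t x = ∫ x : E d, (1 + ‖x‖) ^ (-β) := by
  have h := Measure.integral_comp_smul (volume : Measure (E d)) (fun x => (1 + ‖x‖) ^ (-β)) t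
  simp only [norm_smul, Real.norm_of_nonneg ht.le] at h
  simp only [weight]
  rw [integral_const_mul, h, finrank_euclideanSpace_fin, abs_of_pos (by positivity), smul_eq_mul,
    mul_inv_cancel_left₀ (by positivity)]

theorem lintegral_weight {β t : ℝ} (hβ : (d : ℝ) < β) (ht : 0 < t) :
    ∫⁻ x : E d, ENNReal.ofReal (weight β t x) =
      ENNReal.ofReal (∫ x : E d, (1 + ‖x‖) ^ (-β)) := by
  rw [← integral_weight ht, ofReal_integral_eq_lintegral_ofReal (integrable_weight hβ ht)
    (Eventually.of_forall fun x => weight_nonneg ht.le x)]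

/-- A larger argument gives a smaller weight. -/
theorem weight_le_of_norm_le {β t : ℝ} (hβ : 0 ≤ β) (ht : 0 ≤ t) {x y : E d}
    (h : ‖x‖ ≤ 2 * ‖y‖) : weight β t y ≤ 2 ^ β * weight β t x := by
  have h1 : (1 + t * ‖x‖) / 2 ≤ 1 + t * ‖y‖ := by
    nlinarith [mul_le_mul_of_nonneg_left h ht, norm_nonneg x]
  have h2 := Real.rpow_le_rpow_of_nonpos (by positivity) h1 (neg_nonpos.2 hβ)
  rw [Real.div_rpow (by positivity) (by norm_num), Real.rpow_neg (by norm_num : (0 : ℝ) ≤ 2),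
    div_inv_eq_mul] at h2
  rw [weight, weight]
  calc t ^ d * (1 + t * ‖y‖) ^ (-β) ≤ t ^ d * ((1 + t * ‖x‖) ^ (-β) * 2 ^ β) := by gcongr
    _ = _ := by ring

/-- Trading decay of the weight for smallness away from the origin. -/
theorem weight_le_rpow_mul_weight {β ε t R : ℝ} (hε : 0 ≤ ε) (ht : 0 < t) (hR : 0 < R) {x : E d}
    (hx : R ≤ ‖x‖) : weight β t x ≤ (t * R) ^ (-ε) * weight (β - ε) t x := by
  have h1 : t * R ≤ 1 + t * ‖x‖ := by
    have := mul_le_mul_of_nonneg_left hx ht.le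
    linarith
  have h2 := Real.rpow_le_rpow_of_nonpos (by positivity) h1 (neg_nonpos.2 hε)
  rw [weight, weight]
  calc t ^ d * (1 + t * ‖x‖) ^ (-β)
      = (1 + t * ‖x‖) ^ (-ε) * (t ^ d * (1 + t * ‖x‖) ^ (-(β - ε))) := by
        rw [mul_left_comm, ← Real.rpow_add (by positivity)]
        congr 2
        ring
    _ ≤ _ := by gcongr

theorem sum_pow_le_of_injOn {ι : Type*} {θ : ℝ} (h0 : 0 ≤ θ) (h1 : θ < 1) (J : Finset ι)
    (e : ι → ℕ) (he : InjOn e J) : ∑ j ∈ J, θ ^ e j ≤ (1 - θ)⁻¹ := by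
  classical
  rw [← Finset.sum_image (f := fun i => θ ^ i) he, ← tsum_geometric_of_lt_one h0 h1]
  exact (summable_geometric_of_lt_one h0 h1).sum_le_tsum _ fun i _ => by positivity

/-- A two-sided geometric series, one for each sign of `j + N`. In Hörmander's condition these are
the scales on either side of `‖y‖⁻¹`. -/
theorem sum_pow_natAbs_le {θ : ℝ} (h0 : 0 ≤ θ) (h1 : θ < 1) (J : Finset ℤ) (N : ℤ) :
    ∑ j ∈ J, θ ^ (j + N).natAbs ≤ 2 * (1 - θ)⁻¹ := by
  rw [← Finset.sum_filter_add_sum_filter_not J fun j => 0 ≤ j + N, two_mul]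
  refine add_le_add (sum_pow_le_of_injOn h0 h1 _ _ ?_) (sum_pow_le_of_injOn h0 h1 _ _ ?_)
  · intro a ha b hb hab
    simp only [Finset.coe_filter, mem_ofPred_eq] at ha hb hab
    omega
  · intro a ha b hb hab
    simp only [Finset.coe_filter, mem_ofPred_eq] at ha hb hab
    omega

/-- The low frequency sum. -/
theorem sum_weight_low_le {β : ℝ} (hβ : 0 ≤ β) (hβd : β < d + 1) (n : ℤ) (J : Finset ℤ)
    (hJ : ∀ j ∈ J, j ≤ n) (x : E d) :
    ∑ j ∈ J, (2 : ℝ) ^ (j - n) * weight β (2 ^ j) x ≤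
      (1 - (2 : ℝ) ^ (-(d + 1 - β)))⁻¹ * weight β (2 ^ n) x := by
  set θ : ℝ := (2 : ℝ) ^ (-(d + 1 - β)) with hθ
  have h0 : 0 ≤ θ := by positivity
  have h1 : θ < 1 := Real.rpow_lt_one_of_one_lt_of_neg (by norm_num) (by linarith)
  -- With `n = j + i`, passing from scale `j` to scale `n` costs `2^{i(β-d)}`. The factor `2^{-i}`
  -- wins because `β < d + 1`.
  have hterm : ∀ j ∈ J, (2 : ℝ) ^ (j - n) * weight β (2 ^ j) x ≤
      θ ^ (n - j).toNat * weight β (2 ^ n) x := by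
    intro j hj
    obtain ⟨i, hi⟩ := Int.eq_ofNat_of_zero_le (sub_nonneg.2 (hJ j hj))
    have hn : n = j + i := by omega
    subst hn
    simp only [weight, add_sub_cancel_left, Int.toNat_natCast, sub_add_cancel_left]
    set s : ℝ := 2 ^ j * ‖x‖ with hs
    have hs0 : 0 ≤ s := by positivity
    have e1 : (2 : ℝ) ^ (j + (i : ℤ)) * ‖x‖ = 2 ^ i * s := by
      rw [zpow_add₀ two_ne_zero, zpow_natCast, hs]
      ring
    have h2 : (1 + s) ^ (-β) ≤ (2 ^ i) ^ β * (1 + 2 ^ i * s) ^ (-β) := by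
      have h3 : (1 + 2 ^ i * s) / 2 ^ i ≤ 1 + s := by
        rw [div_le_iff₀ (by positivity)]
        nlinarith [one_le_pow₀ (M₀ := ℝ) one_le_two (n := i)]
      refine (Real.rpow_le_rpow_of_nonpos (by positivity) h3 (neg_nonpos.2 hβ)).trans_eq ?_
      rw [Real.div_rpow (by positivity) (by positivity), Real.rpow_neg (x := 2 ^ i) (by positivity),
        div_inv_eq_mul, mul_comm]
    rw [e1, zpow_neg, zpow_natCast, zpow_add₀ two_ne_zero, zpow_natCast, mul_pow]
    have e2 : θ ^ i = ((2 : ℝ) ^ i) ^ β * (((2 : ℝ) ^ i)⁻¹ * ((2 : ℝ) ^ i) ^ d)⁻¹ * (((2 : ℝ) ^ i)⁻¹ * ((2 : ℝ) ^ i)⁻¹) := by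
      have hp : (0 : ℝ) < 2 ^ i := by positivity
      rw [hθ, ← Real.rpow_natCast, ← Real.rpow_mul (by norm_num), mul_comm, Real.rpow_mul (by norm_num),
        Real.rpow_natCast, ← Real.rpow_natCast _ d]
      rw [show -((d : ℝ) + 1 - β) = β - d - 1 by ring, Real.rpow_sub hp, Real.rpow_sub hp, Real.rpow_one]
      field_simp
    rw [e2]
    calc ((2 : ℝ) ^ i)⁻¹ * ((2 ^ j) ^ d * (1 + s) ^ (-β))
        ≤ ((2 : ℝ) ^ i)⁻¹ * ((2 ^ j) ^ d * ((2 ^ i) ^ β * (1 + 2 ^ i * s) ^ (-β))) := by gcongr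
      _ = _ := by
        field_simp
  refine (Finset.sum_le_sum hterm).trans ?_
  rw [← Finset.sum_mul]
  refine mul_le_mul_of_nonneg_right (sum_pow_le_of_injOn h0 h1 _ _ ?_)
    (weight_nonneg (by positivity) x)
  intro a ha b hb hab
  have := hJ a ha
  have := hJ b hb
  simp only at hab
  omega

/-- The high frequency sum, away from the origin. -/
theorem sum_weight_high_le {β : ℝ} (hβ : (d : ℝ) < β) (n : ℤ) (J : Finset ℤ)
    (hJ : ∀ j ∈ J, n ≤ j) {x : E d} (hx : 1 ≤ 2 ^ n * ‖x‖) :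
    ∑ j ∈ J, weight β (2 ^ j) x ≤
      2 ^ β * (1 - (2 : ℝ) ^ (-(β - d)))⁻¹ * weight β (2 ^ n) x := by
  set θ : ℝ := (2 : ℝ) ^ (-(β - d)) with hθ
  have hβ0 : 0 < β := (Nat.cast_nonneg d).trans_lt hβ
  have h0 : 0 ≤ θ := by positivity
  have h1 : θ < 1 := Real.rpow_lt_one_of_one_lt_of_neg (by norm_num) (by linarith)
  -- With `j = n + i` and `s = 2^n ‖x‖ ≥ 1`, one has `1 + 2^i s ≥ 2^i (1 + s) / 2`, so the weight
  -- loses a factor `2^{-i(β-d)}`.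
  have hterm : ∀ j ∈ J, weight β (2 ^ j) x ≤ θ ^ (j - n).toNat * (2 ^ β * weight β (2 ^ n) x) := by
    intro j hj
    obtain ⟨i, hi⟩ := Int.eq_ofNat_of_zero_le (sub_nonneg.2 (hJ j hj))
    have hn : j = n + i := by omega
    subst hn
    simp only [weight, add_sub_cancel_left, Int.toNat_natCast]
    set s : ℝ := 2 ^ n * ‖x‖ with hs
    have e1 : (2 : ℝ) ^ (n + (i : ℤ)) * ‖x‖ = 2 ^ i * s := by
      rw [zpow_add₀ two_ne_zero, zpow_natCast, hs]
      ring
    have h2 : (1 + 2 ^ i * s) ^ (-β) ≤ (2 ^ i) ^ (-β) * (2 ^ β * (1 + s) ^ (-β)) := by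
      have h3 : 2 ^ i * ((1 + s) / 2) ≤ 1 + 2 ^ i * s := by
        nlinarith [one_le_pow₀ (M₀ := ℝ) one_le_two (n := i)]
      refine (Real.rpow_le_rpow_of_nonpos (by positivity) h3 (neg_nonpos.2 hβ0.le)).trans_eq ?_
      rw [Real.mul_rpow (by positivity) (by positivity),
        Real.div_rpow (by positivity) (by positivity), Real.rpow_neg (x := 2) (by positivity),
        div_inv_eq_mul, mul_comm ((1 + s) ^ (-β))]
    have e2 : θ ^ i = ((2 : ℝ) ^ i) ^ (-β) * ((2 : ℝ) ^ i) ^ d := by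
      have hp : (0 : ℝ) < 2 ^ i := by positivity
      rw [hθ, ← Real.rpow_natCast, ← Real.rpow_mul (by norm_num), mul_comm,
        Real.rpow_mul (by norm_num), Real.rpow_natCast, ← Real.rpow_natCast _ d,
        ← Real.rpow_add hp]
      congr 1
      ring
    rw [e1, zpow_add₀ two_ne_zero, zpow_natCast, mul_pow, e2]
    calc ((2 : ℝ) ^ n) ^ d * (2 ^ i) ^ d * (1 + 2 ^ i * s) ^ (-β)
        ≤ ((2 : ℝ) ^ n) ^ d * (2 ^ i) ^ d * ((2 ^ i) ^ (-β) * (2 ^ β * (1 + s) ^ (-β))) := by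
          gcongr
      _ = _ := by ring
  refine (Finset.sum_le_sum hterm).trans ?_
  rw [← Finset.sum_mul, mul_right_comm, mul_comm _ (1 - θ)⁻¹]
  refine mul_le_mul_of_nonneg_right (sum_pow_le_of_injOn h0 h1 _ _ ?_)
    (mul_nonneg (by positivity) (weight_nonneg (by positivity) x))
  intro a ha b hb hab
  have := hJ a ha
  have := hJ b hb
  simp only at hab
  omega

/-- Convolution with a weight is dominated by the maximal function. -/
theorem exists_lintegral_weight_mul_le_maximalFunction {β : ℝ} (hβ : (d : ℝ) < β) :
    ∃ c : ℝ≥0, ∀ (t : ℝ), 0 < t → ∀ (f : E d → ℂ), AEStronglyMeasurable f → ∀ x : E d,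
      ∫⁻ z, ENNReal.ofReal (weight β t (x - z)) * ‖f z‖ₑ ≤
        c * maximalFunction (fun y => ‖f y‖ₑ) x := by
  have hβ0 : 0 < β := (Nat.cast_nonneg d).trans_lt hβ
  set θ : ℝ := (2 : ℝ) ^ (-(β - d)) with hθ
  have h0 : 0 < θ := by positivity
  have h1 : θ < 1 := Real.rpow_lt_one_of_one_lt_of_neg (by norm_num) (by linarith)
  set v : ℝ≥0∞ := volume (Metric.ball (0 : E d) 1) with hv
  have hvfin : v ≠ ⊤ := measure_ball_lt_top.ne
  have hsum : ∑' i : ℕ, ENNReal.ofReal θ ^ i ≠ ⊤ := by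
    rw [ENNReal.tsum_geometric]
    refine ENNReal.inv_ne_top.2 (tsub_pos_of_lt ?_).ne'
    exact ENNReal.ofReal_lt_one.2 h1
  refine ⟨(ENNReal.ofReal (2 ^ β) * v * ∑' i : ℕ, ENNReal.ofReal θ ^ i).toNNReal,
    fun t ht f hf x => ?_⟩
  rw [ENNReal.coe_toNNReal (ENNReal.mul_ne_top (ENNReal.mul_ne_top ENNReal.ofReal_ne_top hvfin)
    hsum)]
  set S : ℕ → Set (E d) := fun i => Metric.ball x (2 ^ i / t) with hS
  have hSm : ∀ i, MeasurableSet (S i) := fun i => Metric.isOpen_ball.measurableSet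
  set a : ℕ → ℝ≥0∞ := fun i => ENNReal.ofReal (2 ^ β * t ^ d * ((2 : ℝ) ^ i) ^ (-β)) with ha
  -- The weight is dominated by a sum of multiples of indicators of the balls of radius `2^i / t`.
  -- The product of coefficient and volume is geometric in `i`, with ratio `θ < 1`.
  have hpt : ∀ z, ENNReal.ofReal (weight β t (x - z)) ≤
      ∑' i, a i * (S i).indicator (fun _ => 1) z := by
    intro z
    set s : ℝ := t * ‖x - z‖ with hs
    have hs0 : 0 ≤ s := by positivity
    -- One term suffices: an `i` for which `2^i` exceeds `s` but is at most `2(1 + s)`.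
    have key : ∀ i : ℕ, s < 2 ^ i → (2 : ℝ) ^ i ≤ 2 * (1 + s) → ENNReal.ofReal (weight β t (x - z)) ≤
        ∑' i, a i * (S i).indicator (fun _ => 1) z := by
      intro i hi1 hi2
      refine le_trans ?_ (ENNReal.le_tsum i)
      have hz : z ∈ S i := by
        rw [hS, Metric.mem_ball, dist_eq_norm, norm_sub_rev, lt_div_iff₀ ht, mul_comm]
        exact hi1
      rw [indicator_of_mem hz, mul_one]
      refine ENNReal.ofReal_le_ofReal ?_
      rw [weight, ← hs]
      have h3 := Real.rpow_le_rpow_of_nonpos (x := 2 ^ i / 2) (y := 1 + s) (z := -β)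
        (by positivity) (by linarith) (by linarith)
      rw [Real.div_rpow (by positivity) (by norm_num), Real.rpow_neg (by norm_num : (0 : ℝ) ≤ 2) β,
        div_inv_eq_mul] at h3
      calc t ^ d * (1 + s) ^ (-β) ≤ t ^ d * ((2 ^ i) ^ (-β) * 2 ^ β) := by gcongr
        _ = _ := by ring
    rcases lt_or_ge s 1 with h | h
    · exact key 0 (by simpa using h) (by rw [pow_zero]; linarith)
    · obtain ⟨n, hn1, hn2⟩ := exists_nat_pow_near h (one_lt_two (α := ℝ))
      exact key (n + 1) hn2 (by rw [pow_succ]; linarith)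
  have hball : ∀ i, a i * ∫⁻ z in S i, ‖f z‖ₑ ≤ ENNReal.ofReal (2 ^ β) * v *
      maximalFunction (fun y => ‖f y‖ₑ) x * ENNReal.ofReal θ ^ i := by
    intro i
    have hr : 0 < 2 ^ i / t := by positivity
    rw [hS, ← measure_mul_setLAverage _ measure_ball_lt_top.ne, Measure.addHaar_ball_of_pos _ _ hr,
      finrank_euclideanSpace_fin, ← hv]
    have hM : (⨍⁻ z in Metric.ball x (2 ^ i / t), ‖f z‖ₑ ∂volume) ≤
        maximalFunction (fun y => ‖f y‖ₑ) x :=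
      le_iSup₂ (f := fun (ρ : ℝ) (_ : 0 < ρ) => ⨍⁻ y in Metric.ball x ρ, ‖f y‖ₑ ∂volume) _ hr
    have hcoef : a i * ENNReal.ofReal ((2 ^ i / t) ^ d) =
        ENNReal.ofReal (2 ^ β) * ENNReal.ofReal θ ^ i := by
      rw [ha, ← ENNReal.ofReal_mul (by positivity), ← ENNReal.ofReal_pow h0.le,
        ← ENNReal.ofReal_mul (by positivity)]
      congr 1
      have e2 : θ ^ i = ((2 : ℝ) ^ i) ^ (-β) * ((2 : ℝ) ^ i) ^ d := by
        have hp : (0 : ℝ) < 2 ^ i := by positivity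
        rw [hθ, ← Real.rpow_natCast, ← Real.rpow_mul (by norm_num), mul_comm,
          Real.rpow_mul (by norm_num), Real.rpow_natCast, ← Real.rpow_natCast _ d,
          ← Real.rpow_add hp]
        congr 1
        ring
      rw [e2, div_pow]
      field_simp
    calc a i * (ENNReal.ofReal ((2 ^ i / t) ^ d) * v * ⨍⁻ z in Metric.ball x (2 ^ i / t), ‖f z‖ₑ ∂volume)
        ≤ a i * (ENNReal.ofReal ((2 ^ i / t) ^ d) * v * maximalFunction (fun y => ‖f y‖ₑ) x) := by
          gcongr
      _ = (a i * ENNReal.ofReal ((2 ^ i / t) ^ d)) * v * maximalFunction (fun y => ‖f y‖ₑ) x := by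
          ring
      _ = _ := by
          rw [hcoef]
          ring
  calc ∫⁻ z, ENNReal.ofReal (weight β t (x - z)) * ‖f z‖ₑ
      ≤ ∫⁻ z, ∑' i, a i * (S i).indicator (fun z => ‖f z‖ₑ) z := by
        refine lintegral_mono fun z => ?_
        refine (mul_le_mul_left (hpt z) _).trans_eq ?_
        rw [← ENNReal.tsum_mul_right]
        congr 1 with i
        by_cases hz : z ∈ S i <;> simp [hz]
    _ = ∑' i, a i * ∫⁻ z in S i, ‖f z‖ₑ := by
        rw [lintegral_tsum fun i => (hf.enorm.indicator (hSm i)).const_mul _]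
        congr 1 with i
        rw [lintegral_const_mul'' _ (hf.enorm.indicator (hSm i)), lintegral_indicator (hSm i)]
    _ ≤ ∑' i, ENNReal.ofReal (2 ^ β) * v *
          maximalFunction (fun y => ‖f y‖ₑ) x * ENNReal.ofReal θ ^ i := ENNReal.tsum_le_tsum hball
    _ = _ := by
        rw [ENNReal.tsum_mul_left]
        ring

/-- Convolution of a weight with an `L^p` function is finite everywhere. -/
theorem exists_lintegral_weight_mul_le_eLpNorm {β : ℝ} (hβ : (d : ℝ) < β) {t : ℝ} (ht : 0 < t)
    {p : ℝ} (hp : 1 ≤ p) :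
    ∃ c : ℝ≥0, ∀ f : E d → ℂ, AEStronglyMeasurable f → ∀ x : E d,
      ∫⁻ z, ENNReal.ofReal (weight β t (x - z)) * ‖f z‖ₑ ≤
        c * (∫⁻ z, ‖f z‖ₑ ^ p) ^ (1 / p) := by
  have hβ0 : 0 < β := (Nat.cast_nonneg d).trans_lt hβ
  have hle : ∀ x : E d, weight β t x ≤ t ^ d := fun x => by
    rw [weight]
    refine mul_le_of_le_one_right (by positivity)
      (Real.rpow_le_one_of_one_le_of_nonpos ?_ (by linarith))
    have : 0 ≤ t * ‖x‖ := by positivity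
    linarith
  rcases hp.eq_or_lt with rfl | hp1
  · refine ⟨(t ^ d).toNNReal, fun f hf x => ?_⟩
    simp only [ENNReal.rpow_one, div_one]
    rw [← lintegral_const_mul'' _ hf.enorm]
    gcongr with z
    exact ENNReal.ofReal_le_ofReal (hle _)
  · have hpq := Real.HolderConjugate.conjExponent hp1
    set q := p.conjExponent with hq
    have hq1 : 1 < q := hpq.symm.lt
    -- The weight is bounded and integrable, hence lies in `L^q`, and Hölder's inequality applies.
    -- The case `p = 1` uses boundedness alone.
    have hfin : ∫⁻ x : E d, ENNReal.ofReal (weight β t x) ^ q < ⊤ := by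
      have h := (integrable_weight (d := d) hβ ht).const_mul ((t ^ d) ^ (q - 1))
      refine lt_of_le_of_lt (lintegral_mono fun x => ?_) h.2
      have hw := weight_nonneg (β := β) ht.le x
      rw [ENNReal.ofReal_rpow_of_nonneg hw (by linarith), ← ofReal_norm,
        Real.norm_of_nonneg (by positivity)]
      refine ENNReal.ofReal_le_ofReal ?_
      calc weight β t x ^ q = weight β t x ^ (q - 1) * weight β t x := by
            rw [← Real.rpow_add_one' hw (by linarith)]
            congr 1
            ring
        _ ≤ (t ^ d) ^ (q - 1) * weight β t x := by
            gcongr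
            exact hle x
    have hfin' : (∫⁻ x : E d, ENNReal.ofReal (weight β t x) ^ q) ^ (1 / q) ≠ ⊤ :=
      ENNReal.rpow_ne_top_of_nonneg (by positivity) hfin.ne
    refine ⟨((∫⁻ x : E d, ENNReal.ofReal (weight β t x) ^ q) ^ (1 / q)).toNNReal,
      fun f hf x => ?_⟩
    rw [ENNReal.coe_toNNReal hfin']
    have hm : Measurable fun z : E d => ENNReal.ofReal (weight β t (x - z)) :=
      ((continuous_weight ht.le).comp (continuous_const.sub continuous_id)).measurable.ennreal_ofReal
    refine (ENNReal.lintegral_mul_le_Lp_mul_Lq volume hpq.symm hm.aemeasurable hf.enorm).trans_eq ?_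
    rw [lintegral_sub_left_eq_self (fun z => ENNReal.ofReal (weight β t z) ^ q) x]

/-! ### Finite sums of dyadic kernels -/

/-- A finite sum of dyadic kernels. -/
noncomputable def kernelSum (M : ℤ → E d → ℂ) (J : Finset ℤ) (x : E d) : ℂ := ∑ j ∈ J, 𝓕⁻ (M j) x

theorem fourierInv_finset_sum {M : ℤ → E d → ℂ} (hM : ∀ j, Integrable (M j)) (J : Finset ℤ) :
    𝓕⁻ (fun ξ => ∑ j ∈ J, M j ξ) = kernelSum M J := by
  funext x
  simp only [kernelSum, Real.fourierInv_eq, Finset.smul_sum]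
  refine integral_finsetSum _ fun j _ => ?_
  refine (hM j).mono ?_ (Eventually.of_forall fun ξ => by simp [Circle.norm_smul])
  exact (Continuous.aestronglyMeasurable (by fun_prop)).smul (hM j).1

namespace IsDyadicFamily

variable {β : ℝ} {A : ℝ≥0} {M : ℤ → E d → ℂ}

theorem continuous_kernel (hM : IsDyadicFamily β A M) (j : ℤ) : Continuous (𝓕⁻ (M j)) := by
  rw [Real.fourierInv_eq_fourier_comp_neg]
  exact continuous_fourier (hM.integrable j).comp_neg

theorem integrable_kernel (hM : IsDyadicFamily β A M) (hβ : (d : ℝ) < β) (j : ℤ) :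
    Integrable (𝓕⁻ (M j)) :=
  ((integrable_weight hβ (by positivity)).const_mul (A : ℝ)).mono'
    (hM.continuous_kernel j).aestronglyMeasurable (Eventually.of_forall (hM.size j))

theorem integrable_kernelSum (hM : IsDyadicFamily β A M) (hβ : (d : ℝ) < β) (J : Finset ℤ) :
    Integrable (kernelSum M J) :=
  integrable_finsetSum _ fun j _ => hM.integrable_kernel hβ j

theorem sum_eq_of_support {ξ : E d} {N : ℤ} (hN : ∀ j, M j ξ ≠ 0 → j = N ∨ j = N + 1)
    (J : Finset ℤ) : ∑ j ∈ J, M j ξ = ∑ j ∈ J.filter (· ∈ ({N, N + 1} : Finset ℤ)), M j ξ := by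
  refine (Finset.sum_filter_of_ne fun j _ hj => ?_).symm
  simpa using hN j hj

/-- At most two pieces are nonzero at any frequency, so the bound does not depend on `J`. -/
theorem norm_sum_le (hM : IsDyadicFamily β A M) :
    ∀ᵐ ξ, ∀ J : Finset ℤ, ‖∑ j ∈ J, M j ξ‖ ≤ 2 * A := by
  filter_upwards [ae_all_iff.2 hM.bound] with ξ hξ J
  obtain ⟨N, hN⟩ := hM.support ξ
  rw [sum_eq_of_support hN]
  refine (norm_sum_le_of_le _ fun j _ => hξ j).trans ?_
  rw [Finset.sum_const, nsmul_eq_mul]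
  gcongr
  have h1 : (J.filter (· ∈ ({N, N + 1} : Finset ℤ))).card ≤ 2 := by
    refine (Finset.card_le_card (t := {N, N + 1}) fun j hj => (Finset.mem_filter.1 hj).2).trans ?_
    exact Finset.card_le_two
  exact_mod_cast h1

/-- Hörmander's integral for a single dyadic kernel. -/
theorem lintegral_kernel_sub_le (hM : IsDyadicFamily β A M) (hβ : (d : ℝ) < β) (hβd : β < d + 1)
    {y : E d} {N : ℤ} (hN1 : (2 : ℝ) ^ N ≤ ‖y‖) (hN2 : ‖y‖ < 2 ^ (N + 1)) (j : ℤ) :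
    ∫⁻ x in {x | 2 * ‖y‖ ≤ ‖x‖}, ‖𝓕⁻ (M j) (x - y) - 𝓕⁻ (M j) x‖ₑ ≤
      ENNReal.ofReal (2 * A * (∫ x : E d, (1 + ‖x‖) ^ (-((β + d) / 2))) *
        ((2 : ℝ) ^ (-((β - d) / 2))) ^ (j + N).natAbs) := by
  -- Half of the excess of `β` over `d` is spent on decay in the scale; the remaining exponent `β -
  -- ε` still exceeds `d`, so the weight stays integrable.
  set ε : ℝ := (β - d) / 2 with hε
  have hε0 : 0 < ε := by rw [hε]; linarith
  have hβε : β - ε = (β + d) / 2 := by rw [hε]; ring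
  have hβε' : (d : ℝ) < β - ε := by rw [hβε]; linarith
  set W : ℝ := ∫ x : E d, (1 + ‖x‖) ^ (-((β + d) / 2)) with hW
  have hW0 : 0 ≤ W := integral_nonneg fun x => by positivity
  have hWt : ∀ t : ℝ, 0 < t → ∫⁻ x : E d, ENNReal.ofReal (weight (β - ε) t x) = ENNReal.ofReal W :=
    fun t ht => by rw [lintegral_weight hβε' ht, hβε]
  have hy0 : 0 < ‖y‖ := lt_of_lt_of_le (by positivity) hN1
  have hSm : MeasurableSet {x : E d | 2 * ‖y‖ ≤ ‖x‖} :=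
    (isClosed_le continuous_const continuous_norm).measurableSet
  have hθ0 : (0 : ℝ) < 2 ^ (-ε) := by positivity
  have h2j : (0 : ℝ) < 2 ^ j := by positivity
  -- For `j + N < 0` the shift `y` is short at scale `2^{-j}` and smoothness gains `2^j ‖y‖`.
  -- Otherwise both kernel values are small, since `x` and `x - y` lie at distance at least `‖y‖`
  -- from the origin.
  rcases lt_or_ge (j + N) 0 with hneg | hpos
  · obtain ⟨i, hi⟩ := Int.eq_ofNat_of_zero_le (show 0 ≤ -(j + N) by omega)
    have hi1 : 1 ≤ i := by omega
    have hnat : (j + N).natAbs = i := by omega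
    have htR : (2 : ℝ) ^ j * ‖y‖ ≤ 2 * (2 ^ i)⁻¹ := by
      calc (2 : ℝ) ^ j * ‖y‖ ≤ 2 ^ j * 2 ^ (N + 1) := by gcongr
        _ = 2 ^ (j + N) * 2 := by
            rw [zpow_add₀ two_ne_zero N, zpow_add₀ two_ne_zero j, zpow_one]
            ring
        _ = _ := by
            rw [show j + N = -(i : ℤ) by omega, zpow_neg, zpow_natCast, mul_comm]
    have htR1 : (2 : ℝ) ^ j * ‖y‖ ≤ 1 := by
      refine htR.trans ?_
      rw [← div_eq_mul_inv]
      refine div_le_one_of_le₀ ?_ (by positivity)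
      calc (2 : ℝ) = 2 ^ 1 := (pow_one _).symm
        _ ≤ 2 ^ i := pow_le_pow_right₀ one_le_two hi1
    have hεle : ((2 : ℝ) ^ i)⁻¹ ≤ ((2 : ℝ) ^ (-ε)) ^ i := by
      rw [← inv_pow]
      refine pow_le_pow_left₀ (by norm_num) ?_ i
      rw [← Real.rpow_neg_one]
      exact Real.rpow_le_rpow_of_exponent_le one_le_two (by rw [hε]; linarith)
    rw [hnat]
    calc ∫⁻ x in {x | 2 * ‖y‖ ≤ ‖x‖}, ‖𝓕⁻ (M j) (x - y) - 𝓕⁻ (M j) x‖ₑ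
        ≤ ∫⁻ x, ENNReal.ofReal (A * (2 * (2 ^ i)⁻¹)) *
            ENNReal.ofReal (weight (β - ε) (2 ^ j) x) := by
          refine (setLIntegral_le_lintegral _ _).trans (lintegral_mono fun x => ?_)
          rw [← ofReal_norm, ← ENNReal.ofReal_mul (by positivity)]
          refine ENNReal.ofReal_le_ofReal ((hM.smooth j x y htR1).trans ?_)
          have hw := weight_nonneg (β := β) h2j.le x
          gcongr
          rw [weight, weight]
          gcongr
          · have : 0 ≤ 2 ^ j * ‖x‖ := by positivity
            linarith
          · linarith
      _ = ENNReal.ofReal (A * (2 * (2 ^ i)⁻¹)) * ENNReal.ofReal W := by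
          rw [lintegral_const_mul' _ _ ENNReal.ofReal_ne_top, hWt _ h2j]
      _ ≤ _ := by
          rw [← ENNReal.ofReal_mul (by positivity)]
          refine ENNReal.ofReal_le_ofReal ?_
          calc (A : ℝ) * (2 * (2 ^ i)⁻¹) * W ≤ A * (2 * ((2 : ℝ) ^ (-ε)) ^ i) * W :=
                mul_le_mul_of_nonneg_right (mul_le_mul_of_nonneg_left (by linarith) A.2) hW0
            _ = _ := by ring
  · obtain ⟨i, hi⟩ := Int.eq_ofNat_of_zero_le hpos
    have hnat : (j + N).natAbs = i := by omega
    have htR : (2 : ℝ) ^ i ≤ 2 ^ j * ‖y‖ := by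
      calc (2 : ℝ) ^ i = 2 ^ (j + N) := by rw [hi]; exact (zpow_natCast _ _).symm
        _ = 2 ^ j * 2 ^ N := zpow_add₀ two_ne_zero _ _
        _ ≤ _ := by gcongr
    have hdec : ((2 : ℝ) ^ j * ‖y‖) ^ (-ε) ≤ ((2 : ℝ) ^ (-ε)) ^ i := by
      refine (Real.rpow_le_rpow_of_nonpos (by positivity) htR (by linarith)).trans_eq ?_
      rw [← Real.rpow_natCast, ← Real.rpow_natCast, ← Real.rpow_mul (by norm_num),
        ← Real.rpow_mul (by norm_num), mul_comm]
    have hk : ∀ x, ‖y‖ ≤ ‖x‖ → ‖𝓕⁻ (M j) x‖ₑ ≤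
        ENNReal.ofReal (A * ((2 : ℝ) ^ (-ε)) ^ i) * ENNReal.ofReal (weight (β - ε) (2 ^ j) x) := by
      intro x hx
      rw [← ofReal_norm, ← ENNReal.ofReal_mul (by positivity)]
      refine ENNReal.ofReal_le_ofReal ((hM.size j x).trans ?_)
      rw [mul_assoc]
      have hw := weight_nonneg (β := β - ε) h2j.le x
      gcongr
      refine (weight_le_rpow_mul_weight hε0.le h2j hy0 hx).trans ?_
      gcongr
    have hm : Measurable fun x : E d => ENNReal.ofReal (weight (β - ε) (2 ^ j) x) :=
      (continuous_weight h2j.le).measurable.ennreal_ofReal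
    rw [hnat]
    calc ∫⁻ x in {x | 2 * ‖y‖ ≤ ‖x‖}, ‖𝓕⁻ (M j) (x - y) - 𝓕⁻ (M j) x‖ₑ
        ≤ ∫⁻ x in {x | 2 * ‖y‖ ≤ ‖x‖}, (ENNReal.ofReal (A * ((2 : ℝ) ^ (-ε)) ^ i) *
            ENNReal.ofReal (weight (β - ε) (2 ^ j) (x - y)) +
            ENNReal.ofReal (A * ((2 : ℝ) ^ (-ε)) ^ i) *
            ENNReal.ofReal (weight (β - ε) (2 ^ j) x)) := by
          refine setLIntegral_mono' hSm fun x hx => ?_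
          have hx' : 2 * ‖y‖ ≤ ‖x‖ := hx
          refine enorm_sub_le.trans (add_le_add (hk _ ?_) (hk _ ?_))
          · have := norm_sub_norm_le x y
            linarith
          · linarith
      _ ≤ ∫⁻ x, (ENNReal.ofReal (A * ((2 : ℝ) ^ (-ε)) ^ i) *
            ENNReal.ofReal (weight (β - ε) (2 ^ j) (x - y)) +
            ENNReal.ofReal (A * ((2 : ℝ) ^ (-ε)) ^ i) *
            ENNReal.ofReal (weight (β - ε) (2 ^ j) x)) := setLIntegral_le_lintegral _ _
      _ = 2 * (ENNReal.ofReal (A * ((2 : ℝ) ^ (-ε)) ^ i) * ENNReal.ofReal W) := by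
          rw [lintegral_add_right _ (hm.const_mul _),
            lintegral_const_mul' _ _ ENNReal.ofReal_ne_top,
            lintegral_const_mul' _ _ ENNReal.ofReal_ne_top,
            lintegral_sub_right_eq_self (fun x => ENNReal.ofReal (weight (β - ε) (2 ^ j) x)) y,
            hWt _ h2j, two_mul]
      _ = _ := by
          rw [← ENNReal.ofReal_mul (by positivity), ← ENNReal.ofReal_ofNat 2,
            ← ENNReal.ofReal_mul (by norm_num)]
          congr 1
          ring

end IsDyadicFamily

/-- Finite sums of dyadic kernels are Calderón–Zygmund kernels, uniformly. -/
theorem exists_isCalderonZygmundKernel {β : ℝ} (hβ : (d : ℝ) < β) (hβd : β < d + 1) :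
    ∃ c : ℝ≥0, 0 < c ∧ ∀ (A : ℝ≥0) (M : ℤ → E d → ℂ), IsDyadicFamily β A M →
      ∀ J : Finset ℤ, IsCalderonZygmundKernel (kernelSum M J) (c * A) := by
  set W : ℝ := ∫ x : E d, (1 + ‖x‖) ^ (-((β + d) / 2)) with hW
  have hW0 : 0 ≤ W := integral_nonneg fun x => by positivity
  set θ : ℝ := (2 : ℝ) ^ (-((β - d) / 2)) with hθ
  have h0 : 0 ≤ θ := by positivity
  have h1 : θ < 1 := Real.rpow_lt_one_of_one_lt_of_neg (by norm_num) (by linarith)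
  have h1' : 0 < 1 - θ := by linarith
  -- The 2 is the bound of the summed multiplier; the rest is Hörmander's integral summed over all
  -- scales.
  set c : ℝ := 2 + 2 * W * (2 * (1 - θ)⁻¹) with hc
  have hc0 : 0 < c := by positivity
  refine ⟨⟨c, hc0.le⟩, hc0, fun A M hM J => ⟨mul_pos hc0 hM.pos, hM.integrable_kernelSum hβ J,
    fun f hf hf2 => ?_, fun y => ?_⟩⟩
  · rw [← fourierInv_finset_sum hM.integrable]
    refine lintegral_conv_fourierInv_sq_le (integrable_finsetSum _ fun j _ => hM.integrable j) ?_
      hf hf2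
    filter_upwards [hM.norm_sum_le] with ξ hξ
    rw [← ofReal_norm, ← ENNReal.ofReal_coe_nnreal]
    refine ENNReal.ofReal_le_ofReal ((hξ J).trans ?_)
    change 2 * (A : ℝ) ≤ c * A
    gcongr
    rw [hc]
    have : 0 ≤ 2 * W * (2 * (1 - θ)⁻¹) := by positivity
    linarith
  · rcases eq_or_ne y 0 with rfl | hy
    · simp
    obtain ⟨N, hN1, hN2⟩ := exists_mem_Ico_zpow (norm_pos_iff.2 hy) (one_lt_two (α := ℝ))
    have hAW : 0 ≤ 2 * (A : ℝ) * W := mul_nonneg (mul_nonneg zero_le_two A.2) hW0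
    calc ∫⁻ x in {x | 2 * ‖y‖ ≤ ‖x‖}, ‖kernelSum M J (x - y) - kernelSum M J x‖ₑ
        ≤ ∫⁻ x in {x | 2 * ‖y‖ ≤ ‖x‖}, ∑ j ∈ J, ‖𝓕⁻ (M j) (x - y) - 𝓕⁻ (M j) x‖ₑ := by
          refine lintegral_mono fun x => ?_
          rw [kernelSum, kernelSum, ← Finset.sum_sub_distrib]
          exact enorm_sum_le _ _
      _ = ∑ j ∈ J, ∫⁻ x in {x | 2 * ‖y‖ ≤ ‖x‖}, ‖𝓕⁻ (M j) (x - y) - 𝓕⁻ (M j) x‖ₑ :=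
          lintegral_finsetSum _ fun j _ => (((hM.continuous_kernel j).comp
            (continuous_id.sub continuous_const)).sub (hM.continuous_kernel j)).enorm.measurable
      _ ≤ ∑ j ∈ J, ENNReal.ofReal (2 * A * W * θ ^ (j + N).natAbs) :=
          Finset.sum_le_sum fun j _ => hM.lintegral_kernel_sub_le hβ hβd hN1 hN2 j
      _ = ENNReal.ofReal (2 * A * W * ∑ j ∈ J, θ ^ (j + N).natAbs) := by
          rw [Finset.mul_sum, ENNReal.ofReal_sum_of_nonneg fun j _ => mul_nonneg hAW (pow_nonneg h0 _)]
      _ ≤ ENNReal.ofReal (2 * A * W * (2 * (1 - θ)⁻¹)) :=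
          ENNReal.ofReal_le_ofReal (mul_le_mul_of_nonneg_left (sum_pow_natAbs_le h0 h1 J N) hAW)
      _ ≤ _ := by
          rw [← ENNReal.ofReal_coe_nnreal]
          refine ENNReal.ofReal_le_ofReal ?_
          change _ ≤ c * (A : ℝ)
          have hA := A.2
          rw [hc]
          nlinarith

/-! ### Extension of operators by continuity in measure -/

/-- Fatou's lemma for distribution functions: where `l' < v x`, the inequality `l k < u k x` holds
for all late `k`, so almost all of the set lies in an increasing union of tail intersections. -/
theorem measure_lt_le_of_tendsto {X : Type*} [MeasurableSpace X] {μ : Measure X}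
    {u : ℕ → X → ℝ≥0∞} {v : X → ℝ≥0∞} {l : ℕ → ℝ≥0∞} {l' b : ℝ≥0∞}
    (hu : ∀ᵐ x ∂μ, Tendsto (fun k => u k x) atTop (𝓝 (v x))) (hl : Tendsto l atTop (𝓝 l'))
    (hb : ∀ᶠ k in atTop, μ {x | l k < u k x} ≤ b) : μ {x | l' < v x} ≤ b := by
  set S : ℕ → Set X := fun N => ⋂ k ≥ N, {x | l k < u k x} with hS
  have hmono : Monotone S := by
    intro a b hab
    refine subset_iInter₂ fun k hk => ?_
    exact iInter₂_subset k (hab.trans hk)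
  have hsub : ({x | l' < v x} : Set X) ≤ᵐ[μ] (⋃ N, S N : Set X) := by
    filter_upwards [hu] with x hx hlt
    obtain ⟨N, hN⟩ := eventually_atTop.1 (hl.eventually_lt hx hlt)
    exact mem_iUnion.2 ⟨N, mem_iInter₂.2 hN⟩
  refine (measure_mono_ae hsub).trans ?_
  rw [hmono.measure_iUnion]
  refine iSup_le fun N => ?_
  obtain ⟨k, hkN, hk⟩ := ((eventually_ge_atTop N).and hb).exists
  exact (measure_mono (iInter₂_subset k hkN)).trans hk

theorem exists_schwartz_eLpNorm_sub_le {p : ℝ≥0∞} (hp1 : 1 ≤ p) (hp : p ≠ ⊤) {f : E d → ℂ}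
    (hf : MemLp f p) {η : ℝ} (hη : 0 < η) :
    ∃ ψ : 𝓢(E d, ℂ), eLpNorm (fun x => ψ x - f x) p volume ≤ ENNReal.ofReal η := by
  obtain ⟨g, hg1, hg2, hg3⟩ := MemLp.exist_eLpNorm_sub_le hp hp1 hf hη
  refine ⟨hg1.toSchwartzMap hg2, ?_⟩
  rw [← eLpNorm_neg]
  refine le_trans (le_of_eq ?_) hg3
  congr 1
  funext x
  simp

/-- A linear operator on Schwartz functions that is continuous at `0` from `L^p` to convergence in
measure extends to `L^p`. -/
theorem exists_extension_in_measure {T : 𝓢(E d, ℂ) → E d → ℂ}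
    (hsub : ∀ φ ψ x, T (φ - ψ) x = T φ x - T ψ x) (hmeas : ∀ φ, AEStronglyMeasurable (T φ))
    {p : ℝ≥0∞} (hp1 : 1 ≤ p) (hp : p ≠ ⊤)
    (hT : ∀ l : ℝ≥0∞, l ≠ 0 → ∀ b : ℝ≥0∞, b ≠ 0 → ∃ η : ℝ, 0 < η ∧
      ∀ φ : 𝓢(E d, ℂ), eLpNorm φ p volume ≤ ENNReal.ofReal η → volume {x | l < ‖T φ x‖ₑ} ≤ b)
    {f : E d → ℂ} (hf : MemLp f p) :
    ∃ g : E d → ℂ, AEStronglyMeasurable g ∧ ∀ φ : ℕ → 𝓢(E d, ℂ),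
      Tendsto (fun k => eLpNorm (fun x => φ k x - f x) p volume) atTop (𝓝 0) →
        TendstoInMeasure volume (fun k => T (φ k)) atTop g := by
  have hdist : ∀ (φ ψ : 𝓢(E d, ℂ)) (η : ℝ), 0 < η →
      eLpNorm (fun x => φ x - f x) p volume ≤ ENNReal.ofReal (η / 2) →
      eLpNorm (fun x => ψ x - f x) p volume ≤ ENNReal.ofReal (η / 2) →
      eLpNorm (φ - ψ : 𝓢(E d, ℂ)) p volume ≤ ENNReal.ofReal η := by
    intro φ ψ η hη h1 h2
    have e : ((φ - ψ : 𝓢(E d, ℂ)) : E d → ℂ) =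
        (fun x => φ x - f x) - fun x => ψ x - f x := by
      funext x
      simp
    rw [e]
    refine (eLpNorm_sub_le (φ.continuous.aestronglyMeasurable.sub hf.1)
      (ψ.continuous.aestronglyMeasurable.sub hf.1) hp1).trans ((add_le_add h1 h2).trans_eq ?_)
    rw [← ENNReal.ofReal_add (by positivity) (by positivity), add_halves]
  have h2k : ∀ k : ℕ, ((2 : ℝ≥0∞)⁻¹) ^ k ≠ 0 := fun k =>
    pow_ne_zero _ (ENNReal.inv_ne_zero.2 (by norm_num))
  choose η hη hηT using fun k : ℕ => hT ((2 : ℝ≥0∞)⁻¹ ^ k) (h2k k) ((2 : ℝ≥0∞)⁻¹ ^ k) (h2k k)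
  -- Being within `η k / 2` and `η (k - 1) / 2` of `f` makes the difference of `ψ (k + 1)` and `ψ k`
  -- at most `η k`; the bound `1 / (k + 1)` gives convergence. At `k = 0` the truncated `k - 1` only
  -- repeats a condition.
  choose ψ hψ using fun k : ℕ => exists_schwartz_eLpNorm_sub_le hp1 hp hf
    (η := min (min (η k / 2) (η (k - 1) / 2)) (1 / (k + 1)))
    (lt_min (lt_min (half_pos (hη k)) (half_pos (hη (k - 1)))) (by positivity))
  have hψ0 : Tendsto (fun k => eLpNorm (fun x => ψ k x - f x) p volume) atTop (𝓝 0) := by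
    refine tendsto_of_tendsto_of_tendsto_of_le_of_le tendsto_const_nhds ?_
      (fun k => zero_le) (fun k => (hψ k).trans (ENNReal.ofReal_le_ofReal (min_le_right _ _)))
    have := ENNReal.tendsto_ofReal (tendsto_one_div_add_atTop_nhds_zero_nat (𝕜 := ℝ))
    simpa using this
  have hstep : ∀ k, volume {x | (2 : ℝ≥0∞)⁻¹ ^ k < ‖T (ψ (k + 1) - ψ k) x‖ₑ} ≤
      (2 : ℝ≥0∞)⁻¹ ^ k := by
    intro k
    refine hηT k _ (hdist _ _ _ (hη k) ((hψ (k + 1)).trans ?_) ((hψ k).trans ?_))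
    · exact ENNReal.ofReal_le_ofReal ((min_le_left _ _).trans (min_le_right _ _))
    · exact ENNReal.ofReal_le_ofReal ((min_le_left _ _).trans (min_le_left _ _))
  -- Borel–Cantelli: almost everywhere the increments are eventually dominated by a geometric
  -- series.
  have hBC : ∀ᵐ x, ∀ᶠ k in atTop, x ∉ {x | (2 : ℝ≥0∞)⁻¹ ^ k < ‖T (ψ (k + 1) - ψ k) x‖ₑ} := by
    refine ae_eventually_notMem (ne_top_of_le_ne_top ?_ (ENNReal.tsum_le_tsum hstep))
    rw [ENNReal.tsum_geometric]
    simp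
  have hlim : ∀ᵐ x, ∃ y, Tendsto (fun k => T (ψ k) x) atTop (𝓝 y) := by
    filter_upwards [hBC] with x hx
    refine cauchySeq_tendsto_of_complete (cauchySeq_of_summable_dist ?_)
    refine Summable.of_norm_bounded_eventually_nat (g := fun k : ℕ => (2 : ℝ)⁻¹ ^ k)
      (summable_geometric_of_lt_one (by norm_num) (by norm_num)) ?_
    filter_upwards [hx] with k hk
    simp only [not_lt, hsub] at hk
    rw [Real.norm_of_nonneg dist_nonneg, dist_comm, dist_eq_norm, ← toReal_enorm]
    have h := ENNReal.toReal_mono (by simp) hk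
    simpa using h
  set g : E d → ℂ := fun x => limUnder atTop fun k => T (ψ k) x with hg
  have hgl : ∀ᵐ x, Tendsto (fun k => T (ψ k) x) atTop (𝓝 (g x)) := by
    filter_upwards [hlim] with x hx
    exact tendsto_nhds_limUnder hx
  refine ⟨g, aestronglyMeasurable_of_tendsto_ae atTop (fun k => hmeas (ψ k)) hgl,
    fun φ hφ => ?_⟩
  intro ε hε
  refine ENNReal.tendsto_nhds_zero.2 fun b hb => ?_
  -- Halving turns the non-strict level `ε` into a strict one; the minimum with 1 is needed because
  -- half of `∞` is `∞`.
  have hε2 : (min ε 1 / 2 : ℝ≥0∞) ≠ 0 := (ENNReal.half_pos (lt_min hε one_pos).ne').ne'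
  obtain ⟨η', hη', hηT'⟩ := hT _ hε2 b hb.ne'
  have hpos : 0 < ENNReal.ofReal (η' / 2) := ENNReal.ofReal_pos.2 (half_pos hη')
  filter_upwards [ENNReal.tendsto_nhds_zero.1 hφ _ hpos] with k hk
  have h1 : volume {x | min ε 1 / 2 < ‖T (φ k) x - g x‖ₑ} ≤ b := by
    refine measure_lt_le_of_tendsto (u := fun i x => ‖T (φ k) x - T (ψ i) x‖ₑ) ?_
      tendsto_const_nhds ?_
    · filter_upwards [hgl] with x hx
      exact (tendsto_const_nhds.sub hx).enorm
    · filter_upwards [ENNReal.tendsto_nhds_zero.1 hψ0 _ hpos] with i hi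
      have := hηT' _ (hdist _ _ _ hη' hk hi)
      simpa only [hsub] using this
  refine (measure_mono fun x hx => ?_).trans h1
  have hx' : ε ≤ edist (T (φ k) x) (g x) := hx
  rw [edist_eq_enorm_sub] at hx'
  refine lt_of_lt_of_le ?_ ((min_le_left ε 1).trans hx')
  exact ENNReal.half_lt_self (lt_min hε one_pos).ne' (ne_top_of_le_ne_top ENNReal.one_ne_top
    (min_le_right _ _))

/-! ### Multiplier operators as limits of convolution operators -/

/-- The multiplier `Q` is the limit of the sums of the `M j` over the finite sets `J k`. -/
def Approximates (M : ℤ → E d → ℂ) (J : ℕ → Finset ℤ) (Q : E d → ℂ) : Prop :=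
  ∀ᵐ ξ, ∀ᶠ k in atTop, ∑ j ∈ J k, M j ξ = Q ξ

/-- The multiplier operator with symbol `Q`, in the normalization of Mathlib's Fourier
transform. -/
noncomputable def multiplierOp (Q : E d → ℂ) (φ : 𝓢(E d, ℂ)) : E d → ℂ :=
  𝓕⁻ fun ξ : E d => Q ξ * 𝓕 (φ : E d → ℂ) ξ

namespace IsDyadicFamily

variable {β : ℝ} {A : ℝ≥0} {M : ℤ → E d → ℂ}

theorem norm_kernelSum_le (J : Finset ℤ) (x : E d) :
    ‖kernelSum M J x‖ ≤ ∑ j ∈ J, ∫ ξ, ‖M j ξ‖ := by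
  refine norm_sum_le_of_le _ fun j _ => ?_
  rw [Real.fourierInv_eq_fourier_neg]
  exact norm_fourier_le _ _

theorem continuous_kernelSum (hM : IsDyadicFamily β A M) (J : Finset ℤ) :
    Continuous (kernelSum M J) :=
  continuous_finsetSum _ fun j _ => hM.continuous_kernel j

theorem integrable_mul_kernelSum (hM : IsDyadicFamily β A M) (J : Finset ℤ) {f : E d → ℂ}
    (hf : Integrable f) (x : E d) : Integrable fun z => f z * kernelSum M J (x - z) :=
  hf.mul_bdd ((hM.continuous_kernelSum J).comp
    (continuous_const.sub continuous_id)).aestronglyMeasurable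
    (Eventually.of_forall fun z => norm_kernelSum_le J (x - z))

theorem conv_kernelSum (hM : IsDyadicFamily β A M) (J : Finset ℤ) {f : E d → ℂ}
    (hf : Integrable f) (x : E d) :
    conv (kernelSum M J) f x = 𝓕⁻ (fun ξ => (∑ j ∈ J, M j ξ) * 𝓕 f ξ) x := by
  rw [fourierInv_mul_fourier (integrable_finsetSum _ fun j _ => hM.integrable j) hf,
    fourierInv_finset_sum hM.integrable]

/-- Dominated convergence on the Fourier side, with majorant `2A ‖𝓕 φ‖`. It carries estimates
uniform in the finite sums over to the operator with symbol `Q`, at every point `x`. -/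
theorem tendsto_conv_multiplierOp (hM : IsDyadicFamily β A M) {J : ℕ → Finset ℤ} {Q : E d → ℂ}
    (hQ : Approximates M J Q) (φ : 𝓢(E d, ℂ)) (x : E d) :
    Tendsto (fun k => conv (kernelSum M (J k)) φ x) atTop (𝓝 (multiplierOp Q φ x)) := by
  simp only [hM.conv_kernelSum _ φ.integrable, multiplierOp, Real.fourierInv_eq]
  have hφ : Integrable (𝓕 (φ : E d → ℂ)) := by
    rw [← SchwartzMap.fourier_coe]
    exact (𝓕 φ).integrable
  refine tendsto_integral_of_dominated_convergence (fun ξ => 2 * A * ‖𝓕 (φ : E d → ℂ) ξ‖)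
    (fun k => ?_) (hφ.norm.const_mul _) (fun k => ?_) ?_
  · refine (Continuous.aestronglyMeasurable (by fun_prop)).smul ?_
    exact (Finset.aestronglyMeasurable_fun_sum _ fun j _ => (hM.integrable j).1).mul hφ.1
  · filter_upwards [hM.norm_sum_le] with ξ hξ
    rw [Circle.norm_smul, norm_mul]
    gcongr
    exact hξ _
  · filter_upwards [hQ] with ξ hξ
    refine tendsto_const_nhds.congr' ?_
    filter_upwards [hξ] with k hk
    rw [hk]

theorem multiplierOp_sub (hM : IsDyadicFamily β A M) {J : ℕ → Finset ℤ} {Q : E d → ℂ}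
    (hQ : Approximates M J Q) (φ ψ : 𝓢(E d, ℂ)) (x : E d) :
    multiplierOp Q (φ - ψ) x = multiplierOp Q φ x - multiplierOp Q ψ x := by
  refine tendsto_nhds_unique (hM.tendsto_conv_multiplierOp hQ (φ - ψ) x)
    (((hM.tendsto_conv_multiplierOp hQ φ x).sub (hM.tendsto_conv_multiplierOp hQ ψ x)).congr
      fun k => ?_)
  simp only [conv, sub_apply, sub_mul]
  exact (integral_sub (hM.integrable_mul_kernelSum _ φ.integrable x)
    (hM.integrable_mul_kernelSum _ ψ.integrable x)).symm

theorem aestronglyMeasurable_multiplierOp (hM : IsDyadicFamily β A M) (hβ : (d : ℝ) < β)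
    {J : ℕ → Finset ℤ} {Q : E d → ℂ} (hQ : Approximates M J Q) (φ : 𝓢(E d, ℂ)) :
    AEStronglyMeasurable (multiplierOp Q φ) :=
  aestronglyMeasurable_of_tendsto_ae atTop
    (fun k => (integrable_conv (hM.integrable_kernelSum hβ (J k)) φ.integrable).1)
    (Eventually.of_forall fun x => hM.tendsto_conv_multiplierOp hQ φ x)

/-- The weak type (p,p) estimate for multiplier operators on Schwartz functions. -/
theorem exists_weak_type_multiplierOp (hd : 1 ≤ d) (hM : IsDyadicFamily β A M) (hβ : (d : ℝ) < β)
    (hβd : β < d + 1) {p : ℝ} (hp : 1 ≤ p) :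
    ∃ C D : ℝ≥0, 0 < D ∧ ∀ (J : ℕ → Finset ℤ) (Q : E d → ℂ), Approximates M J Q →
      ∀ (φ : 𝓢(E d, ℂ)) (γ : ℝ≥0), (γ : ℝ≥0∞) ^ p *
        volume {x | (D : ℝ≥0∞) * γ < ‖multiplierOp Q φ x‖ₑ} ≤ C * ∫⁻ z, ‖φ z‖ₑ ^ p := by
  obtain ⟨c, hc0, hc⟩ := exists_isCalderonZygmundKernel hβ hβd
  obtain ⟨C, hC⟩ := exists_weak_type hd hp
  -- The factor 2 comes from the level `A * (2 * γ)` in the weak type estimate.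
  refine ⟨C, c * A * 2, mul_pos (mul_pos hc0 hM.pos) two_pos, fun J Q hQ φ γ => ?_⟩
  rcases eq_or_ne γ 0 with rfl | hγ
  · rw [ENNReal.coe_zero, ENNReal.zero_rpow_of_pos (by linarith), zero_mul]
    exact zero_le
  have hγ0 : (γ : ℝ≥0∞) ^ p ≠ 0 := by
    simp [ENNReal.rpow_eq_zero_iff, hγ]
  have hγt : (γ : ℝ≥0∞) ^ p ≠ ⊤ :=
    ENNReal.rpow_ne_top_of_nonneg (by linarith) ENNReal.coe_ne_top
  rw [mul_comm, ← ENNReal.le_div_iff_mul_le (Or.inl hγ0) (Or.inl hγt)]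
  refine measure_lt_le_of_tendsto (u := fun k x => ‖conv (kernelSum M (J k)) φ x‖ₑ)
    (Eventually.of_forall fun x => (hM.tendsto_conv_multiplierOp hQ φ x).enorm)
    tendsto_const_nhds (Eventually.of_forall fun k => ?_)
  rw [ENNReal.le_div_iff_mul_le (Or.inl hγ0) (Or.inl hγt), mul_comm]
  have := hC _ _ (hc A M hM (J k)) φ φ.integrable (φ.memLp 2) γ
  push_cast at this ⊢
  simpa only [mul_assoc] using this

/-- Multiplier operators extend to `L^p`. -/
theorem exists_multiplierOp_extension (hd : 1 ≤ d) (hM : IsDyadicFamily β A M)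
    (hβ : (d : ℝ) < β) (hβd : β < d + 1) {J : ℕ → Finset ℤ} {Q : E d → ℂ}
    (hQ : Approximates M J Q) {p : ℝ≥0∞} (hp1 : 1 ≤ p) (hp : p ≠ ⊤) {f : E d → ℂ}
    (hf : MemLp f p) :
    ∃ g : E d → ℂ, AEStronglyMeasurable g ∧ ∀ φ : ℕ → 𝓢(E d, ℂ),
      Tendsto (fun k => eLpNorm (fun x => φ k x - f x) p volume) atTop (𝓝 0) →
        TendstoInMeasure volume (fun k => multiplierOp Q (φ k)) atTop g := by
  have hpr : 1 ≤ p.toReal := by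
    rw [← ENNReal.toReal_one]
    exact ENNReal.toReal_mono hp hp1
  have hp0 : p ≠ 0 := (one_pos.trans_le hp1).ne'
  have hpr0 : 0 < p.toReal := by linarith
  obtain ⟨C, D, hD, hCD⟩ := hM.exists_weak_type_multiplierOp hd hβ hβd hpr
  refine exists_extension_in_measure (hM.multiplierOp_sub hQ)
    (hM.aestronglyMeasurable_multiplierOp hβ hQ) hp1 hp ?_ hf
  intro l hl b hb
  -- The level and the bound may be infinite; they are replaced by finite ones, which only
  -- strengthens the claim.
  set l' : ℝ≥0∞ := min l 1 with hl'
  set b' : ℝ≥0∞ := min b 1 with hb'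
  have hl0 : l' ≠ 0 := (lt_min (pos_iff_ne_zero.2 hl) one_pos).ne'
  have hb0 : b' ≠ 0 := (lt_min (pos_iff_ne_zero.2 hb) one_pos).ne'
  have hlt : l' ≠ ⊤ := ne_top_of_le_ne_top ENNReal.one_ne_top (min_le_right _ _)
  have hbt : b' ≠ ⊤ := ne_top_of_le_ne_top ENNReal.one_ne_top (min_le_right _ _)
  set γ : ℝ≥0 := l'.toNNReal / D with hγ
  have hγ0 : 0 < γ := div_pos (ENNReal.toNNReal_pos hl0 hlt) hD
  have hDγ : (D : ℝ≥0∞) * γ = l' := by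
    rw [hγ, ← ENNReal.coe_mul, mul_div_cancel₀ _ hD.ne', ENNReal.coe_toNNReal hlt]
  have hγp0 : (γ : ℝ≥0∞) ^ p.toReal ≠ 0 := by
    simp [ENNReal.rpow_eq_zero_iff, hγ0.ne']
  have hγpt : (γ : ℝ≥0∞) ^ p.toReal ≠ ⊤ :=
    ENNReal.rpow_ne_top_of_nonneg hpr0.le ENNReal.coe_ne_top
  -- Chosen so that `C κ^p ≤ γ^p b'`; `C + 1` in place of `C` avoids division by zero.
  set κ : ℝ≥0∞ := ((γ : ℝ≥0∞) ^ p.toReal * b' / (C + 1)) ^ (1 / p.toReal) with hκ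
  have hC1 : (C + 1 : ℝ≥0∞) ≠ 0 := by simp
  have hC1t : (C + 1 : ℝ≥0∞) ≠ ⊤ := by simp
  have hin0 : (γ : ℝ≥0∞) ^ p.toReal * b' / (C + 1) ≠ 0 :=
    ENNReal.div_ne_zero.2 ⟨mul_ne_zero hγp0 hb0, hC1t⟩
  have hint : (γ : ℝ≥0∞) ^ p.toReal * b' / (C + 1) ≠ ⊤ :=
    ENNReal.div_ne_top (ENNReal.mul_ne_top hγpt hbt) hC1
  have hκ0 : κ ≠ 0 := by
    simp [hκ, ENNReal.rpow_eq_zero_iff, hin0, hint, not_lt.2 hpr0.le]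
  have hκt : κ ≠ ⊤ := ENNReal.rpow_ne_top_of_nonneg (by positivity) hint
  refine ⟨κ.toReal, ENNReal.toReal_pos hκ0 hκt, fun φ hφ => ?_⟩
  rw [ENNReal.ofReal_toReal hκt, eLpNorm_eq_lintegral_rpow_enorm_toReal hp0 hp, hκ] at hφ
  have hφ' : ∫⁻ z, ‖φ z‖ₑ ^ p.toReal ≤ (γ : ℝ≥0∞) ^ p.toReal * b' / (C + 1) :=
    (ENNReal.rpow_le_rpow_iff (by positivity)).1 hφ
  have h1 := hCD J Q hQ φ γ
  rw [hDγ] at h1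
  have h2 : (γ : ℝ≥0∞) ^ p.toReal * volume {x | l' < ‖multiplierOp Q φ x‖ₑ} ≤
      (γ : ℝ≥0∞) ^ p.toReal * b' :=
    calc _ ≤ C * ∫⁻ z, ‖φ z‖ₑ ^ p.toReal := h1
      _ ≤ (C + 1) * ((γ : ℝ≥0∞) ^ p.toReal * b' / (C + 1)) := by
          gcongr
          exact le_self_add
      _ = _ := ENNReal.mul_div_cancel hC1 hC1t
  have h3 := (ENNReal.mul_le_mul_iff_right hγp0 hγpt).1 h2
  refine le_trans (measure_mono fun x hx => ?_) (h3.trans (min_le_left _ _))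
  exact lt_of_le_of_lt (min_le_left l 1) (show l < _ from hx)

end IsDyadicFamily

/-! ### Littlewood–Paley sums of the multiplier -/

theorem dyadicPiece_eq (χ : ℝ → ℝ) (m : E d → ℂ) (j : ℤ) (ξ : E d) :
    dyadicPiece χ m j ξ =
      (χ ((2 : ℝ) ^ (-j) * ‖(2 * Real.pi) • ξ‖) : ℂ) * m ((2 * Real.pi) • ξ) := by
  rw [dyadicPiece, norm_smul, Real.norm_of_nonneg (by positivity)]

/-- At each frequency only two scales are active, so the finite sums are eventually equal to the
full one. -/
theorem approximates_truncMultiplier {χ : ℝ → ℝ} (hχ : IsDyadicPartition χ) (m : E d → ℂ) (n : ℤ) :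
    Approximates (dyadicPiece χ m) (fun k : ℕ => Finset.Icc (-(k : ℤ)) n)
      fun ξ => truncMultiplier χ m n ((2 * Real.pi) • ξ) := by
  refine Eventually.of_forall fun ξ => ?_
  obtain ⟨N, hN⟩ := exists_forall_eq_or_eq_of_ne_zero hχ ‖(2 * Real.pi) • ξ‖
  filter_upwards [eventually_ge_atTop N.natAbs] with k hk
  have h1 : truncMultiplier χ m n ((2 * Real.pi) • ξ) =
      ∑' j : Iic n, dyadicPiece χ m (j : ℤ) ξ := rfl
  rw [h1, tsum_subtype (Iic n) fun j => dyadicPiece χ m j ξ,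
    tsum_eq_sum (s := Finset.Icc (-(k : ℤ)) n) ?_]
  · refine Finset.sum_congr rfl fun j hj => ?_
    rw [indicator_of_mem (mem_Iic.2 (Finset.mem_Icc.1 hj).2)]
  · intro j hj
    by_cases hjn : j ≤ n
    · rw [indicator_of_mem (mem_Iic.2 hjn), dyadicPiece_eq]
      by_contra h
      have h2 : χ ((2 : ℝ) ^ (-j) * ‖(2 * Real.pi) • ξ‖) ≠ 0 := fun h0 =>
        h (by rw [h0, Complex.ofReal_zero, zero_mul])
      rw [Finset.mem_Icc] at hj
      rcases hN j h2 with h3 | h3 <;> omega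
    · exact indicator_of_notMem (by simpa using hjn) _

/-- Away from the origin the active scales are eventually all included and the cutoffs add up to 1.
The origin is a null set because `1 ≤ d`. -/
theorem approximates_multiplier (hd : 1 ≤ d) {χ : ℝ → ℝ} (hχ : IsDyadicPartition χ)
    (m : E d → ℂ) :
    Approximates (dyadicPiece χ m) (fun k : ℕ => Finset.Icc (-(k : ℤ)) k)
      fun ξ => m ((2 * Real.pi) • ξ) := by
  have : Nonempty (Fin d) := ⟨⟨0, hd⟩⟩
  filter_upwards [compl_mem_ae_iff.2 (measure_singleton (0 : E d))] with ξ hξ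
  have hpos : 0 < ‖(2 * Real.pi) • ξ‖ :=
    norm_pos_iff.2 (smul_ne_zero (by positivity) hξ)
  obtain ⟨N, hN⟩ := exists_forall_eq_or_eq_of_ne_zero hχ ‖(2 * Real.pi) • ξ‖
  filter_upwards [eventually_ge_atTop (N.natAbs + 1)] with k hk
  have h1 : ∑' j : ℤ, χ ((2 : ℝ) ^ (-j) * ‖(2 * Real.pi) • ξ‖) = 1 := by
    rw [← hχ.sum_eq_one _ hpos]
    exact (Equiv.neg ℤ).tsum_eq fun j : ℤ => χ ((2 : ℝ) ^ j * ‖(2 * Real.pi) • ξ‖)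
  rw [tsum_eq_sum (s := Finset.Icc (-(k : ℤ)) k)] at h1
  · simp only [dyadicPiece_eq, ← Finset.sum_mul, ← Complex.ofReal_sum]
    rw [h1, Complex.ofReal_one, one_mul]
  · intro j hj
    by_contra h
    rw [Finset.mem_Icc] at hj
    rcases hN j h with h3 | h3 <;> omega

/-! ### Local estimates -/

/-- The average of `‖f‖` at the point `x` with respect to `weight β t`. -/
noncomputable def weightedAverage (β t : ℝ) (f : E d → ℂ) (x : E d) : ℝ≥0∞ :=
  ∫⁻ z, ENNReal.ofReal (weight β t (x - z)) * ‖f z‖ₑ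

theorem enorm_integral_mul_le_weightedAverage {β t : ℝ} {f k : E d → ℂ} {c : ℝ≥0}
    {x : E d} (h : ∀ z, f z ≠ 0 → ‖k z‖ ≤ c * weight β t (x - z)) :
    ‖∫ z, f z * k z‖ₑ ≤ c * weightedAverage β t f x := by
  refine (enorm_integral_le_lintegral_enorm _).trans ?_
  rw [weightedAverage, ← lintegral_const_mul' _ _ ENNReal.coe_ne_top]
  refine lintegral_mono fun z => ?_
  rcases eq_or_ne (f z) 0 with hz | hz
  · simp [hz]
  rw [enorm_mul, ← mul_assoc, mul_comm ‖f z‖ₑ]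
  gcongr
  rw [← ofReal_norm, ← ENNReal.ofReal_coe_nnreal, ← ENNReal.ofReal_mul c.coe_nonneg]
  exact ENNReal.ofReal_le_ofReal (h z hz)

theorem weightedAverage_le_add {β t : ℝ} (ht : 0 ≤ t) {f g : E d → ℂ} (hf : AEStronglyMeasurable f)
    (x : E d) :
    weightedAverage β t g x ≤
      weightedAverage β t f x + weightedAverage β t (fun z => g z - f z) x := by
  have hm : AEMeasurable fun z => ENNReal.ofReal (weight β t (x - z)) * ‖f z‖ₑ :=
    (((continuous_weight ht).comp
      (continuous_const.sub continuous_id)).measurable.ennreal_ofReal.aemeasurable).mul hf.enorm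
  rw [weightedAverage, weightedAverage, weightedAverage, ← lintegral_add_left' hm]
  refine lintegral_mono fun z => ?_
  rw [← mul_add]
  gcongr
  calc ‖g z‖ₑ = ‖f z + (g z - f z)‖ₑ := by rw [add_sub_cancel]
    _ ≤ _ := enorm_add_le _ _

namespace IsDyadicFamily

/-- For `j ≤ n`, points at distance at most `2^{-n}` are close at scale `2^{-j}`, and smoothness
gains `2^{j-n}`. This factor makes the sum over the low scales converge to a single weight at scale
`n`. -/
theorem exists_enorm_conv_low_sub_le (d : ℕ) {β : ℝ} (hβ : (d : ℝ) < β) (hβd : β < d + 1) :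
    ∃ c : ℝ≥0, ∀ (A : ℝ≥0) (M : ℤ → E d → ℂ), IsDyadicFamily β A M → ∀ (n : ℤ) (J : Finset ℤ),
      (∀ j ∈ J, j ≤ n) → ∀ f : E d → ℂ, Integrable f → ∀ x y : E d, (2 : ℝ) ^ n * ‖x - y‖ ≤ 1 →
      ‖conv (kernelSum M J) f x - conv (kernelSum M J) f y‖ₑ ≤
        (c * A : ℝ≥0) * weightedAverage β (2 ^ n) f x := by
  have hβ0 : 0 ≤ β := (Nat.cast_nonneg d).trans hβ.le
  have hc0 : 0 ≤ (1 - (2 : ℝ) ^ (-(d + 1 - β)))⁻¹ :=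
    inv_nonneg.2 (sub_nonneg.2 (Real.rpow_le_one_of_one_le_of_nonpos one_le_two (by linarith)))
  obtain ⟨c, hc⟩ : ∃ c : ℝ≥0, (c : ℝ) = (1 - (2 : ℝ) ^ (-(d + 1 - β)))⁻¹ := CanLift.prf _ hc0
  refine ⟨c, fun A M hM n J hJ f hf x y hxy => ?_⟩
  simp only [conv]
  rw [← integral_sub (hM.integrable_mul_kernelSum J hf x) (hM.integrable_mul_kernelSum J hf y)]
  simp only [← mul_sub]
  refine enorm_integral_mul_le_weightedAverage fun z _ => ?_
  have h2 : ∀ j ∈ J, ‖𝓕⁻ (M j) (x - z) - 𝓕⁻ (M j) (y - z)‖ ≤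
      A * ((2 : ℝ) ^ (j - n) * weight β (2 ^ j) (x - z)) := by
    intro j hj
    have h3 : (2 : ℝ) ^ j * ‖x - y‖ ≤ 2 ^ (j - n) := by
      calc (2 : ℝ) ^ j * ‖x - y‖ = 2 ^ (j - n) * (2 ^ n * ‖x - y‖) := by
            rw [← mul_assoc, ← zpow_add₀ two_ne_zero, sub_add_cancel]
        _ ≤ 2 ^ (j - n) * 1 := by gcongr
        _ = _ := mul_one _
    have h4 : (2 : ℝ) ^ (j - n) ≤ 1 := zpow_le_one_of_nonpos₀ one_le_two (by linarith [hJ j hj])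
    have h5 := hM.smooth j (x - z) (x - y) (h3.trans h4)
    rw [show x - z - (x - y) = y - z by abel, norm_sub_rev] at h5
    refine h5.trans ?_
    rw [mul_assoc]
    gcongr
    exact weight_nonneg (by positivity) _
  calc ‖kernelSum M J (x - z) - kernelSum M J (y - z)‖
      = ‖∑ j ∈ J, (𝓕⁻ (M j) (x - z) - 𝓕⁻ (M j) (y - z))‖ := by
        rw [Finset.sum_sub_distrib]; rfl
    _ ≤ ∑ j ∈ J, A * ((2 : ℝ) ^ (j - n) * weight β (2 ^ j) (x - z)) := norm_sum_le_of_le _ h2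
    _ ≤ A * ((1 - (2 : ℝ) ^ (-(d + 1 - β)))⁻¹ * weight β (2 ^ n) (x - z)) := by
        rw [← Finset.mul_sum]
        gcongr
        exact sum_weight_low_le hβ0 hβd n J hJ _
    _ = _ := by
        rw [NNReal.coe_mul, hc]
        ring

/-- The function is split at the double of the ball. High frequency kernels sum to a multiple of the
weight at scale `n` away from the origin, which handles the far part pointwise; the near part is
handled by weak (1,1). -/
theorem exists_local_weak_type (hd : 1 ≤ d) {β : ℝ} (hβ : (d : ℝ) < β) (hβd : β < d + 1) :
    ∃ c b : ℝ≥0, 0 < b ∧ ∀ (A : ℝ≥0) (M : ℤ → E d → ℂ), IsDyadicFamily β A M →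
      ∀ (n : ℤ) (J : Finset ℤ), (∀ j ∈ J, n ≤ j) → ∀ f : E d → ℂ, Integrable f →
      ∀ (x : E d) (γ : ℝ≥0), γ * volume.restrict (Metric.ball x (2 ^ (-n)))
        {y | (c * A * γ : ℝ≥0) + (c * A : ℝ≥0) * weightedAverage β (2 ^ n) f x <
          ‖conv (kernelSum M J) f y‖ₑ} ≤
        b * volume (Metric.ball x (2 ^ (-n))) * weightedAverage β (2 ^ n) f x := by
  have hβ0 : 0 ≤ β := (Nat.cast_nonneg d).trans hβ.le
  obtain ⟨c₀, hc₀, hCZ⟩ := exists_isCalderonZygmundKernel hβ hβd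
  have hc1 : 0 ≤ (2 : ℝ) ^ β * (2 ^ β * (1 - (2 : ℝ) ^ (-(β - d)))⁻¹) :=
    mul_nonneg (by positivity) (mul_nonneg (by positivity) (inv_nonneg.2 (sub_nonneg.2
      (Real.rpow_le_one_of_one_le_of_nonpos one_le_two (by linarith)))))
  obtain ⟨c₁, hc₁⟩ : ∃ c : ℝ≥0, (c : ℝ) =
    (2 : ℝ) ^ β * (2 ^ β * (1 - (2 : ℝ) ^ (-(β - d)))⁻¹) := CanLift.prf _ hc1
  set v : ℝ≥0∞ := volume (Metric.ball (0 : E d) 1) with hv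
  have hv0 : v ≠ 0 := (Metric.measure_ball_pos _ _ one_pos).ne'
  have hvt : v ≠ ⊤ := measure_ball_lt_top.ne
  -- In `b`, `3^β` compares the weight with a constant on the double ball and `v` turns `ρ ^ d` into
  -- the volume of the ball.
  refine ⟨max c₀ c₁, (weakConst d * (3 : ℝ≥0) ^ β) / v.toNNReal + 1, by positivity,
    fun A M hM n J hJ f hf x γ => ?_⟩
  set ρ : ℝ := 2 ^ (-n) with hρ
  have hρ0 : 0 < ρ := by positivity
  have hnρ : (2 : ℝ) ^ n * ρ = 1 := by
    rw [hρ, ← zpow_add₀ two_ne_zero, add_neg_cancel, zpow_zero]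
  set U := weightedAverage β (2 ^ n) f x with hU
  set B := Metric.ball x (2 * ρ) with hB
  have hBm : MeasurableSet B := measurableSet_ball
  set f₁ : E d → ℂ := B.indicator f with hf₁
  set f₂ : E d → ℂ := Bᶜ.indicator f with hf₂
  have hf₁i : Integrable f₁ := hf.indicator hBm
  have hf₂i : Integrable f₂ := hf.indicator hBm.compl
  have hadd : ∀ y, conv (kernelSum M J) f y =
      conv (kernelSum M J) f₁ y + conv (kernelSum M J) f₂ y := by
    intro y
    simp only [conv]
    rw [← integral_add (hM.integrable_mul_kernelSum J hf₁i y)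
      (hM.integrable_mul_kernelSum J hf₂i y)]
    simp only [← add_mul]
    congr 1 with z
    rw [← Pi.add_apply f₁ f₂ z, hf₁, hf₂, indicator_self_add_compl]
  have hfar : ∀ y ∈ Metric.ball x ρ, ‖conv (kernelSum M J) f₂ y‖ₑ ≤ (c₁ * A : ℝ≥0) * U := by
    intro y hy
    have h1 : ‖conv (kernelSum M J) f₂ y‖ₑ ≤
        (c₁ * A : ℝ≥0) * weightedAverage β (2 ^ n) f₂ x := by
      refine enorm_integral_mul_le_weightedAverage fun z hz => ?_
      have hz' : z ∉ B := fun h => hz (by simp [hf₂, h])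
      rw [hB, Metric.mem_ball, not_lt, dist_eq_norm, norm_sub_rev] at hz'
      rw [Metric.mem_ball, dist_eq_norm, norm_sub_rev] at hy
      have h2 : ‖x - z‖ ≤ ‖x - y‖ + ‖y - z‖ := norm_sub_le_norm_sub_add_norm_sub _ _ _
      -- With `y` in the ball and `z` outside its double, `‖y - z‖` is at least `ρ` and at least `‖x
      -- - z‖ / 2`. The first fact allows the high frequency sum, the second recentres the weight at
      -- `x`.
      have h3 : 1 ≤ (2 : ℝ) ^ n * ‖y - z‖ := by
        rw [← hnρ]
        gcongr
        linarith
      calc ‖kernelSum M J (y - z)‖ ≤ ∑ j ∈ J, A * weight β (2 ^ j) (y - z) :=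
            norm_sum_le_of_le _ fun j _ => hM.size j _
        _ ≤ A * (2 ^ β * (1 - (2 : ℝ) ^ (-(β - d)))⁻¹ * (2 ^ β * weight β (2 ^ n) (x - z))) := by
            rw [← Finset.mul_sum]
            gcongr
            refine (sum_weight_high_le hβ n J hJ h3).trans ?_
            gcongr
            · exact mul_nonneg (by positivity) (inv_nonneg.2 (sub_nonneg.2
                (Real.rpow_le_one_of_one_le_of_nonpos one_le_two (by linarith))))
            · exact weight_le_of_norm_le hβ0 (by positivity) (by linarith)
        _ = _ := by
            rw [NNReal.coe_mul, hc₁]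
            ring
    refine h1.trans ?_
    gcongr
    rw [hU, weightedAverage, weightedAverage]
    gcongr with z
    exact enorm_indicator_le_enorm_self _ _
  -- On the double ball `1 + 2^n ‖x - z‖ ≤ 3`, so there the weight is at least `3^{-β} ρ^{-d}`.
  have hnear : ∫⁻ z, ‖f₁ z‖ₑ ≤ (3 : ℝ≥0) ^ β * ENNReal.ofReal (ρ ^ d) * U := by
    rw [hU, weightedAverage, ← lintegral_const_mul' _ _ (by finiteness)]
    refine lintegral_mono fun z => ?_
    by_cases hz : z ∈ B
    · rw [hf₁, indicator_of_mem hz, ← mul_assoc]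
      refine le_mul_of_one_le_left' ?_
      rw [hB, Metric.mem_ball, dist_eq_norm, norm_sub_rev] at hz
      have h1 : 1 + (2 : ℝ) ^ n * ‖x - z‖ ≤ 3 := by
        have : (2 : ℝ) ^ n * ‖x - z‖ ≤ 2 ^ n * (2 * ρ) := by gcongr
        linarith
      have h2 : (3 : ℝ) ^ (-β) ≤ (1 + (2 : ℝ) ^ n * ‖x - z‖) ^ (-β) :=
        Real.rpow_le_rpow_of_nonpos (by positivity) h1 (by linarith)
      have h3 : (1 : ℝ) ≤ 3 ^ β * ρ ^ d * weight β (2 ^ n) (x - z) := by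
        calc (1 : ℝ) = (2 ^ n * ρ) ^ d * (3 ^ β * 3 ^ (-β)) := by
              rw [hnρ, ← Real.rpow_add (by norm_num), add_neg_cancel, Real.rpow_zero]
              simp
          _ ≤ (2 ^ n * ρ) ^ d * (3 ^ β * (1 + (2 : ℝ) ^ n * ‖x - z‖) ^ (-β)) := by gcongr
          _ = _ := by
              rw [weight, mul_pow]
              ring
      have h4 : ((3 : ℝ≥0) : ℝ≥0∞) ^ β = ENNReal.ofReal (3 ^ β) := by
        rw [← ENNReal.ofReal_rpow_of_pos (by norm_num)]
        norm_num
      rw [h4, ← ENNReal.ofReal_mul (by positivity), ← ENNReal.ofReal_mul (by positivity)]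
      exact ENNReal.one_le_ofReal.2 h3
    · simp [hf₁, hz]
  have hsub : volume.restrict (Metric.ball x ρ) {y | (max c₀ c₁ * A * γ : ℝ≥0) +
      (max c₀ c₁ * A : ℝ≥0) * U < ‖conv (kernelSum M J) f y‖ₑ} ≤
      volume {y | ((c₀ * A : ℝ≥0) : ℝ≥0∞) * γ < ‖conv (kernelSum M J) f₁ y‖ₑ} := by
    rw [Measure.restrict_apply' measurableSet_ball]
    refine measure_mono fun y hy => ?_
    obtain ⟨hy1, hy2⟩ := hy
    by_contra hcon
    rw [mem_ofPred_eq] at hy1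
    refine not_le.2 hy1 ?_
    have hcon' : ‖conv (kernelSum M J) f₁ y‖ₑ ≤ ((c₀ * A : ℝ≥0) : ℝ≥0∞) * γ := not_lt.1 hcon
    rw [hadd]
    refine (enorm_add_le _ _).trans (add_le_add (hcon'.trans ?_) ((hfar y hy2).trans ?_))
    · rw [← ENNReal.coe_mul]
      gcongr
      exact le_max_left _ _
    · gcongr
      exact le_max_right _ _
  have hball : volume (Metric.ball x ρ) = ENNReal.ofReal (ρ ^ d) * v := by
    have : Nonempty (Fin d) := ⟨⟨0, hd⟩⟩
    rw [Measure.addHaar_ball _ _ hρ0.le]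
    simp [hv]
  calc _ ≤ γ * volume {y | ((c₀ * A : ℝ≥0) : ℝ≥0∞) * γ < ‖conv (kernelSum M J) f₁ y‖ₑ} := by
        gcongr
    _ ≤ weakConst d * ∫⁻ z, ‖f₁ z‖ₑ := (hCZ A M hM J).weak_one_one hd hf₁i γ
    _ ≤ weakConst d * ((3 : ℝ≥0) ^ β * ENNReal.ofReal (ρ ^ d) * U) := by gcongr
    _ ≤ _ := by
        have h5 : (weakConst d : ℝ≥0∞) * (3 : ℝ≥0) ^ β * ENNReal.ofReal (ρ ^ d) ≤
            (weakConst d * (3 : ℝ≥0) ^ β / v.toNNReal + 1 : ℝ≥0) * volume (Metric.ball x ρ) := by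
          rw [hball, mul_left_comm, mul_comm (ENNReal.ofReal (ρ ^ d))]
          refine mul_le_mul_left ?_ _
          rw [← ENNReal.coe_rpow_of_nonneg _ hβ0, ← ENNReal.coe_mul]
          nth_rewrite 2 [← ENNReal.coe_toNNReal hvt]
          rw [← ENNReal.coe_mul, ENNReal.coe_le_coe, add_mul,
            div_mul_cancel₀ _ (ENNReal.toNNReal_pos hv0 hvt).ne']
          exact le_self_add
        calc _ = (weakConst d : ℝ≥0∞) * (3 : ℝ≥0) ^ β * ENNReal.ofReal (ρ ^ d) * U := by ring
          _ ≤ _ := by gcongr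

variable {β : ℝ} {A : ℝ≥0} {M : ℤ → E d → ℂ}

/-- For large `k` the scales in `[-k, k]` without those in `[-k, n]` are the scales in `(n, k]`, so
the difference of the operators involves only high frequencies. -/
theorem tendsto_conv_high (hM : IsDyadicFamily β A M) {Q R : E d → ℂ} {n : ℤ}
    (hQ : Approximates M (fun k : ℕ => Finset.Icc (-(k : ℤ)) k) Q)
    (hR : Approximates M (fun k : ℕ => Finset.Icc (-(k : ℤ)) n) R) (φ : 𝓢(E d, ℂ)) (x : E d) :
    Tendsto (fun k : ℕ => conv (kernelSum M (Finset.Ioc n k)) φ x) atTop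
      (𝓝 (multiplierOp Q φ x - multiplierOp R φ x)) := by
  refine ((hM.tendsto_conv_multiplierOp hQ φ x).sub
    (hM.tendsto_conv_multiplierOp hR φ x)).congr' ?_
  filter_upwards [eventually_ge_atTop n.natAbs] with k hk
  have hsum : ∀ z, kernelSum M (Finset.Icc (-(k : ℤ)) k) z =
      kernelSum M (Finset.Icc (-(k : ℤ)) n) z + kernelSum M (Finset.Ioc n k) z := by
    intro z
    have hu : Finset.Icc (-(k : ℤ)) k = Finset.Icc (-(k : ℤ)) n ∪ Finset.Ioc n k := by
      ext j
      simp only [Finset.mem_union, Finset.mem_Icc, Finset.mem_Ioc]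
      omega
    rw [kernelSum, hu, Finset.sum_union]
    · rfl
    · refine Finset.disjoint_left.2 fun j h1 h2 => ?_
      rw [Finset.mem_Icc] at h1
      rw [Finset.mem_Ioc] at h2
      omega
  simp only [conv]
  rw [← integral_sub (hM.integrable_mul_kernelSum _ φ.integrable x)
    (hM.integrable_mul_kernelSum _ φ.integrable x)]
  simp only [← mul_sub, hsum, add_sub_cancel_left]

end IsDyadicFamily

theorem exists_seq_schwartz_tendsto {p : ℝ≥0∞} (hp1 : 1 ≤ p) (hp : p ≠ ⊤) {f : E d → ℂ}
    (hf : MemLp f p) : ∃ φ : ℕ → 𝓢(E d, ℂ),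
      Tendsto (fun k => eLpNorm (fun x => φ k x - f x) p volume) atTop (𝓝 0) := by
  choose ψ hψ using fun k : ℕ => exists_schwartz_eLpNorm_sub_le hp1 hp hf
    (Nat.one_div_pos_of_nat (α := ℝ) (n := k))
  refine ⟨ψ, tendsto_of_tendsto_of_tendsto_of_le_of_le tendsto_const_nhds ?_
    (fun k => zero_le) hψ⟩
  simpa using ENNReal.tendsto_ofReal (tendsto_one_div_add_atTop_nhds_zero_nat (𝕜 := ℝ))

theorem weightedAverage_lt_top {β t : ℝ} (hβ : (d : ℝ) < β) (ht : 0 < t) {p : ℝ≥0∞} (hp1 : 1 ≤ p)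
    (hp : p ≠ ⊤) {f : E d → ℂ} (hf : MemLp f p) (x : E d) : weightedAverage β t f x < ⊤ := by
  have hpr : 1 ≤ p.toReal := by
    rw [← ENNReal.toReal_one]
    exact ENNReal.toReal_mono hp hp1
  obtain ⟨c, hc⟩ := exists_lintegral_weight_mul_le_eLpNorm hβ ht hpr
  refine (hc f hf.1 x).trans_lt (ENNReal.mul_lt_top ENNReal.coe_lt_top ?_)
  rw [← eLpNorm_eq_lintegral_rpow_enorm_toReal (one_pos.trans_le hp1).ne' hp]
  exact hf.2

/-- At a fixed point the weighted average is continuous in `L^p`. A strict upper bound `u` therefore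
passes to Schwartz approximations, for which the kernel estimates are available. -/
theorem eventually_weightedAverage_lt {β t : ℝ} (hβ : (d : ℝ) < β) (ht : 0 < t) {p : ℝ≥0∞}
    (hp1 : 1 ≤ p) (hp : p ≠ ⊤) {f : E d → ℂ} (hf : MemLp f p) {φ : ℕ → 𝓢(E d, ℂ)}
    (hφ : Tendsto (fun k => eLpNorm (fun x => φ k x - f x) p volume) atTop (𝓝 0)) (x : E d)
    {u : ℝ≥0∞} (hu : weightedAverage β t f x < u) :
    ∀ᶠ k in atTop, weightedAverage β t (φ k) x < u := by
  have hpr : 1 ≤ p.toReal := by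
    rw [← ENNReal.toReal_one]
    exact ENNReal.toReal_mono hp hp1
  obtain ⟨c, hc⟩ := exists_lintegral_weight_mul_le_eLpNorm hβ ht hpr
  have hlim : Tendsto (fun k => weightedAverage β t f x +
      c * eLpNorm (fun x => φ k x - f x) p volume) atTop (𝓝 (weightedAverage β t f x)) := by
    simpa using tendsto_const_nhds.add
      (ENNReal.Tendsto.const_mul hφ (Or.inr (ENNReal.coe_ne_top (r := c))))
  filter_upwards [hlim.eventually_lt_const hu] with k hk
  refine lt_of_le_of_lt ((weightedAverage_le_add ht.le hf.1 x).trans ?_) hk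
  gcongr
  rw [eLpNorm_eq_lintegral_rpow_enorm_toReal (one_pos.trans_le hp1).ne' hp]
  exact hc _ ((φ k).continuous.aestronglyMeasurable.sub hf.1) x

/-- Local comparison of a multiplier operator with its low frequency part on the ball of radius
`2^{-n}`. -/
theorem exists_local_comparison (hd : 1 ≤ d) {β : ℝ} (hβ : (d : ℝ) < β) (hβd : β < d + 1) :
    ∃ c b : ℝ≥0, 0 < b ∧ ∀ (A₀ : ℝ≥0) (M : ℤ → E d → ℂ), IsDyadicFamily β A₀ M →
      ∀ (Q R : E d → ℂ) (n : ℤ), Approximates M (fun k : ℕ => Finset.Icc (-(k : ℤ)) k) Q →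
      Approximates M (fun k : ℕ => Finset.Icc (-(k : ℤ)) n) R →
      ∀ p : ℝ≥0∞, 1 ≤ p → p ≠ ⊤ → ∀ f : E d → ℂ, MemLp f p → ∀ g h : E d → ℂ,
      (∀ φ : ℕ → 𝓢(E d, ℂ),
        Tendsto (fun k => eLpNorm (fun x => φ k x - f x) p volume) atTop (𝓝 0) →
          TendstoInMeasure volume (fun k => multiplierOp Q (φ k)) atTop g) →
      (∀ φ : ℕ → 𝓢(E d, ℂ),
        Tendsto (fun k => eLpNorm (fun x => φ k x - f x) p volume) atTop (𝓝 0) →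
          TendstoInMeasure volume (fun k => multiplierOp R (φ k)) atTop h) →
      ∀ᵐ x, ∀ A : ℝ≥0, IsDyadicFamily β A M → ∀ u : ℝ≥0, weightedAverage β (2 ^ n) f x < u →
        (∀ᵐ y ∂volume.restrict (Metric.ball x (2 ^ (-n))), ‖h x - h y‖ₑ ≤ (c * A * u : ℝ≥0)) ∧
        ∀ γ : ℝ≥0, γ * volume.restrict (Metric.ball x (2 ^ (-n)))
          {y | ((c * A * γ + c * A * u : ℝ≥0) : ℝ≥0∞) < ‖g y - h y‖ₑ} ≤
            b * volume (Metric.ball x (2 ^ (-n))) * u := by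
  obtain ⟨c₁, hc₁⟩ := IsDyadicFamily.exists_enorm_conv_low_sub_le d hβ hβd
  obtain ⟨c₂, b, hb, hc₂⟩ := IsDyadicFamily.exists_local_weak_type hd hβ hβd
  refine ⟨max c₁ c₂, b, hb, fun A₀ M hM₀ Q R n hQ hR p hp1 hp f hf g h hg hh => ?_⟩
  -- Two successive subsequences turn both convergences in measure into almost everywhere
  -- convergence along one sequence.
  obtain ⟨φ₀, hφ₀⟩ := exists_seq_schwartz_tendsto hp1 hp hf
  obtain ⟨a₁, ha₁, hga⟩ := (hg φ₀ hφ₀).exists_seq_tendsto_ae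
  have hφ₁ : Tendsto (fun k => eLpNorm (fun x => φ₀ (a₁ k) x - f x) p volume) atTop (𝓝 0) :=
    hφ₀.comp ha₁.tendsto_atTop
  obtain ⟨a₂, ha₂, hha⟩ := (hh (fun k => φ₀ (a₁ k)) hφ₁).exists_seq_tendsto_ae
  set φ : ℕ → 𝓢(E d, ℂ) := fun k => φ₀ (a₁ (a₂ k)) with hφdef
  have hφ : Tendsto (fun k => eLpNorm (fun x => φ k x - f x) p volume) atTop (𝓝 0) :=
    hφ₁.comp ha₂.tendsto_atTop
  have hgφ : ∀ᵐ x, Tendsto (fun k => multiplierOp Q (φ k) x) atTop (𝓝 (g x)) := by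
    filter_upwards [hga] with x hx using hx.comp ha₂.tendsto_atTop
  have hhφ : ∀ᵐ x, Tendsto (fun k => multiplierOp R (φ k) x) atTop (𝓝 (h x)) := hha
  have h2n : (0 : ℝ) < 2 ^ n := by positivity
  -- The exceptional null set is fixed before `A`, `u` and `γ`; only convergence of the low part at
  -- `x` is required. This later permits all `δ` and all `B' > B` at once.
  filter_upwards [hhφ] with x hx A hM u hu
  have hev := eventually_weightedAverage_lt hβ h2n hp1 hp hf hφ x hu
  refine ⟨?_, fun γ => ?_⟩
  · filter_upwards [ae_restrict_of_ae hhφ, ae_restrict_mem measurableSet_ball] with y hy hyx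
    refine le_of_tendsto (hx.sub hy).enorm ?_
    filter_upwards [hev] with k hk
    have hxy : (2 : ℝ) ^ n * ‖x - y‖ ≤ 1 := by
      rw [Metric.mem_ball, dist_eq_norm, norm_sub_rev] at hyx
      calc (2 : ℝ) ^ n * ‖x - y‖ ≤ 2 ^ n * 2 ^ (-n) := by gcongr
        _ = 1 := by rw [← zpow_add₀ two_ne_zero, add_neg_cancel, zpow_zero]
    refine le_of_tendsto ((hM.tendsto_conv_multiplierOp hR (φ k) x).sub
      (hM.tendsto_conv_multiplierOp hR (φ k) y)).enorm (Eventually.of_forall fun i => ?_)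
    refine (hc₁ A M hM n _ (fun j hj => (Finset.mem_Icc.1 hj).2) (φ k) (φ k).integrable x y
      hxy).trans ?_
    rw [ENNReal.coe_mul _ u]
    gcongr
    exact le_max_left _ _
  · rcases eq_or_ne γ 0 with rfl | hγ
    · simp
    have hγ0 : (γ : ℝ≥0∞) ≠ 0 := by simpa using hγ
    rw [mul_comm, ← ENNReal.le_div_iff_mul_le (Or.inl hγ0) (Or.inl ENNReal.coe_ne_top)]
    have hu' : ∀ᵐ y ∂volume.restrict (Metric.ball x (2 ^ (-n))),
        Tendsto (fun k => ‖multiplierOp Q (φ k) y - multiplierOp R (φ k) y‖ₑ) atTop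
          (𝓝 ‖g y - h y‖ₑ) := by
      filter_upwards [ae_restrict_of_ae hhφ, ae_restrict_of_ae hgφ] with y hy1 hy2
      exact (hy2.sub hy1).enorm
    refine measure_lt_le_of_tendsto hu' tendsto_const_nhds ?_
    -- A second limit for fixed `k`: the high part acting on `φ k` is itself the limit of finite
    -- kernel sums.
    filter_upwards [hev] with k hk
    refine measure_lt_le_of_tendsto (Eventually.of_forall fun y =>
      (hM.tendsto_conv_high hQ hR (φ k) y).enorm) tendsto_const_nhds
      (Eventually.of_forall fun i => ?_)
    rw [ENNReal.le_div_iff_mul_le (Or.inl hγ0) (Or.inl ENNReal.coe_ne_top), mul_comm]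
    calc _ ≤ γ * volume.restrict (Metric.ball x (2 ^ (-n))) {y | (c₂ * A * γ : ℝ≥0) +
          (c₂ * A : ℝ≥0) * weightedAverage β (2 ^ n) (φ k) x <
          ‖conv (kernelSum M (Finset.Ioc n i)) (φ k) y‖ₑ} := by
          gcongr with y
          rw [ENNReal.coe_add, ENNReal.coe_mul _ u]
          gcongr <;> exact le_max_right _ _
      _ ≤ _ := (hc₂ A M hM n _ (fun j hj => (Finset.mem_Ioc.1 hj).1.le) _ (φ k).integrable x γ)
      _ ≤ _ := by gcongr

/-- Recovering a lower bound for the `r`-average of `g` from a function `h` that is bounded below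
and is close to `g` outside a set of small measure. -/
theorem le_average_rpow_add {X : Type*} [MeasurableSpace X] {μ : Measure X} [IsFiniteMeasure μ]
    (hμ : μ univ ≠ 0) {g h : X → ℂ} (hg : AEStronglyMeasurable g μ) {a s t : ℝ≥0∞} {δ : ℝ}
    (hδ0 : 0 < δ) (hδ : δ ≤ 1 / 2) (hah : ∀ᵐ y ∂μ, a ≤ ‖h y‖ₑ + s)
    (hgh : μ {y | t < ‖g y - h y‖ₑ} ≤ ENNReal.ofReal δ * μ univ) {r : ℝ} (hr : 0 < r) :
    a ≤ ENNReal.ofReal (1 / (1 - δ) ^ (1 / r)) * (⨍⁻ y, ‖g y‖ₑ ^ r ∂μ) ^ (1 / r) + (s + t) := by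
  have hδ1 : 0 < 1 - δ := by linarith
  have hμt : μ univ ≠ ⊤ := measure_ne_top _ _
  -- The subtraction is truncated: if `a ≤ s + t`, then `w = 0` and the claim is trivial. Off the
  -- exceptional set `w ≤ ‖g y‖ₑ`, so this holds on a fraction at least `1 - δ` of the space.
  set w := a - (s + t) with hw
  have hcover : (univ : Set X) ≤ᵐ[μ] ({y | w ≤ ‖g y‖ₑ} ∪ {y | t < ‖g y - h y‖ₑ} : Set X) := by
    filter_upwards [hah] with y hy _
    by_cases hy2 : t < ‖g y - h y‖ₑ
    · exact Or.inr hy2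
    · refine Or.inl (tsub_le_iff_right.2 (hy.trans ?_))
      calc ‖h y‖ₑ + s ≤ ‖g y‖ₑ + ‖g y - h y‖ₑ + s := by
            gcongr
            calc ‖h y‖ₑ = ‖g y - (g y - h y)‖ₑ := by rw [sub_sub_cancel]
              _ ≤ _ := enorm_sub_le
        _ ≤ ‖g y‖ₑ + t + s := by
            gcongr
            exact not_lt.1 hy2
        _ = _ := by rw [add_assoc, add_comm t]
  have h1 : ENNReal.ofReal (1 - δ) * μ univ ≤ μ {y | w ≤ ‖g y‖ₑ} := by
    have h2 : ENNReal.ofReal (1 - δ) * μ univ + ENNReal.ofReal δ * μ univ ≤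
        μ {y | w ≤ ‖g y‖ₑ} + ENNReal.ofReal δ * μ univ := by
      rw [← add_mul, ← ENNReal.ofReal_add hδ1.le hδ0.le, sub_add_cancel, ENNReal.ofReal_one,
        one_mul]
      exact (measure_mono_ae hcover).trans ((measure_union_le _ _).trans (by gcongr))
    exact (ENNReal.add_le_add_iff_right (ENNReal.mul_ne_top ENNReal.ofReal_ne_top hμt)).1 h2
  have h3 : w ^ r * μ {y | w ≤ ‖g y‖ₑ} ≤ ∫⁻ y, ‖g y‖ₑ ^ r ∂μ := by
    have h4 := mul_meas_ge_le_lintegral₀ (hg.enorm.pow_const r) (w ^ r)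
    simpa only [ENNReal.rpow_le_rpow_iff hr] using h4
  have h5 : w ^ r * ENNReal.ofReal (1 - δ) ≤ ⨍⁻ y, ‖g y‖ₑ ^ r ∂μ := by
    rw [laverage_eq, ENNReal.le_div_iff_mul_le (Or.inl hμ) (Or.inl hμt), mul_assoc]
    exact le_trans (by gcongr) h3
  have h6 : w ≤ ENNReal.ofReal (1 / (1 - δ) ^ (1 / r)) * (⨍⁻ y, ‖g y‖ₑ ^ r ∂μ) ^ (1 / r) := by
    have h7 : w ^ r ≤ ENNReal.ofReal (1 / (1 - δ)) * ⨍⁻ y, ‖g y‖ₑ ^ r ∂μ := by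
      calc w ^ r = ENNReal.ofReal (1 / (1 - δ)) * (w ^ r * ENNReal.ofReal (1 - δ)) := by
            rw [mul_left_comm, ← ENNReal.ofReal_mul (by positivity), one_div,
              inv_mul_cancel₀ hδ1.ne', ENNReal.ofReal_one, mul_one]
        _ ≤ _ := by gcongr
    calc w = (w ^ r) ^ (1 / r) := by
          rw [← ENNReal.rpow_mul, mul_one_div_cancel hr.ne', ENNReal.rpow_one]
      _ ≤ (ENNReal.ofReal (1 / (1 - δ)) * ⨍⁻ y, ‖g y‖ₑ ^ r ∂μ) ^ (1 / r) :=
          ENNReal.rpow_le_rpow h7 (by positivity)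
      _ = _ := by
          rw [ENNReal.mul_rpow_of_nonneg _ _ (by positivity),
            ENNReal.ofReal_rpow_of_nonneg (by positivity) (by positivity),
            Real.div_rpow zero_le_one hδ1.le, Real.one_rpow]
  exact tsub_le_iff_right.1 h6

/-- Removes two strict inequalities by continuity: `B < B'` keeps the constant of the dyadic family
positive even when `B(m) = 0`, and `U < U'` leaves room for approximation in `L^p`. -/
theorem le_add_mul_of_forall_lt {a X : ℝ≥0∞} {K B U : ℝ≥0}
    (h : ∀ B' U' : ℝ≥0, B < B' → U < U' → a ≤ X + (K * B' * U' : ℝ≥0)) :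
    a ≤ X + (K * B * U : ℝ≥0) := by
  have hc : Tendsto (fun ε : ℝ≥0 => X + ((K * (B + ε) * (U + ε) : ℝ≥0) : ℝ≥0∞)) (𝓝[>] 0)
      (𝓝 (X + ((K * (B + 0) * (U + 0) : ℝ≥0) : ℝ≥0∞))) := by
    refine Tendsto.mono_left (Continuous.tendsto ?_ 0) nhdsWithin_le_nhds
    fun_prop
  simp only [add_zero] at hc
  refine ge_of_tendsto hc ?_
  filter_upwards [self_mem_nhdsWithin] with ε hε
  exact h _ _ (lt_add_of_pos_right _ hε) (lt_add_of_pos_right _ hε)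

end Cotlar

/-! ### The pointwise inequality for the truncations -/

open Cotlar

theorem proposition3p3 (d : ℕ) (hd : 1 ≤ d) (χ : ℝ → ℝ) (hχ : Cotlar.IsDyadicPartition χ)
    (α : ℝ) (hα : (d : ℝ) < α) :
    ∃ C : ℝ≥0, ∀ m : Cotlar.E d → ℂ, Cotlar.multiplierConst χ α m < ⊤ →
      ∀ p : ℝ≥0∞, 1 ≤ p → p < ⊤ → ∀ f : Cotlar.E d → ℂ, MemLp f p volume →
        -- `S f` and the truncations `S_n f` are well defined
        (∃ Sf : Cotlar.E d → ℂ, Cotlar.IsMultiplierImage m p f Sf) ∧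
        (∀ n : ℤ, ∃ Snf : Cotlar.E d → ℂ,
          Cotlar.IsMultiplierImage (Cotlar.truncMultiplier χ m n) p f Snf) ∧
        -- and they satisfy the pointwise inequality
        ∀ (Sf : Cotlar.E d → ℂ) (Snf : ℤ → Cotlar.E d → ℂ),
          Cotlar.IsMultiplierImage m p f Sf →
          (∀ n : ℤ, Cotlar.IsMultiplierImage (Cotlar.truncMultiplier χ m n) p f (Snf n)) →
          ∀ r : ℝ, 0 < r →
            ∀ᵐ x ∂(volume : Measure (Cotlar.E d)), ∀ δ : ℝ, 0 < δ → δ ≤ 1 / 2 →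
              (⨆ n : ℤ, ‖Snf n x‖ₑ) ≤
                ENNReal.ofReal (1 / (1 - δ) ^ (1 / r)) *
                    (Cotlar.maximalFunction (fun y => ‖Sf y‖ₑ ^ r) x) ^ (1 / r) +
                  C * ENNReal.ofReal δ⁻¹ * Cotlar.multiplierConst χ α m *
                    Cotlar.maximalFunction (fun y => ‖f y‖ₑ) x := by
  -- Above `d`, for integrable weights and the high frequency sum; below `d + 1`, for the low
  -- frequency sum.
  set β : ℝ := min α (d + 1 / 2) with hβdef
  have hβ : (d : ℝ) < β := lt_min hα (by linarith)
  have hβd : β < d + 1 := (min_le_right _ _).trans_lt (by linarith)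
  obtain ⟨C₀, hC₀, hfam⟩ := exists_isDyadicFamily hχ hβ (min_le_left α (d + 1 / 2))
  obtain ⟨c, b, hb, hloc⟩ := exists_local_comparison hd hβ hβd
  obtain ⟨c', hc'⟩ := exists_lintegral_weight_mul_le_maximalFunction hβ
  -- The 2 counts the oscillation of the low part and the far part of the high part, `b` comes from
  -- the weak type level, and `c'` compares the weighted average with the maximal function.
  refine ⟨c * C₀ * (2 + b) * c', fun m hm p hp1 hp f hf => ?_⟩
  obtain ⟨B, hB⟩ : ∃ B : ℝ≥0, (B : ℝ≥0∞) = multiplierConst χ α m :=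
    ⟨_, ENNReal.coe_toNNReal hm.ne⟩
  have hfam' : ∀ B' : ℝ≥0, B < B' → IsDyadicFamily β (C₀ * B') (dyadicPiece χ m) :=
    fun B' hB' => hfam m B' (pos_of_gt hB') (by rw [← hB]; exact_mod_cast hB'.le)
  have hM := hfam' (B + 1) (lt_add_one B)
  have hQ := approximates_multiplier hd hχ m
  have hR := approximates_truncMultiplier hχ m
  refine ⟨hM.exists_multiplierOp_extension hd hβ hβd hQ hp1 hp.ne hf,
    fun n => hM.exists_multiplierOp_extension hd hβ hβd (hR n) hp1 hp.ne hf,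
    fun Sf Snf hSf hSnf r hr => ?_⟩
  have hae : ∀ᵐ x, ∀ n : ℤ, _ := ae_all_iff.2 fun n =>
    hloc _ _ hM _ _ n hQ (hR n) p hp1 hp.ne f hf Sf (Snf n) hSf.2 (hSnf n).2
  filter_upwards [hae] with x hx δ hδ0 hδ
  refine iSup_le fun n => ?_
  have h2n : (0 : ℝ) < 2 ^ n := by positivity
  set ρ : ℝ := 2 ^ (-n) with hρ
  have hρ0 : 0 < ρ := by positivity
  set X : ℝ≥0∞ := ENNReal.ofReal (1 / (1 - δ) ^ (1 / r)) *
    (maximalFunction (fun y => ‖Sf y‖ₑ ^ r) x) ^ (1 / r) with hX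
  obtain ⟨U, hU⟩ : ∃ U : ℝ≥0, (U : ℝ≥0∞) = weightedAverage β (2 ^ n) f x :=
    ⟨_, ENNReal.coe_toNNReal (weightedAverage_lt_top hβ h2n hp1 hp.ne hf x).ne⟩
  obtain ⟨D, hD⟩ : ∃ D : ℝ≥0, (D : ℝ) = δ := CanLift.prf _ hδ0.le
  have hD0 : 0 < D := by rw [← NNReal.coe_pos, hD]; exact hδ0
  have hDδ : ENNReal.ofReal δ = D := by rw [← hD, ENNReal.ofReal_coe_nnreal]
  have hDinv : ENNReal.ofReal δ⁻¹ = (D⁻¹ : ℝ≥0) := by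
    rw [← hD, ← NNReal.coe_inv, ENNReal.ofReal_coe_nnreal]
  have hD1 : 1 ≤ D⁻¹ := by
    rw [one_le_inv₀ hD0, ← NNReal.coe_le_coe, hD]
    exact hδ.trans (by norm_num)
  have key : ‖Snf n x‖ₑ ≤ X + (c * C₀ * (2 + b) * D⁻¹ * B * U : ℝ≥0) := by
    refine le_add_mul_of_forall_lt fun B' U' hB' hU' => ?_
    obtain ⟨hlow, hhigh⟩ := hx n (C₀ * B') (hfam' B' hB') U' (by rw [← hU]; exact_mod_cast hU')
    have hU0 : 0 < U' := pos_of_gt hU'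
    set V := volume (Metric.ball x ρ) with hV
    have hV0 : V ≠ 0 := (Metric.measure_ball_pos _ _ hρ0).ne'
    have : IsFiniteMeasure (volume.restrict (Metric.ball x ρ)) :=
      ⟨by rw [Measure.restrict_apply_univ]; exact measure_ball_lt_top⟩
    -- This level makes the weak type bound `b V U'` equal to `γ δ V`, so the exceptional set has at
    -- most the fraction `δ` of the ball.
    set γ : ℝ≥0 := b * U' * D⁻¹ with hγ
    have hγ0 : 0 < γ := by positivity
    have hbad : volume.restrict (Metric.ball x ρ)
        {y | ((c * (C₀ * B') * γ + c * (C₀ * B') * U' : ℝ≥0) : ℝ≥0∞) < ‖Sf y - Snf n y‖ₑ} ≤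
        ENNReal.ofReal δ * volume.restrict (Metric.ball x ρ) univ := by
      rw [Measure.restrict_apply_univ, hDδ, ← ENNReal.mul_le_mul_iff_right
        (a := (γ : ℝ≥0∞)) (by exact_mod_cast hγ0.ne') ENNReal.coe_ne_top]
      refine (hhigh γ).trans_eq ?_
      rw [← mul_assoc, ← ENNReal.coe_mul, hγ, inv_mul_cancel_right₀ hD0.ne', mul_right_comm,
        ENNReal.coe_mul]
    have hmain := le_average_rpow_add (by rwa [Measure.restrict_apply_univ])
      hSf.1.restrict hδ0 hδ (a := ‖Snf n x‖ₑ) (s := (c * (C₀ * B') * U' : ℝ≥0))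
      (by
        filter_upwards [hlow] with y hy
        calc ‖Snf n x‖ₑ = ‖Snf n y + (Snf n x - Snf n y)‖ₑ := by rw [add_sub_cancel]
          _ ≤ ‖Snf n y‖ₑ + ‖Snf n x - Snf n y‖ₑ := enorm_add_le _ _
          _ ≤ _ := by gcongr) hbad hr
    refine hmain.trans (add_le_add ?_ ?_)
    · rw [hX]
      gcongr
      exact le_iSup₂ (f := fun (ρ : ℝ) (_ : 0 < ρ) =>
        ⨍⁻ y in Metric.ball x ρ, ‖Sf y‖ₑ ^ r ∂volume) ρ hρ0
    · rw [← ENNReal.coe_add, ENNReal.coe_le_coe, hγ]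
      calc _ = c * C₀ * (2 * 1 + b * D⁻¹) * B' * U' := by ring
        -- The terms without `δ⁻¹` are absorbed because `δ⁻¹ ≥ 1`.
        _ ≤ c * C₀ * (2 * D⁻¹ + b * D⁻¹) * B' * U' := by gcongr
        _ = _ := by ring
  refine key.trans (add_le_add_right ?_ _)
  have hUM := hc' _ h2n f hf.1 x
  change weightedAverage β (2 ^ n) f x ≤ _ at hUM
  rw [hDinv, ← hB, ENNReal.coe_mul, hU]
  calc _ ≤ ((c * C₀ * (2 + b) * D⁻¹ * B : ℝ≥0) : ℝ≥0∞) *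
        (c' * maximalFunction (fun y => ‖f y‖ₑ) x) := by gcongr
    _ = _ := by
        push_cast
        ring
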